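/- **Theorem (CLWE to LWE).** Notation. $D_s$ is the Gaussian distribution on $\mathbb{R}$ with density $e^{-\pi (x/s)^2}/s$; $\mathbb{Z}_q=\{0,\dots,q-1\}$, $\mathbb{T}_q=\mathbb{R}/q\mathbb{Z}=[0,q)$, $\mathbb{T}=\mathbb{T}_1$, and $U(X)$ is the uniform distribution on $X$. For a distribution $\mathcal{S}$ over $\mathbb{Z}^n$, $\mathsf{LWE}(m,\mathbb{Z}_q^n,\mathcal{S},D_\sigma)$ is the distribution of $(\mathbf{a}_i,\langle \mathbf{s},\mathbf{a}_i\rangle+e_i \bmod q)_{i\le m}$ with $\mathbf{s}\sim\mathcal{S}$, $\mathbf{a}_i\sim U(\mathbb{Z}_q^n)$, $e_i\sim D_\sigma$ independent. For a distribution $\mathcal{S}'$ over unit vectors, $\mathsf{CLWE}(m,D_1^n,\mathcal{S}',\gamma,\beta)$ is the distribution of $(\mathbf{a}_i,\gamma\langle \mathbf{a}_i,\mathbf{s}\rangle+e_i \bmod 1)_{i\le m}$ with $\mathbf{s}\sim\mathcal{S}'$, $\mathbf{a}_i\sim D_1^n$, $e_i\sim D_\beta$ independent. Algorithms are programs of a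 probabilistic real RAM (exact real registers, index registers for addresses, unit-cost arithmetic, comparisons, indirect addressing, jumps, independent uniform random numbers in $[0,1]$, no rounding instruction); a program may depend on the parameters and on $\mathcal S$, and a $T$-time algorithm has at most $T$ instructions and halts within $T$ steps on every input. A distinguisher $\mathcal{A}$ between $\mathcal{D}_1,\mathcal{D}_2$ has advantage $|\Pr_{x\sim \mathcal{D}_1}[\mathcal{A}(x)=1]-\Pr_{x\sim \mathcal{D}_2}[\mathcal{A}(x)=1]|$. There is an absolute constant $C\ge 1$ such that the following holds. Let $f,g:\mathbb{N}\to\mathbb{R}$ be functions with $f(\lambda),g(\lambda)=\omega(\log\lambda)$, where $f$ grows at most quasi-polynomially, i.e. $f(\lambda)\le e^{(\log\lambda)^{k}}$ for some $k$ and all large $\lambda$. Then there are a polynomial $p$ and a negligible function $\nu$, depending only on $f$ and $g$, such that for all $\lambda\in\mathbb{N}$, all integers $n,m,q\ge 1$ and all reals $r\ge 1$, $\beta>0$ with $$\gamma=r\sqrt{\ln m+\ln n+f(\lambda)}\quad\text{and}\quad \beta q\ \ge\ 3r\sqrt{\ln m+\ln n+g(\lambda)}$$ (a square root of a negative number, possible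 only for small $\lambda$, is read as $0$), there is a $\sigma$ with $\beta q\le\sigma\le C\beta q$ such that for every distribution $\mathcal{S}$ over $\mathbb{Z}^n$ all of whose support has $\ell_2$-norm $r$, every $T\in\mathbb{N}$ and every $\epsilon\in\mathbb{R}$, with $T'=T+p(n,m,\lfloor\log_2 q\rfloor,\lfloor\log_2\lambda\rfloor)$ (where $\lfloor\log_2 0\rfloor:=0$): 1. (Decision.) If there is no $T'$-time distinguisher between $\mathsf{CLWE}(m,D_1^n,\tfrac1r\mathcal{S},\gamma,\beta)$ and $D_1^{n\times m}\times U(\mathbb{T}^m)$ with advantage at least $\epsilon-\nu(\lambda)$, then there is no $T$-time distinguisher between $\mathsf{LWE}(m,\mathbb{Z}_q^n,\mathcal{S},D_\sigma)$ and $U(\mathbb{Z}_q^{n\times m}\times\mathbb{T}_q^m)$ with advantage at least $\epsilon$. 2. (Search.) If there is no $T'$-time algorithm that, given samples from $\mathsf{CLWE}(m,D_1^n,\tfrac1r\mathcal{S},\gamma,\beta)$, outputs their secret with probability at least $\epsilon-\nu(\lambda)$, then there is no $T$-time algorithm that, given samples from $\mathsf{LWE}(m,\mathbb{Z}_q^n,\mathcal{S},D_\sigma)$,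 outputs their secret with probability at least $\epsilon$. -/

import Mathlib

open MeasureTheory ProbabilityTheory Filter

noncomputable section

/-! ### A probabilistic real RAM

The machine has real registers `R 0, R 1, …`, which hold exact real numbers, and index registers
`N 0, N 1, …`, which hold natural numbers and serve as addresses. One instruction is one step.
There is no instruction for rounding a real number to an integer. -/

/-- Instructions of the machine. -/
inductive RAMInstr : Type
  /-- `R i := c` -/
  | const (i : ℕ) (c : ℝ)
  /-- `R i := R j + R k` -/
  | add (i j k : ℕ)
  /-- `R i := R j - R k` -/
  | sub (i j k : ℕ)
  /-- `R i := R j * R k` -/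
  | mul (i j k : ℕ)
  /-- `R i := R j / R k` (and `0` if `R k = 0`) -/
  | div (i j k : ℕ)
  /-- `R i := 1` if `R j ≤ R k`, and `R i := 0` otherwise -/
  | le (i j k : ℕ)
  /-- indirect read: `R i := R (N j)` -/
  | load (i j : ℕ)
  /-- indirect write: `R (N i) := R j` -/
  | store (i j : ℕ)
  /-- `R i :=` a fresh random number, uniform in `[0, 1]` -/
  | rand (i : ℕ)
  /-- continue at line `t` of the program if `R j > 0`, and at the next line otherwise -/
  | jump (j t : ℕ)
  /-- `N i := c` -/
  | idxConst (i c : ℕ)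
  /-- `N i := N j + N k` -/
  | idxAdd (i j k : ℕ)
  /-- `N i := N j - N k` (and `0` if `N j < N k`) -/
  | idxSub (i j k : ℕ)
  /-- continue at line `t` of the program if `N j > 0`, and at the next line otherwise -/
  | idxJump (j t : ℕ)

/-- A program is a finite list of instructions. -/
abbrev RAMProgram : Type := List RAMInstr

/-- A configuration: the line to be executed next and the contents of the registers. -/
structure RAMConfig : Type where
  pc : ℕ
  reg : ℕ → ℝ
  idx : ℕ → ℕ

/-- One step of the program `P`; `u` is the random number available to this step. A configuration
whose line number lies beyond the end of the program is halted and no longer changes. -/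
def RAMProgram.step (P : RAMProgram) (u : ℝ) (c : RAMConfig) : RAMConfig :=
  match P[c.pc]? with
  | none => c
  | some (.const i x) => ⟨c.pc + 1, Function.update c.reg i x, c.idx⟩
  | some (.add i j k) => ⟨c.pc + 1, Function.update c.reg i (c.reg j + c.reg k), c.idx⟩
  | some (.sub i j k) => ⟨c.pc + 1, Function.update c.reg i (c.reg j - c.reg k), c.idx⟩
  | some (.mul i j k) => ⟨c.pc + 1, Function.update c.reg i (c.reg j * c.reg k), c.idx⟩
  | some (.div i j k) => ⟨c.pc + 1, Function.update c.reg i (c.reg j / c.reg k), c.idx⟩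
  | some (.le i j k) =>
      ⟨c.pc + 1, Function.update c.reg i (if c.reg j ≤ c.reg k then 1 else 0), c.idx⟩
  | some (.load i j) => ⟨c.pc + 1, Function.update c.reg i (c.reg (c.idx j)), c.idx⟩
  | some (.store i j) => ⟨c.pc + 1, Function.update c.reg (c.idx i) (c.reg j), c.idx⟩
  | some (.rand i) => ⟨c.pc + 1, Function.update c.reg i u, c.idx⟩
  | some (.jump j t) => ⟨if 0 < c.reg j then t else c.pc + 1, c.reg, c.idx⟩
  | some (.idxConst i a) => ⟨c.pc + 1, c.reg, Function.update c.idx i a⟩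
  | some (.idxAdd i j k) => ⟨c.pc + 1, c.reg, Function.update c.idx i (c.idx j + c.idx k)⟩
  | some (.idxSub i j k) => ⟨c.pc + 1, c.reg, Function.update c.idx i (c.idx j - c.idx k)⟩
  | some (.idxJump j t) => ⟨if 0 < c.idx j then t else c.pc + 1, c.reg, c.idx⟩

/-- Random tapes: step number `t` has access to the random number `ω t`. -/
abbrev RAMTape : Type := ℕ → unitInterval

/-- The random numbers of the different steps are independent and uniform in `[0, 1]`. -/
def ramTapeMeasure : Measure RAMTape := Measure.infinitePi fun _ : ℕ => (volume : Measure unitInterval)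

/-- The configuration after `t` steps, started at line `0` with `x` in the real registers and zeros in
the index registers. -/
def RAMProgram.run (P : RAMProgram) (x : ℕ → ℝ) (ω : RAMTape) : ℕ → RAMConfig
  | 0 => ⟨0, x, fun _ => 0⟩
  | t + 1 => P.step (ω t) (P.run x ω t)

/-- After `t` steps the program has halted. -/
def RAMProgram.HaltsBy (P : RAMProgram) (x : ℕ → ℝ) (ω : RAMTape) (t : ℕ) : Prop :=
  P.length ≤ (P.run x ω t).pc

/-! ### Algorithms that receive `m` samples in dimension `n` -/

/-- Arrays of `m` samples `(aᵢ, bᵢ)` with `aᵢ ∈ ℝⁿ` and `bᵢ ∈ ℝ`. Elements of `ℤ_q` are represented by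
`0, …, q - 1`, and elements of `ℝ/qℤ` by real numbers in `[0, q)`. -/
abbrev Samples (m n : ℕ) : Type := Fin m → (Fin n → ℝ) × ℝ

/-- The initial contents of the real registers on input `x`: the numbers
`a₀₀, …, a₀₍ₙ₋₁₎, b₀, a₁₀, …, a₁₍ₙ₋₁₎, b₁, …` one after the other, followed by zeros. -/
def Samples.toReg {m n : ℕ} (x : Samples m n) (k : ℕ) : ℝ :=
  if hi : k / (n + 1) < m then
    if hj : k % (n + 1) < n then (x ⟨k / (n + 1), hi⟩).1 ⟨k % (n + 1), hj⟩
    else (x ⟨k / (n + 1), hi⟩).2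
  else 0

/-- `P` is a `T`-time algorithm on arrays of `m` samples in dimension `n`: on every input and for all
outcomes of its random choices it halts within `T` steps. Since a program belongs to fixed parameters
and may contain constants that depend on them, its length is also counted as part of the time. -/
def RAMProgram.RunsInTime (P : RAMProgram) (m n T : ℕ) : Prop :=
  P.length ≤ T ∧ ∀ (x : Samples m n) (ω : RAMTape), P.HaltsBy x.toReg ω T

/-- `P` outputs `1` (it halts, with `1` in `R 0`). -/
def RAMProgram.Accepts (P : RAMProgram) {m n : ℕ} (x : Samples m n) (ω : RAMTape) : Prop :=
  ∃ t, P.HaltsBy x.toReg ω t ∧ (P.run x.toReg ω t).reg 0 = 1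

/-- `P` outputs the vector `v` (it halts, with `v` in `R 0, …, R (n - 1)`). -/
def RAMProgram.Outputs (P : RAMProgram) {m n : ℕ} (x : Samples m n) (ω : RAMTape)
    (v : Fin n → ℝ) : Prop :=
  ∃ t, P.HaltsBy x.toReg ω t ∧ ∀ j : Fin n, (P.run x.toReg ω t).reg j = v j

/-- The probability that `P` outputs `1` on an input drawn from `D`. -/
def RAMProgram.acceptProb (P : RAMProgram) {m n : ℕ} (D : Measure (Samples m n)) : ℝ :=
  (D.prod ramTapeMeasure).real {w | P.Accepts w.1 w.2}

/-- There is a `T`-time distinguisher between `D₁` and `D₂` with advantage at least `ε`. -/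
def HasDistinguisher {m n : ℕ} (D₁ D₂ : Measure (Samples m n)) (T : ℕ) (ε : ℝ) : Prop :=
  ∃ P : RAMProgram, P.RunsInTime m n T ∧ ε ≤ |P.acceptProb D₁ - P.acceptProb D₂|

/-- For a joint distribution `J` of a secret and an array of samples: there is a `T`-time algorithm
that on input the samples outputs the secret with probability at least `ε`. -/
def HasSearchSolver {m n : ℕ} (J : Measure ((Fin n → ℝ) × Samples m n)) (T : ℕ) (ε : ℝ) : Prop :=
  ∃ P : RAMProgram, P.RunsInTime m n T ∧
    ε ≤ (J.prod ramTapeMeasure).real {w | P.Outputs w.1.2 w.2 w.1.1}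

/-! ### Distributions -/

/-- The representative of `x` modulo `q` in `[0, q)`. -/
def realMod (x q : ℝ) : ℝ := x - q * ⌊x / q⌋

/-- The Gaussian distribution `D_s` of width `s` on `ℝ`, with density `exp (-π (x/s)²) / s`, that is,
with variance `s² / (2π)`. -/
def gaussianWidth (s : ℝ) : Measure ℝ := gaussianReal 0 (s ^ 2 / (2 * Real.pi)).toNNReal

/-- The distribution `D_sⁿ` on `ℝⁿ`. -/
def gaussianVec (n : ℕ) (s : ℝ) : Measure (Fin n → ℝ) := Measure.pi fun _ => gaussianWidth s

/-- The uniform distribution on `ℤ_q = {0, …, q - 1}`. -/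
def uniformZMod (q : ℕ) : Measure ℝ := uniformOn ((fun k : ℕ => (k : ℝ)) '' Set.Iio q)

/-- The uniform distribution on `ℤ_qⁿ`. -/
def uniformZModVec (n q : ℕ) : Measure (Fin n → ℝ) := Measure.pi fun _ => uniformZMod q

/-- The uniform distribution on the torus `ℝ/qℤ = [0, q)`. -/
def uniformTorus (q : ℝ) : Measure ℝ := cond volume (Set.Ico 0 q)

/-- The distribution of `s` drawn from `S`, as a distribution on `ℝⁿ`, scaled by `c`. -/
def scaledSecret {n : ℕ} (c : ℝ) (S : PMF (Fin n → ℤ)) : Measure (Fin n → ℝ) :=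
  S.toMeasure.map fun s j => c * (s j : ℝ)

/-- The joint distribution of the secret `s` and the samples `(aᵢ, γ ⟨aᵢ, s⟩ + eᵢ mod q)`, `i < m`,
where `s` is drawn from `S`, the `aᵢ` from `A` and the `eᵢ` from `E`, all independently. -/
def noisyJoint (m : ℕ) {n : ℕ} (q γ : ℝ) (A S : Measure (Fin n → ℝ)) (E : Measure ℝ) :
    Measure ((Fin n → ℝ) × Samples m n) :=
  (S.prod ((Measure.pi fun _ : Fin m => A).prod (Measure.pi fun _ : Fin m => E))).map fun w =>
    (w.1, fun i => (w.2.1 i, realMod (γ * ∑ j, w.2.1 i j * w.1 j + w.2.2 i) q))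

/-- The secret and the samples of `LWE(m, A, S, E)` with modulus `q`. -/
def lweJoint (m : ℕ) {n : ℕ} (q : ℕ) (A : Measure (Fin n → ℝ)) (S : PMF (Fin n → ℤ))
    (E : Measure ℝ) : Measure ((Fin n → ℝ) × Samples m n) :=
  noisyJoint m q 1 A (scaledSecret 1 S) E

/-- The distribution `LWE(m, A, S, E)` with modulus `q`. -/
def lweDist (m : ℕ) {n : ℕ} (q : ℕ) (A : Measure (Fin n → ℝ)) (S : PMF (Fin n → ℤ))
    (E : Measure ℝ) : Measure (Samples m n) :=
  (lweJoint m q A S E).map Prod.snd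

/-- The secret and the samples of `CLWE(m, A, S, γ, β)`. -/
def clweJoint (m : ℕ) {n : ℕ} (A S : Measure (Fin n → ℝ)) (γ β : ℝ) :
    Measure ((Fin n → ℝ) × Samples m n) :=
  noisyJoint m 1 γ A S (gaussianWidth β)

/-- The distribution `CLWE(m, A, S, γ, β)`. -/
def clweDist (m : ℕ) {n : ℕ} (A S : Measure (Fin n → ℝ)) (γ β : ℝ) : Measure (Samples m n) :=
  (clweJoint m A S γ β).map Prod.snd

/-- The null distribution: `m` independent samples `(a, b)` with `a` drawn from `A` and, independently,
`b` uniform in `[0, q)`. -/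
def nullDist (m : ℕ) {n : ℕ} (A : Measure (Fin n → ℝ)) (q : ℝ) : Measure (Samples m n) :=
  Measure.pi fun _ : Fin m => A.prod (uniformTorus q)

/-! ### Asymptotic notation -/

/-- `f(λ) = ω(log λ)`. -/
def IsSuperLog (f : ℕ → ℝ) : Prop :=
  Tendsto (fun l : ℕ => f l / Real.log l) atTop atTop

/-- `f` grows at most quasi-polynomially: `log f(λ)` is bounded by a polynomial in `log λ`. -/
def IsQuasiPolyBounded (f : ℕ → ℝ) : Prop :=
  ∃ k : ℕ, ∀ᶠ l : ℕ in atTop, f l ≤ Real.exp (Real.log l ^ k)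

/-- `ν` is negligible: it decays faster than the inverse of every polynomial. -/
def IsNegligible (ν : ℕ → ℝ) : Prop :=
  Asymptotics.SuperpolynomialDecay atTop (fun l : ℕ => (l : ℝ)) ν

end

noncomputable section
set_option linter.unusedSimpArgs false

/-! ### Straight-line code -/

/-- Instructions that only compute with the real registers. -/
def RAMInstr.IsStraight : RAMInstr → Prop
  | .const _ _ | .add _ _ _ | .sub _ _ _ | .mul _ _ _ | .div _ _ _ | .le _ _ _ | .rand _ => True
  | _ => False

/-- The effect of a straight-line instruction on the real registers. -/
def RAMInstr.exec (i : RAMInstr) (u : ℝ) (R : ℕ → ℝ) : ℕ → ℝ :=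
  match i with
  | .const i x => Function.update R i x
  | .add i j k => Function.update R i (R j + R k)
  | .sub i j k => Function.update R i (R j - R k)
  | .mul i j k => Function.update R i (R j * R k)
  | .div i j k => Function.update R i (R j / R k)
  | .le i j k => Function.update R i (if R j ≤ R k then 1 else 0)
  | .rand i => Function.update R i u
  | _ => R

/-- The effect of straight-line code on the real registers. -/
def execCode : List RAMInstr → RAMTape → (ℕ → ℝ) → ℕ → ℝ
  | [], _, R => R
  | i :: l, ω, R => execCode l (fun t => ω (t + 1)) (i.exec (ω 0) R)

theorem execCode_append (l₁ l₂ : List RAMInstr) (ω : RAMTape) (R : ℕ → ℝ) :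
    execCode (l₁ ++ l₂) ω R =
      execCode l₂ (fun t => ω (l₁.length + t)) (execCode l₁ ω R) := by
  induction l₁ generalizing ω R with
  | nil => simp [execCode]
  | cons i l ih =>
    simp only [List.cons_append, execCode, ih, List.length_cons]
    congr 1
    funext t
    congr 1
    omega

theorem RAMProgram.step_of_isStraight {P : RAMProgram} {c : RAMConfig} {i : RAMInstr}
    (hi : P[c.pc]? = some i) (hs : i.IsStraight) (u : ℝ) :
    P.step u c = ⟨c.pc + 1, i.exec u c.reg, c.idx⟩ := by
  unfold RAMProgram.step
  rw [hi]
  cases i <;> simp_all [RAMInstr.IsStraight, RAMInstr.exec]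

/-- Running straight-line code that is embedded in a program. -/
theorem RAMProgram.run_straight {P : RAMProgram} (code : List RAMInstr)
    (hs : ∀ i ∈ code, i.IsStraight) (x : ℕ → ℝ) (ω : RAMTape) (t p : ℕ)
    (hP : ∀ k < code.length, P[p + k]? = code[k]?) (hpc : (P.run x ω t).pc = p) :
    P.run x ω (t + code.length) =
      ⟨p + code.length, execCode code (fun s => ω (t + s)) (P.run x ω t).reg,
        (P.run x ω t).idx⟩ := by
  induction code generalizing t p with
  | nil =>
    simp only [List.length_nil, add_zero, execCode]
    rw [← hpc]
  | cons i l ih =>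
    have h0 : P[(P.run x ω t).pc]? = some i := by
      have := hP 0 (by simp)
      simpa [hpc] using this
    have h1 : P.run x ω (t + 1) =
        ⟨p + 1, i.exec (ω t) (P.run x ω t).reg, (P.run x ω t).idx⟩ := by
      rw [← hpc]
      exact RAMProgram.step_of_isStraight h0 (hs i (by simp)) _
    have h2 := ih (fun j hj => hs j (by simp [hj])) (t + 1) (p + 1) (fun k hk => by
      have := hP (k + 1) (by simpa using hk)
      simpa [add_assoc, add_comm 1 k] using this) (by rw [h1])
    simp only [List.length_cons, execCode]
    rw [show t + (l.length + 1) = t + 1 + l.length by omega, h2, h1]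
    simp only [RAMConfig.mk.injEq, add_zero, and_true]
    refine ⟨by omega, ?_⟩
    congr 1
    funext s
    congr 1
    omega

/-! ### Halting -/

theorem RAMProgram.run_succ (P : RAMProgram) (x : ℕ → ℝ) (ω : RAMTape) (t : ℕ) :
    P.run x ω (t + 1) = P.step (ω t) (P.run x ω t) := rfl

theorem RAMProgram.run_eq_of_haltsBy {P : RAMProgram} {x : ℕ → ℝ} {ω : RAMTape} {t : ℕ}
    (h : P.HaltsBy x ω t) (s : ℕ) : P.run x ω (t + s) = P.run x ω t := by
  induction s with
  | zero => rfl
  | succ s ih =>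
    rw [← add_assoc, RAMProgram.run_succ, ih]
    unfold RAMProgram.step
    rw [List.getElem?_eq_none h]

theorem RAMProgram.run_eq_run_of_haltsBy {P : RAMProgram} {x : ℕ → ℝ} {ω : RAMTape} {t s : ℕ}
    (h : P.HaltsBy x ω t) (h' : P.HaltsBy x ω s) : P.run x ω t = P.run x ω s := by
  rcases le_total t s with hts | hts
  · obtain ⟨d, rfl⟩ := Nat.exists_eq_add_of_le hts
    exact (RAMProgram.run_eq_of_haltsBy h d).symm
  · obtain ⟨d, rfl⟩ := Nat.exists_eq_add_of_le hts
    exact RAMProgram.run_eq_of_haltsBy h' d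

theorem RAMProgram.haltsBy_mono {P : RAMProgram} {x : ℕ → ℝ} {ω : RAMTape} {t s : ℕ}
    (h : P.HaltsBy x ω t) (hts : t ≤ s) : P.HaltsBy x ω s := by
  obtain ⟨d, rfl⟩ := Nat.exists_eq_add_of_le hts
  unfold RAMProgram.HaltsBy
  rw [RAMProgram.run_eq_of_haltsBy h d]
  exact h

theorem RAMProgram.accepts_iff {P : RAMProgram} {m n : ℕ} {x : Samples m n} {ω : RAMTape} {T : ℕ}
    (h : P.HaltsBy x.toReg ω T) : P.Accepts x ω ↔ (P.run x.toReg ω T).reg 0 = 1 := by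
  constructor
  · rintro ⟨t, ht, h1⟩
    rwa [RAMProgram.run_eq_run_of_haltsBy h ht]
  · exact fun h1 => ⟨T, h, h1⟩

theorem RAMProgram.outputs_iff {P : RAMProgram} {m n : ℕ} {x : Samples m n} {ω : RAMTape} {T : ℕ}
    {v : Fin n → ℝ} (h : P.HaltsBy x.toReg ω T) :
    P.Outputs x ω v ↔ ∀ j : Fin n, (P.run x.toReg ω T).reg j = v j := by
  constructor
  · rintro ⟨t, ht, h1⟩
    rwa [RAMProgram.run_eq_run_of_haltsBy h ht]
  · exact fun h1 => ⟨T, h, h1⟩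

/-! ### Sandwiching a program between straight-line code -/

/-- An instruction of a program of length `len`, to be executed at offset `L`. -/
def RAMInstr.relocate (L len : ℕ) : RAMInstr → RAMInstr
  | .jump j t => .jump j (L + min t len)
  | .idxJump j t => .idxJump j (L + min t len)
  | i => i

/-- The program that runs `pre`, then `P`, then `post`. -/
def RAMProgram.sandwich (pre post : List RAMInstr) (P : RAMProgram) : RAMProgram :=
  pre ++ (P.map (RAMInstr.relocate pre.length P.length) ++ post)

theorem RAMProgram.length_sandwich (pre post : List RAMInstr) (P : RAMProgram) :
    (RAMProgram.sandwich pre post P).length = pre.length + P.length + post.length := by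
  simp [RAMProgram.sandwich, add_assoc]

theorem RAMProgram.sandwich_getElem?_pre (pre post : List RAMInstr) (P : RAMProgram) (k : ℕ)
    (hk : k < pre.length) : (RAMProgram.sandwich pre post P)[k]? = pre[k]? := by
  rw [RAMProgram.sandwich, List.getElem?_append_left hk]

theorem RAMProgram.sandwich_getElem?_mid (pre post : List RAMInstr) (P : RAMProgram) (k : ℕ)
    (hk : k < P.length) : (RAMProgram.sandwich pre post P)[pre.length + k]? =
      P[k]?.map (RAMInstr.relocate pre.length P.length) := by
  rw [RAMProgram.sandwich, List.getElem?_append_right (by omega),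
    List.getElem?_append_left (by simpa using hk)]
  simp

theorem RAMProgram.sandwich_getElem?_post (pre post : List RAMInstr) (P : RAMProgram) (k : ℕ) :
    (RAMProgram.sandwich pre post P)[pre.length + P.length + k]? = post[k]? := by
  rw [RAMProgram.sandwich, List.getElem?_append_right (by omega),
    List.getElem?_append_right (by simp; omega)]
  congr 1
  simp
  omega

theorem RAMProgram.step_sandwich (pre post : List RAMInstr) (P : RAMProgram) (u : ℝ)
    (c : RAMConfig) (hc : c.pc < P.length) :
    (RAMProgram.sandwich pre post P).step u ⟨pre.length + c.pc, c.reg, c.idx⟩ =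
      ⟨pre.length + min (P.step u c).pc P.length, (P.step u c).reg, (P.step u c).idx⟩ := by
  have h := RAMProgram.sandwich_getElem?_mid pre post P c.pc hc
  have hm : min (c.pc + 1) P.length = c.pc + 1 := by omega
  obtain ⟨i, hi⟩ : ∃ i, P[c.pc]? = some i := ⟨_, List.getElem?_eq_getElem hc⟩
  unfold RAMProgram.step
  simp only [h, hi, Option.map_some]
  cases i <;> simp only [RAMInstr.relocate, hm, add_assoc]
  all_goals split_ifs <;> simp [hm]

/-- While `P` has not halted, the sandwich simulates it. -/
theorem RAMProgram.run_sandwich_mid (pre post : List RAMInstr) (hpre : ∀ i ∈ pre, i.IsStraight)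
    (P : RAMProgram) (x : ℕ → ℝ) (ω : RAMTape) (t : ℕ)
    (ht : ∀ s < t, ¬ P.HaltsBy (execCode pre ω x) (fun s => ω (pre.length + s)) s) :
    (RAMProgram.sandwich pre post P).run x ω (pre.length + t) =
      ⟨pre.length + min (P.run (execCode pre ω x) (fun s => ω (pre.length + s)) t).pc P.length,
        (P.run (execCode pre ω x) (fun s => ω (pre.length + s)) t).reg,
        (P.run (execCode pre ω x) (fun s => ω (pre.length + s)) t).idx⟩ := by
  induction t with
  | zero =>
    have := RAMProgram.run_straight (P := RAMProgram.sandwich pre post P) pre hpre x ω 0 0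
      (fun k hk => by rw [zero_add]; exact RAMProgram.sandwich_getElem?_pre pre post P k hk) rfl
    simpa [RAMProgram.run] using this
  | succ t ih =>
    have ih' := ih fun s hs => ht s (by omega)
    have hlt := ht t (by omega)
    unfold RAMProgram.HaltsBy at hlt
    rw [← add_assoc, RAMProgram.run_succ, ih', RAMProgram.run_succ,
      min_eq_left (by omega), RAMProgram.step_sandwich _ _ _ _ _ (by omega)]

theorem RAMProgram.run_sandwich (pre post : List RAMInstr) (hpre : ∀ i ∈ pre, i.IsStraight)
    (hpost : ∀ i ∈ post, i.IsStraight) (P : RAMProgram) (x : ℕ → ℝ) (ω : RAMTape) (T : ℕ)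
    (hT : P.HaltsBy (execCode pre ω x) (fun s => ω (pre.length + s)) T) :
    (RAMProgram.sandwich pre post P).HaltsBy x ω (pre.length + T + post.length) ∧
    ∃ ω' : RAMTape, ((RAMProgram.sandwich pre post P).run x ω (pre.length + T + post.length)).reg =
      execCode post ω' (P.run (execCode pre ω x) (fun s => ω (pre.length + s)) T).reg := by
  classical
  have hex : ∃ t, P.HaltsBy (execCode pre ω x) (fun s => ω (pre.length + s)) t := ⟨T, hT⟩
  have hle : Nat.find hex ≤ T := Nat.find_le hT
  have hmid := RAMProgram.run_sandwich_mid pre post hpre P x ω (Nat.find hex)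
    fun s hs => Nat.find_min hex hs
  have hpc := Nat.find_spec hex
  rw [RAMProgram.run_eq_run_of_haltsBy hT hpc]
  generalize Nat.find hex = t at hle hmid hpc
  unfold RAMProgram.HaltsBy at hpc
  rw [min_eq_right hpc] at hmid
  have hend := RAMProgram.run_straight (P := RAMProgram.sandwich pre post P) post hpost x ω
    (pre.length + t) (pre.length + P.length)
    (fun k _ => RAMProgram.sandwich_getElem?_post pre post P k) (by rw [hmid])
  have hhalt : (RAMProgram.sandwich pre post P).HaltsBy x ω (pre.length + t + post.length) := by
    unfold RAMProgram.HaltsBy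
    rw [hend, RAMProgram.length_sandwich]
  have hhalt' := RAMProgram.haltsBy_mono hhalt
    (show pre.length + t + post.length ≤ pre.length + T + post.length by omega)
  refine ⟨hhalt', fun s => ω (pre.length + t + s), ?_⟩
  rw [RAMProgram.run_eq_run_of_haltsBy hhalt' hhalt, hend, hmid]

/-! ### Measurability of runs -/

instance : MeasurableSpace RAMConfig :=
  MeasurableSpace.comap (fun c => (c.pc, c.reg, c.idx)) inferInstance

theorem RAMConfig.measurable_mk {α : Type*} [MeasurableSpace α] {f : α → ℕ} {g : α → ℕ → ℝ}
    {h : α → ℕ → ℕ} (hf : Measurable f) (hg : Measurable g) (hh : Measurable h) :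
    Measurable fun a => (⟨f a, g a, h a⟩ : RAMConfig) := by
  rw [measurable_comap_iff]
  exact hf.prodMk (hg.prodMk hh)

theorem RAMConfig.measurable_toProd :
    Measurable fun c : RAMConfig => (c.pc, c.reg, c.idx) := comap_measurable _

@[fun_prop]
theorem RAMConfig.measurable_pc : Measurable RAMConfig.pc :=
  measurable_fst.comp RAMConfig.measurable_toProd

@[fun_prop]
theorem RAMConfig.measurable_reg : Measurable RAMConfig.reg :=
  measurable_fst.comp (measurable_snd.comp RAMConfig.measurable_toProd)

@[fun_prop]
theorem RAMConfig.measurable_idx : Measurable RAMConfig.idx :=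
  measurable_snd.comp (measurable_snd.comp RAMConfig.measurable_toProd)

@[fun_prop]
theorem measurable_update_of_measurable {α β : Type*} [MeasurableSpace α] [MeasurableSpace β]
    {f : α → ℕ → β} {g : α → β} (i : ℕ) (hf : Measurable f) (hg : Measurable g) :
    Measurable fun a => Function.update (f a) i (g a) := by
  rw [measurable_pi_iff]
  intro j
  by_cases h : j = i
  · subst h; simpa using hg
  · simpa [Function.update_of_ne h] using measurable_pi_iff.1 hf j

theorem measurable_of_countable_index {α β ι : Type*} [MeasurableSpace α] [MeasurableSpace β]
    [MeasurableSpace ι] [Countable ι] [MeasurableSingletonClass ι] {g : ι → α → β} {f : α → ι}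
    (hg : ∀ i, Measurable (g i)) (hf : Measurable f) : Measurable fun a => g (f a) a :=
  (measurable_from_prod_countable_right (f := fun p : ι × α => g p.1 p.2) hg).comp
    (hf.prodMk measurable_id)

theorem RAMProgram.measurable_step (P : RAMProgram) :
    Measurable fun w : ℝ × RAMConfig => P.step w.1 w.2 := by
  have key : ∀ k : ℕ, Measurable fun w : ℝ × RAMConfig =>
      (P.step w.1 ⟨k, w.2.reg, w.2.idx⟩ : RAMConfig) := by
    intro k
    have hreg : ∀ j, Measurable fun w : ℝ × RAMConfig => w.2.reg j := fun j => by fun_prop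
    have hidx : ∀ j, Measurable fun w : ℝ × RAMConfig => w.2.idx j := fun j => by fun_prop
    have hc : Measurable fun w : ℝ × RAMConfig => (⟨k, w.2.reg, w.2.idx⟩ : RAMConfig) :=
      RAMConfig.measurable_mk (by fun_prop) (by fun_prop) (by fun_prop)
    unfold RAMProgram.step
    rcases h : P[k]? with _ | i
    · simpa only [h] using hc
    · simp only [h]
      cases i with
      | const i x => exact RAMConfig.measurable_mk (by fun_prop) (by fun_prop) (by fun_prop)
      | add i j k => exact RAMConfig.measurable_mk (by fun_prop) (by fun_prop) (by fun_prop)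
      | sub i j k => exact RAMConfig.measurable_mk (by fun_prop) (by fun_prop) (by fun_prop)
      | mul i j k => exact RAMConfig.measurable_mk (by fun_prop) (by fun_prop) (by fun_prop)
      | div i j k => exact RAMConfig.measurable_mk (by fun_prop) (by fun_prop) (by fun_prop)
      | le i j k =>
        refine RAMConfig.measurable_mk (by fun_prop) ?_ (by fun_prop)
        exact measurable_update_of_measurable i (by fun_prop)
          (Measurable.ite (measurableSet_le (hreg j) (hreg k)) (by fun_prop) (by fun_prop))
      | load i j =>
        refine RAMConfig.measurable_mk (by fun_prop) ?_ (by fun_prop)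
        exact measurable_update_of_measurable i (by fun_prop)
          (measurable_of_countable_index (g := fun l w => w.2.reg l) hreg (hidx j))
      | store i j =>
        refine RAMConfig.measurable_mk (by fun_prop) ?_ (by fun_prop)
        exact measurable_of_countable_index
          (g := fun l (w : ℝ × RAMConfig) => Function.update w.2.reg l (w.2.reg j))
          (fun l => by fun_prop) (hidx i)
      | rand i => exact RAMConfig.measurable_mk (by fun_prop) (by fun_prop) (by fun_prop)
      | jump j t =>
        refine RAMConfig.measurable_mk ?_ (by fun_prop) (by fun_prop)
        exact Measurable.ite (measurableSet_lt measurable_const (hreg j)) (by fun_prop)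
          (by fun_prop)
      | idxConst i a => exact RAMConfig.measurable_mk (by fun_prop) (by fun_prop) (by fun_prop)
      | idxAdd i j k => exact RAMConfig.measurable_mk (by fun_prop) (by fun_prop) (by fun_prop)
      | idxSub i j k => exact RAMConfig.measurable_mk (by fun_prop) (by fun_prop) (by fun_prop)
      | idxJump j t =>
        refine RAMConfig.measurable_mk ?_ (by fun_prop) (by fun_prop)
        exact Measurable.ite (measurableSet_lt measurable_const (hidx j)) (by fun_prop)
          (by fun_prop)
  exact measurable_of_countable_index (f := fun w : ℝ × RAMConfig => w.2.pc) key (by fun_prop)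

theorem RAMProgram.measurable_run (P : RAMProgram) (t : ℕ) :
    Measurable fun w : (ℕ → ℝ) × RAMTape => P.run w.1 w.2 t := by
  induction t with
  | zero => exact RAMConfig.measurable_mk (by fun_prop) (by fun_prop) (by fun_prop)
  | succ t ih =>
    simp only [RAMProgram.run_succ]
    exact P.measurable_step.comp (Measurable.prodMk (by fun_prop) ih)

theorem Samples.measurable_toReg {m n : ℕ} : Measurable (Samples.toReg : Samples m n → ℕ → ℝ) := by
  rw [measurable_pi_iff]
  intro k
  unfold Samples.toReg
  split_ifs <;> fun_prop

theorem RAMProgram.measurable_run_toReg (P : RAMProgram) {m n : ℕ} (t : ℕ) :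
    Measurable fun w : Samples m n × RAMTape => P.run w.1.toReg w.2 t :=
  (P.measurable_run t).comp ((Samples.measurable_toReg.comp measurable_fst).prodMk measurable_snd)

theorem RAMProgram.measurableSet_haltsBy (P : RAMProgram) (m n : ℕ) (t : ℕ) :
    MeasurableSet {w : Samples m n × RAMTape | P.HaltsBy w.1.toReg w.2 t} :=
  measurableSet_le measurable_const
    (RAMConfig.measurable_pc.comp (P.measurable_run_toReg t))

theorem RAMProgram.measurableSet_accepts (P : RAMProgram) (m n : ℕ) :
    MeasurableSet {w : Samples m n × RAMTape | P.Accepts w.1 w.2} := by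
  simp only [RAMProgram.Accepts, Set.ofPred_exists]
  refine MeasurableSet.iUnion fun t => (P.measurableSet_haltsBy m n t).inter ?_
  exact measurableSet_eq_fun ((measurable_pi_apply 0).comp
    (RAMConfig.measurable_reg.comp (P.measurable_run_toReg t))) measurable_const

theorem RAMProgram.measurableSet_outputs (P : RAMProgram) (m n : ℕ) :
    MeasurableSet {w : ((Fin n → ℝ) × Samples m n) × RAMTape | P.Outputs w.1.2 w.2 w.1.1} := by
  have hg : Measurable fun w : ((Fin n → ℝ) × Samples m n) × RAMTape => (w.1.2, w.2) := by fun_prop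
  simp only [RAMProgram.Outputs, Set.ofPred_exists]
  refine MeasurableSet.iUnion fun t => ((P.measurableSet_haltsBy m n t).preimage hg).inter ?_
  refine (MeasurableSet.iInter fun j : Fin n => measurableSet_eq_fun (f := fun w :
    ((Fin n → ℝ) × Samples m n) × RAMTape => (P.run w.1.2.toReg w.2 t).reg j)
    (g := fun w => w.1.1 j) ?_ (by fun_prop)).congr (by ext; simp; rfl)
  exact (measurable_pi_apply (j : ℕ)).comp
    (RAMConfig.measurable_reg.comp ((P.measurable_run_toReg t).comp hg))

/-! ### The functions computed by the loops -/

/-- Subtract the numbers `w` of the list from `y`, one after the other, whenever possible. -/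
def bitReduce (ws : List ℝ) (y : ℝ) : ℝ :=
  ws.foldl (fun y w => y - (if w ≤ y then 1 else 0) * w) y

/-- Like `bitReduce`, and multiply an accumulator by `exp (κ w)` for each `w` subtracted. -/
def bitExp (κ : ℝ) (ws : List ℝ) (p : ℝ × ℝ) : ℝ × ℝ :=
  ws.foldl (fun p w => (p.1 - (if w ≤ p.1 then 1 else 0) * w,
    p.2 * ((if w ≤ p.1 then 1 else 0) * (Real.exp (κ * w) - 1) + 1))) p

/-- Evaluate the polynomial with coefficient list `As` at `y`; the state is (sum, power). -/
def polySum (As : List ℝ) (y : ℝ) (p : ℝ × ℝ) : ℝ × ℝ :=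
  As.foldl (fun p A => (p.1 + A * p.2, p.2 * y)) p

/-- Count the partial sums of a polynomial that are at most `X`; the state is
(sum, power, count). -/
def polyCount (As : List ℝ) (y X : ℝ) (p : ℝ × ℝ × ℝ) : ℝ × ℝ × ℝ :=
  As.foldl (fun p A => (p.1 + A * p.2.1, p.2.1 * y,
    p.2.2 + (if p.1 + A * p.2.1 ≤ X then 1 else 0))) p

/-! ### Scratch registers -/

/-- Registers below `M` are given by `R`, those from `M` on by `v`. -/
def frame (M : ℕ) (R v : ℕ → ℝ) : ℕ → ℝ := fun i => if i < M then R i else v (i - M)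

/-- Eight scratch values, followed by zeros. -/
def scratch (a₀ a₁ a₂ a₃ a₄ a₅ a₆ a₇ : ℝ) : ℕ → ℝ
  | 0 => a₀ | 1 => a₁ | 2 => a₂ | 3 => a₃ | 4 => a₄ | 5 => a₅ | 6 => a₆ | 7 => a₇ | _ => 0

theorem frame_add (M : ℕ) (R v : ℕ → ℝ) (j : ℕ) : frame M R v (M + j) = v j := by
  simp [frame]

theorem frame_of_lt {M k : ℕ} (h : k < M) (R v : ℕ → ℝ) : frame M R v k = R k := by
  simp [frame, h]

theorem update_frame_add (M : ℕ) (R v : ℕ → ℝ) (j : ℕ) (x : ℝ) :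
    Function.update (frame M R v) (M + j) x = frame M R (Function.update v j x) := by
  funext i
  by_cases h : i = M + j
  · subst h; simp [frame]
  · rw [Function.update_of_ne h]
    unfold frame
    split_ifs with h1
    · rfl
    · rw [Function.update_of_ne (by omega)]

theorem update_frame_of_lt {M k : ℕ} (h : k < M) (R v : ℕ → ℝ) (x : ℝ) :
    Function.update (frame M R v) k x = frame M (Function.update R k x) v := by
  funext i
  by_cases hi : i = k
  · subst hi; simp [frame, h]
  · rw [Function.update_of_ne hi]
    unfold frame
    split_ifs
    · rw [Function.update_of_ne hi]
    · rfl

section ScratchUpdate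
variable (a₀ a₁ a₂ a₃ a₄ a₅ a₆ a₇ x : ℝ)

theorem update_scratch :
    Function.update (scratch a₀ a₁ a₂ a₃ a₄ a₅ a₆ a₇) 0 x = scratch x a₁ a₂ a₃ a₄ a₅ a₆ a₇ ∧
    Function.update (scratch a₀ a₁ a₂ a₃ a₄ a₅ a₆ a₇) 1 x = scratch a₀ x a₂ a₃ a₄ a₅ a₆ a₇ ∧
    Function.update (scratch a₀ a₁ a₂ a₃ a₄ a₅ a₆ a₇) 2 x = scratch a₀ a₁ x a₃ a₄ a₅ a₆ a₇ ∧
    Function.update (scratch a₀ a₁ a₂ a₃ a₄ a₅ a₆ a₇) 3 x = scratch a₀ a₁ a₂ x a₄ a₅ a₆ a₇ ∧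
    Function.update (scratch a₀ a₁ a₂ a₃ a₄ a₅ a₆ a₇) 4 x = scratch a₀ a₁ a₂ a₃ x a₅ a₆ a₇ ∧
    Function.update (scratch a₀ a₁ a₂ a₃ a₄ a₅ a₆ a₇) 5 x = scratch a₀ a₁ a₂ a₃ a₄ x a₆ a₇ ∧
    Function.update (scratch a₀ a₁ a₂ a₃ a₄ a₅ a₆ a₇) 6 x = scratch a₀ a₁ a₂ a₃ a₄ a₅ x a₇ ∧
    Function.update (scratch a₀ a₁ a₂ a₃ a₄ a₅ a₆ a₇) 7 x = scratch a₀ a₁ a₂ a₃ a₄ a₅ a₆ x := by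
  refine ⟨?_, ?_, ?_, ?_, ?_, ?_, ?_, ?_⟩ <;> funext i <;>
    rcases i with _ | _ | _ | _ | _ | _ | _ | _ | i <;> simp [scratch, Function.update]

end ScratchUpdate

/-! ### The loops -/

/-- Code for `bitReduce` on scratch register 1. -/
def reduceCode (M : ℕ) (ws : List ℝ) : List RAMInstr :=
  ws.flatMap fun w => [.const (M + 2) w, .le (M + 3) (M + 2) (M + 1),
    .mul (M + 3) (M + 3) (M + 2), .sub (M + 1) (M + 1) (M + 3)]

/-- Code for `bitExp` on scratch registers 1 and 4. -/
def expCode (κ : ℝ) (M : ℕ) (ws : List ℝ) : List RAMInstr :=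
  ws.flatMap fun w => [.const (M + 2) w, .le (M + 3) (M + 2) (M + 1),
    .mul (M + 2) (M + 3) (M + 2), .sub (M + 1) (M + 1) (M + 2),
    .const (M + 2) (Real.exp (κ * w) - 1), .mul (M + 3) (M + 3) (M + 2), .const (M + 2) 1,
    .add (M + 3) (M + 3) (M + 2), .mul (M + 4) (M + 4) (M + 3)]

/-- Code for `polySum` at the value of scratch register 4, on scratch registers 6 and 5. -/
def sumCode (M : ℕ) (As : List ℝ) : List RAMInstr :=
  As.flatMap fun A => [.const (M + 2) A, .mul (M + 2) (M + 2) (M + 5),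
    .add (M + 6) (M + 6) (M + 2), .mul (M + 5) (M + 5) (M + 4)]

/-- Code for `polyCount` at the value of scratch register 4 with the bound in scratch register 0,
on scratch registers 6, 5 and 7. -/
def countCode (M : ℕ) (As : List ℝ) : List RAMInstr :=
  As.flatMap fun A => [.const (M + 2) A, .mul (M + 2) (M + 2) (M + 5),
    .add (M + 6) (M + 6) (M + 2), .le (M + 3) (M + 6) M, .add (M + 7) (M + 7) (M + 3),
    .mul (M + 5) (M + 5) (M + 4)]

section Loops
variable (M : ℕ) (R : ℕ → ℝ) (a₀ a₁ a₂ a₃ a₄ a₅ a₆ a₇ : ℝ)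

theorem frame_self (v : ℕ → ℝ) : frame M R v M = v 0 := frame_add M R v 0

theorem update_frame_self (v : ℕ → ℝ) (x : ℝ) :
    Function.update (frame M R v) M x = frame M R (Function.update v 0 x) :=
  update_frame_add M R v 0 x

theorem exec_reduceCode (ws : List ℝ) (ω : RAMTape) :
    ∃ b₂ b₃, execCode (reduceCode M ws) ω (frame M R (scratch a₀ a₁ a₂ a₃ a₄ a₅ a₆ a₇)) =
      frame M R (scratch a₀ (bitReduce ws a₁) b₂ b₃ a₄ a₅ a₆ a₇) := by
  induction ws generalizing ω a₁ a₂ a₃ with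
  | nil => exact ⟨a₂, a₃, rfl⟩
  | cons w ws ih =>
    simp only [reduceCode, List.flatMap_cons] at ih ⊢
    rw [execCode_append]
    simp only [execCode, RAMInstr.exec, update_frame_add, frame_add, update_scratch]
    exact ih _ _ _ _

theorem exec_expCode (κ : ℝ) (ws : List ℝ) (ω : RAMTape) :
    ∃ b₂ b₃, execCode (expCode κ M ws) ω (frame M R (scratch a₀ a₁ a₂ a₃ a₄ a₅ a₆ a₇)) =
      frame M R (scratch a₀ (bitExp κ ws (a₁, a₄)).1 b₂ b₃ (bitExp κ ws (a₁, a₄)).2 a₅ a₆ a₇) := by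
  induction ws generalizing ω a₁ a₂ a₃ a₄ with
  | nil => exact ⟨a₂, a₃, rfl⟩
  | cons w ws ih =>
    simp only [expCode, List.flatMap_cons] at ih ⊢
    rw [execCode_append]
    simp only [execCode, RAMInstr.exec, update_frame_add, frame_add, update_scratch]
    exact ih _ _ _ _ _

theorem exec_sumCode (As : List ℝ) (ω : RAMTape) :
    ∃ b₂ b₅, execCode (sumCode M As) ω (frame M R (scratch a₀ a₁ a₂ a₃ a₄ a₅ a₆ a₇)) =
      frame M R (scratch a₀ a₁ b₂ a₃ a₄ b₅ (polySum As a₄ (a₆, a₅)).1 a₇) := by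
  induction As generalizing ω a₂ a₅ a₆ with
  | nil => exact ⟨a₂, a₅, rfl⟩
  | cons A As ih =>
    simp only [sumCode, List.flatMap_cons] at ih ⊢
    rw [execCode_append]
    simp only [execCode, RAMInstr.exec, update_frame_add, frame_add, update_scratch]
    exact ih _ _ _ _

theorem exec_countCode (As : List ℝ) (ω : RAMTape) :
    ∃ b₂ b₃ b₅ b₆, execCode (countCode M As) ω (frame M R (scratch a₀ a₁ a₂ a₃ a₄ a₅ a₆ a₇)) =
      frame M R (scratch a₀ a₁ b₂ b₃ a₄ b₅ b₆ (polyCount As a₄ a₀ (a₆, a₅, a₇)).2.2) := by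
  induction As generalizing ω a₂ a₃ a₅ a₆ a₇ with
  | nil => exact ⟨a₂, a₃, a₅, a₆, rfl⟩
  | cons A As ih =>
    simp only [countCode, List.flatMap_cons] at ih ⊢
    rw [execCode_append]
    simp only [execCode, RAMInstr.exec, update_frame_add, frame_add, update_scratch,
      frame_self, update_frame_self]
    exact ih _ _ _ _ _ _

end Loops

/-! ### Rounding one coordinate -/

/-- The constants of the rounding algorithm: the modulus `q`, the factor `scale` applied to the
input, the number `K` of binary digits of the range, the number `K₂` of binary digits after the
binary point, the range `Z` of the discrete Gaussian distribution and its width `t`. -/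
structure RoundingParams where
  q : ℕ
  scale : ℝ
  K : ℕ
  K₂ : ℕ
  Z : ℕ
  t : ℝ

namespace RoundingParams
variable (p : RoundingParams)

/-- The numbers `c 2^K, …, 2 c, c`. -/
def intBits (c : ℝ) : List ℝ := (List.range (p.K + 1)).map fun i => c * 2 ^ (p.K - i)

/-- The numbers `1/2, 1/4, …, 2^(-K₂)`. -/
def fracBits : List ℝ := (List.range p.K₂).map fun i => (2 ^ (i + 1))⁻¹

/-- The exponent `2π / t²`. -/
def kappa : ℝ := 2 * Real.pi / p.t ^ 2

/-- The Gaussian weights of the integers `j - Z`. -/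
def weight (j : ℕ) : ℝ := Real.exp (-Real.pi * ((j : ℝ) - p.Z) ^ 2 / p.t ^ 2)

/-- The scaled input modulo 1. -/
def frac (v : ℝ) : ℝ := bitReduce (p.intBits 1) (v + 2 ^ p.K)

/-- The base of the powers in the weights of the discrete Gaussian distribution. -/
def base (c : ℝ) : ℝ := (bitExp p.kappa p.fracBits (c, 1)).2

/-- The total weight. -/
def total (y : ℝ) : ℝ := (polySum ((List.range (2 * p.Z + 1)).map p.weight) y (0, 1)).1

/-- The sum of `a` and of the sample selected by `X`. -/
def count (y X a : ℝ) : ℝ :=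
  (polyCount ((List.range (2 * p.Z)).map p.weight) y X (0, 1, a)).2.2

/-- The result of the rounding algorithm on input `a` with random number `u`. -/
def round (a u : ℝ) : ℝ :=
  bitReduce (p.intBits p.q)
    (p.count (p.base (p.frac (a * p.scale))) (u * p.total (p.base (p.frac (a * p.scale))))
      (a * p.scale - p.frac (a * p.scale)) + (p.q * 2 ^ p.K - p.Z))

/-- The rounding algorithm applied to register `k`, with scratch registers from `M` on. -/
def code (M k : ℕ) : List RAMInstr :=
  [.rand M, .const (M + 2) p.scale, .mul (M + 7) k (M + 2), .const (M + 2) (2 ^ p.K),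
    .add (M + 1) (M + 7) (M + 2)] ++ (reduceCode M (p.intBits 1) ++
  ([.sub (M + 7) (M + 7) (M + 1), .const (M + 4) 1] ++ (expCode p.kappa M p.fracBits ++
  ([.const (M + 6) 0, .const (M + 5) 1] ++
  (sumCode M ((List.range (2 * p.Z + 1)).map p.weight) ++
  ([.mul M M (M + 6), .const (M + 6) 0, .const (M + 5) 1] ++
  (countCode M ((List.range (2 * p.Z)).map p.weight) ++
  ([.const (M + 2) (p.q * 2 ^ p.K - p.Z), .add (M + 1) (M + 7) (M + 2)] ++
  (reduceCode M (p.intBits p.q) ++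
  [.const M 0, .const (M + 2) 0, .add k (M + 1) (M + 2), .const (M + 1) 0, .const (M + 3) 0,
    .const (M + 4) 0, .const (M + 5) 0, .const (M + 6) 0, .const (M + 7) 0])))))))))

theorem eq_frame_zero {M : ℕ} {R : ℕ → ℝ} (hR : ∀ i, M ≤ i → R i = 0) :
    R = frame M R (scratch 0 0 0 0 0 0 0 0) := by
  funext i
  unfold frame
  split_ifs with h
  · rfl
  · rw [hR i (by omega)]
    rcases i - M with _ | _ | _ | _ | _ | _ | _ | _ | i <;> rfl

theorem frame_zero_apply {M : ℕ} {R : ℕ → ℝ} {k : ℕ} (hk : k < M) (x : ℝ)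
    (hR : ∀ i, M ≤ i → R i = 0) :
    frame M (Function.update R k x) (scratch 0 0 0 0 0 0 0 0) = Function.update R k x := by
  refine (eq_frame_zero fun i hi => ?_).symm
  rw [Function.update_of_ne (by omega), hR i hi]

theorem exec_code {M k : ℕ} (hk : k < M) (R : ℕ → ℝ) (hR : ∀ i, M ≤ i → R i = 0)
    (ω : RAMTape) :
    execCode (p.code M k) ω R = Function.update R k (p.round (R k) (ω 0)) := by
  conv_lhs => rw [eq_frame_zero hR]
  unfold code
  rw [execCode_append]
  simp only [execCode, RAMInstr.exec, update_frame_add, frame_add, update_scratch, frame_self,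
    update_frame_self, frame_of_lt hk]
  simp only [scratch]
  rw [execCode_append]
  obtain ⟨b₂, b₃, h⟩ := exec_reduceCode M R _ _ _ _ _ _ _ _ (p.intBits 1) _
  rw [h, execCode_append]
  simp only [execCode, RAMInstr.exec, update_frame_add, frame_add, update_scratch, frame_self,
    update_frame_self, frame_of_lt hk]
  simp only [scratch]
  rw [execCode_append]
  obtain ⟨b₂, b₃, h⟩ := exec_expCode M R _ _ _ _ _ _ _ _ p.kappa p.fracBits _
  rw [h, execCode_append]
  simp only [execCode, RAMInstr.exec, update_frame_add, frame_add, update_scratch, frame_self,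
    update_frame_self, frame_of_lt hk]
  rw [execCode_append]
  obtain ⟨b₂, b₅, h⟩ := exec_sumCode M R _ _ _ _ _ _ _ _ ((List.range (2 * p.Z + 1)).map p.weight) _
  rw [h, execCode_append]
  simp only [execCode, RAMInstr.exec, update_frame_add, frame_add, update_scratch, frame_self,
    update_frame_self, frame_of_lt hk]
  simp only [scratch]
  rw [execCode_append]
  obtain ⟨b₂, b₃, b₅, b₆, h⟩ := exec_countCode M R _ _ _ _ _ _ _ _
    ((List.range (2 * p.Z)).map p.weight) _
  rw [h, execCode_append]
  simp only [execCode, RAMInstr.exec, update_frame_add, frame_add, update_scratch, frame_self,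
    update_frame_self, frame_of_lt hk]
  simp only [scratch]
  rw [execCode_append]
  obtain ⟨b₂, b₃, h⟩ := exec_reduceCode M R _ _ _ _ _ _ _ _ (p.intBits p.q) _
  rw [h]
  simp only [execCode, RAMInstr.exec, update_frame_add, frame_add, update_scratch, frame_self,
    update_frame_self, update_frame_of_lt hk]
  simp only [scratch, add_zero]
  exact frame_zero_apply hk _ hR

/-- The length of `code`. -/
def codeLength : ℕ := 8 * (p.K + 1) + 9 * p.K₂ + 20 * p.Z + 27

theorem length_code (M k : ℕ) : (p.code M k).length = p.codeLength := by
  simp [code, reduceCode, expCode, sumCode, countCode, intBits, fracBits, codeLength,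
    List.length_flatMap, Function.comp_def]
  ring

theorem isStraight_code (M k : ℕ) : ∀ i ∈ p.code M k, i.IsStraight := by
  intro i hi
  simp only [code, reduceCode, expCode, sumCode, countCode, List.mem_append, List.mem_flatMap,
    List.mem_cons, List.not_mem_nil, or_false] at hi
  unfold RAMInstr.IsStraight
  aesop

/-! ### Transforming a whole array of samples -/

/-- Multiply register `k` by `q`; padded to the length of `code`. -/
def scaleCode (M k : ℕ) : List RAMInstr :=
  [.const (M + 2) p.q, .mul k k (M + 2)] ++
    List.replicate (p.codeLength - 2) (.const (M + 2) 0)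

theorem length_scaleCode (M k : ℕ) : (p.scaleCode M k).length = p.codeLength := by
  simp [scaleCode, codeLength]

theorem exec_replicate_const (M : ℕ) (R : ℕ → ℝ) (a₂ : ℝ) (N : ℕ) (ω : RAMTape) :
    execCode (List.replicate (N + 1) (.const (M + 2) 0)) ω
      (frame M R (scratch 0 0 a₂ 0 0 0 0 0)) = frame M R (scratch 0 0 0 0 0 0 0 0) := by
  induction N generalizing ω a₂ with
  | zero => simp only [zero_add, List.replicate, execCode, RAMInstr.exec, update_frame_add,
      update_scratch]
  | succ N ih =>
    rw [List.replicate_succ]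
    simp only [execCode, RAMInstr.exec, update_frame_add, update_scratch, ih]

theorem exec_scaleCode {M k : ℕ} (hk : k < M) (R : ℕ → ℝ) (hR : ∀ i, M ≤ i → R i = 0)
    (ω : RAMTape) : execCode (p.scaleCode M k) ω R = Function.update R k (p.q * R k) := by
  conv_lhs => rw [eq_frame_zero hR]
  have : p.codeLength - 2 = (p.codeLength - 3) + 1 := by unfold codeLength; omega
  rw [scaleCode, execCode_append, this]
  simp only [execCode, RAMInstr.exec, update_frame_add, frame_add, update_scratch, frame_of_lt hk,
    update_frame_of_lt hk]
  simp only [scratch]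
  rw [exec_replicate_const, frame_zero_apply hk _ hR, mul_comm]

/-- The code for register `k` of an array of samples in dimension `n`. -/
def blockCode (n M k : ℕ) : List RAMInstr :=
  if k % (n + 1) < n then p.code M k else p.scaleCode M k

/-- The function computed by `blockCode`. -/
def blockFun (n k : ℕ) (a u : ℝ) : ℝ := if k % (n + 1) < n then p.round a u else p.q * a

theorem length_blockCode (n M k : ℕ) : (p.blockCode n M k).length = p.codeLength := by
  unfold blockCode; split_ifs <;> simp [length_code, length_scaleCode]

theorem exec_blockCode (n : ℕ) {M k : ℕ} (hk : k < M) (R : ℕ → ℝ) (hR : ∀ i, M ≤ i → R i = 0)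
    (ω : RAMTape) :
    execCode (p.blockCode n M k) ω R = Function.update R k (p.blockFun n k (R k) (ω 0)) := by
  unfold blockCode blockFun
  split_ifs
  · exact p.exec_code hk R hR ω
  · exact p.exec_scaleCode hk R hR ω

theorem isStraight_blockCode (n M k : ℕ) : ∀ i ∈ p.blockCode n M k, i.IsStraight := by
  unfold blockCode
  split_ifs
  · exact p.isStraight_code M k
  · intro i hi
    simp only [scaleCode, List.mem_append, List.mem_cons, List.not_mem_nil, or_false,
      List.mem_replicate] at hi
    unfold RAMInstr.IsStraight
    aesop

/-- The code that transforms the first `k` registers of an array of samples. -/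
def prefixCode (n M k : ℕ) : List RAMInstr := (List.range k).flatMap (p.blockCode n M)

theorem length_prefixCode (n M k : ℕ) : (p.prefixCode n M k).length = k * p.codeLength := by
  simp [prefixCode, List.length_flatMap, length_blockCode]

theorem isStraight_prefixCode (n M k : ℕ) : ∀ i ∈ p.prefixCode n M k, i.IsStraight := by
  intro i hi
  obtain ⟨j, -, hj⟩ := List.mem_flatMap.1 hi
  exact p.isStraight_blockCode n M j i hj

theorem exec_prefixCode (n : ℕ) {M k : ℕ} (hk : k ≤ M) (R : ℕ → ℝ) (hR : ∀ i, M ≤ i → R i = 0)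
    (ω : RAMTape) : execCode (p.prefixCode n M k) ω R =
      fun i => if i < k then p.blockFun n i (R i) (ω (i * p.codeLength)) else R i := by
  induction k with
  | zero => simp [prefixCode, execCode]
  | succ k ih =>
    have h : p.prefixCode n M (k + 1) = p.prefixCode n M k ++ p.blockCode n M k := by
      simp [prefixCode, List.range_succ]
    rw [h, execCode_append, ih (by omega), p.exec_blockCode n (by omega)]
    · funext i
      rw [length_prefixCode]
      by_cases hi : i = k
      · subst hi; simp
      · rw [Function.update_of_ne hi]
        have : i < k + 1 ↔ i < k := by omega
        simp only [this]
    · intro i hi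
      rw [if_neg (by omega), hR i hi]

/-- The array of samples computed by the prefix code. -/
def transform {m n : ℕ} (x : Samples m n) (u : Fin m → Fin n → ℝ) : Samples m n :=
  fun i => (fun j => p.round ((x i).1 j) (u i j), p.q * (x i).2)

/-- The position on the tape of the random number for entry `j` of sample `i`. -/
def tapePos {m n : ℕ} (i : Fin m) (j : Fin n) : ℕ := (i * (n + 1) + j) * p.codeLength

theorem exec_prefixCode_toReg {m n : ℕ} (x : Samples m n) (ω : RAMTape) :
    execCode (p.prefixCode n (m * (n + 1)) (m * (n + 1))) ω x.toReg =
      (p.transform x fun i j => ω (p.tapePos i j)).toReg := by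
  rw [p.exec_prefixCode n le_rfl]
  · funext k
    have hdiv : k < m * (n + 1) ↔ k / (n + 1) < m := (Nat.div_lt_iff_lt_mul (by omega)).symm
    simp only [hdiv]
    by_cases h1 : k / (n + 1) < m
    · by_cases h2 : k % (n + 1) < n
      · simp only [Samples.toReg, blockFun, transform, h1, h2, dif_pos, if_true, tapePos,
          Nat.div_add_mod']
      · simp only [Samples.toReg, blockFun, transform, h1, h2, dif_pos, if_true, dif_neg,
          not_false_eq_true, if_false]
    · simp [Samples.toReg, h1]
  · intro i hi
    have : ¬ i / (n + 1) < m := by rw [Nat.div_lt_iff_lt_mul (by omega)]; omega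
    simp [Samples.toReg, this]

theorem codeLength_pos : 0 < p.codeLength := by unfold codeLength; omega

theorem tapePos_injective {m n : ℕ} :
    Function.Injective fun ij : Fin m × Fin n => p.tapePos ij.1 ij.2 := by
  rintro ⟨i, j⟩ ⟨i', j'⟩ h
  have h1 : (i : ℕ) * (n + 1) + j = i' * (n + 1) + j' :=
    Nat.eq_of_mul_eq_mul_right p.codeLength_pos h
  have h2 := congrArg (· / (n + 1)) h1
  have h3 := congrArg (· % (n + 1)) h1
  have e1 : ∀ (a : ℕ) (b : Fin n), (a * (n + 1) + b) / (n + 1) = a := fun a b => by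
    rw [mul_comm, Nat.mul_add_div (by omega), Nat.div_eq_of_lt (by omega), add_zero]
  have e2 : ∀ (a : ℕ) (b : Fin n), (a * (n + 1) + b) % (n + 1) = b := fun a b => by
    rw [Nat.mul_add_mod', Nat.mod_eq_of_lt (by omega)]
  simp only [e1, e2] at h2 h3
  simp [Fin.ext_iff, h2, h3]

theorem tapePos_lt {m n : ℕ} (i : Fin m) (j : Fin n) :
    p.tapePos i j < (m * (n + 1)) * p.codeLength := by
  have hj := j.2
  have : ((i : ℕ) + 1) * (n + 1) ≤ m * (n + 1) := Nat.mul_le_mul_right _ i.2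
  refine Nat.mul_lt_mul_of_pos_right ?_ p.codeLength_pos
  rw [add_mul] at this
  omega

end RoundingParams

/-! ### Sums of Gaussian densities over the integers -/

/-- The density of the Gaussian distribution of width `s`. -/
def gaussDensity (s x : ℝ) : ℝ := Real.exp (-Real.pi * x ^ 2 / s ^ 2) / s

theorem gaussDensity_nonneg {s : ℝ} (hs : 0 ≤ s) (x : ℝ) : 0 ≤ gaussDensity s x := by
  unfold gaussDensity; positivity

theorem summable_exp_neg_mul_int_add_sq {s : ℝ} (hs : 0 < s) (x : ℝ) :
    Summable fun n : ℤ => Real.exp (-Real.pi * (x + n) ^ 2 / s ^ 2) := by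
  have h := summable_pow_mul_jacobiTheta₂_term_bound (|x| / s ^ 2) (T := 1 / s ^ 2)
    (by positivity) 0
  refine h.of_nonneg_of_le (fun n => (Real.exp_pos _).le) fun n => ?_
  simp only [pow_zero, one_mul]
  apply Real.exp_le_exp.2
  have h1 : -(|x| * |(n : ℝ)|) ≤ x * n := by
    rw [← abs_mul]; exact neg_abs_le _
  have h2 : -Real.pi * (1 / s ^ 2 * (n : ℝ) ^ 2 - 2 * (|x| / s ^ 2) * ((|n| : ℤ) : ℝ)) =
    -Real.pi * ((n : ℝ) ^ 2 - 2 * (|x| * |(n : ℝ)|)) / s ^ 2 := by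
    push_cast
    field_simp
  rw [h2]
  gcongr ?_ / _
  have := mul_le_mul_of_nonneg_left
    (show (n : ℝ) ^ 2 - 2 * (|x| * |(n : ℝ)|) ≤ (x + n) ^ 2 by nlinarith [sq_nonneg x])
    Real.pi_pos.le
  linarith

theorem summable_gaussDensity {s : ℝ} (hs : 0 < s) (x : ℝ) :
    Summable fun n : ℤ => gaussDensity s (x + n) :=
  (summable_exp_neg_mul_int_add_sq hs x).div_const s

theorem exp_neg_pi_mul_sq_le_half {s : ℝ} (hs : 1 ≤ s) : Real.exp (-Real.pi * s ^ 2) ≤ 1 / 2 := by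
  have h1 : Real.exp (-Real.pi * s ^ 2) ≤ Real.exp (-1) := by
    apply Real.exp_le_exp.2
    nlinarith [Real.pi_gt_three]
  have h2 := Real.exp_one_gt_d9
  rw [Real.exp_neg] at h1
  refine h1.trans ?_
  rw [one_div]
  exact inv_anti₀ (by norm_num) (by linarith)

theorem norm_tsum_le_of_geometric {f : ℕ → ℂ} {x : ℝ} (hx0 : 0 ≤ x) (hx : x ≤ 1 / 2)
    (hf : ∀ n, ‖f n‖ ≤ x * x ^ n) : ‖∑' n, f n‖ ≤ 2 * x := by
  have h := (hasSum_geometric_of_lt_one hx0 (by linarith)).mul_left x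
  refine (tsum_of_norm_bounded h hf).trans ?_
  have : (1 - x)⁻¹ ≤ 2 := inv_le_of_inv_le₀ (by norm_num) (by linarith)
  nlinarith

theorem poisson_gaussDensity {s : ℝ} (hs : 0 < s) (x : ℝ) :
    ((∑' n : ℤ, gaussDensity s (x + n) : ℝ) : ℂ) =
      ∑' n : ℤ, Complex.exp (-Real.pi * ((s ^ 2 : ℝ) : ℂ) * n ^ 2 +
        2 * Real.pi * (-Complex.I * x) * n) := by
  rw [Complex.tsum_exp_neg_quadratic (by rw [Complex.ofReal_re]; positivity)]
  have h1 : ((s ^ 2 : ℝ) : ℂ) ^ (1 / 2 : ℂ) = s := by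
    rw [show (1 / 2 : ℂ) = ((1 / 2 : ℝ) : ℂ) by norm_num, ← Complex.ofReal_cpow (by positivity),
      ← Real.sqrt_eq_rpow, Real.sqrt_sq hs.le]
  rw [h1, Complex.ofReal_tsum, ← tsum_mul_left]
  congr 1
  funext n
  unfold gaussDensity
  rw [Complex.ofReal_div, Complex.ofReal_exp, div_eq_mul_one_div, mul_comm]
  congr 2
  have : Complex.I * (-Complex.I * x) = x := by
    rw [← mul_assoc, mul_neg, Complex.I_mul_I]; simp
  rw [this]
  push_cast
  ring

theorem abs_tsum_gaussDensity_sub_one_le {s : ℝ} (hs : 1 ≤ s) (x : ℝ) :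
    |∑' n : ℤ, gaussDensity s (x + n) - 1| ≤ 4 * Real.exp (-Real.pi * s ^ 2) := by
  set f : ℤ → ℂ := fun n => Complex.exp (-Real.pi * ((s ^ 2 : ℝ) : ℂ) * n ^ 2 +
    2 * Real.pi * (-Complex.I * x) * n) with hf
  set X := Real.exp (-Real.pi * s ^ 2) with hX
  have hnorm : ∀ n : ℤ, ‖f n‖ = Real.exp (-Real.pi * s ^ 2 * (n : ℝ) ^ 2) := by
    intro n
    simp only [hf]
    rw [Complex.norm_exp]
    congr 1
    have : (-(Real.pi : ℂ) * ((s ^ 2 : ℝ) : ℂ) * n ^ 2 + 2 * Real.pi * (-Complex.I * x) * n) =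
      ((-Real.pi * s ^ 2 * (n : ℝ) ^ 2 : ℝ) : ℂ) + ((-(2 * Real.pi * x * n) : ℝ) : ℂ) * Complex.I := by
      push_cast; ring
    rw [this, Complex.add_re, Complex.ofReal_re, Complex.re_ofReal_mul, Complex.I_re, mul_zero,
      add_zero]
  have hle : ∀ n : ℕ, ∀ z : ℤ, ((z : ℝ)) ^ 2 = ((n : ℝ) + 1) ^ 2 → ‖f z‖ ≤ X * X ^ n := by
    intro n z hz
    rw [hnorm, hX, hz, ← Real.exp_nat_mul, ← Real.exp_add]
    apply Real.exp_le_exp.2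
    have h1 : (0:ℝ) ≤ Real.pi * s ^ 2 := by positivity
    nlinarith [mul_nonneg h1 (show (0:ℝ) ≤ ((n : ℝ) + 1) ^ 2 - (n + 1) by nlinarith [n.cast_nonneg (α := ℝ)])]
  have hX0 : 0 ≤ X := (Real.exp_pos _).le
  have hX1 : X ≤ 1 / 2 := exp_neg_pi_mul_sq_le_half hs
  have hp : ∀ n : ℕ, ‖f ((n + 1 : ℕ) : ℤ)‖ ≤ X * X ^ n := fun n => hle n _ (by push_cast; ring)
  have hn : ∀ n : ℕ, ‖f (-((n : ℤ) + 1))‖ ≤ X * X ^ n := fun n => hle n _ (by push_cast; ring)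
  have hgeo : Summable fun n : ℕ => X * X ^ n :=
    (summable_geometric_of_lt_one hX0 (by linarith)).mul_left X
  have sp : Summable fun n : ℕ => f ((n + 1 : ℕ) : ℤ) := hgeo.of_norm_bounded hp
  have sn : Summable fun n : ℕ => f (-((n : ℤ) + 1)) := hgeo.of_norm_bounded hn
  have sp' : Summable fun n : ℕ => f (n : ℤ) :=
    (summable_nat_add_iff (f := fun n : ℕ => f (n : ℤ)) 1).1 sp
  have hsum : ∑' n : ℤ, f n - 1 = ∑' n : ℕ, f ((n + 1 : ℕ) : ℤ) + ∑' n : ℕ, f (-((n : ℤ) + 1)) := by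
    rw [tsum_of_nat_of_neg_add_one sp' sn, sp'.tsum_eq_zero_add]
    have : f ((0 : ℕ) : ℤ) = 1 := by simp [hf]
    rw [this]
    ring
  have hcast : ((∑' n : ℤ, gaussDensity s (x + n) - 1 : ℝ) : ℂ) = ∑' n : ℤ, f n - 1 := by
    rw [Complex.ofReal_sub, poisson_gaussDensity (by linarith)]
    simp [hf]
  rw [← Real.norm_eq_abs, ← Complex.norm_real, hcast, hsum]
  refine (norm_add_le _ _).trans ?_
  linarith [norm_tsum_le_of_geometric hX0 hX1 hp, norm_tsum_le_of_geometric hX0 hX1 hn]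

theorem tsum_gaussDensity_le {s : ℝ} (hs : 1 ≤ s) (x : ℝ) :
    ∑' n : ℤ, gaussDensity s (x + n) ≤ 1 + 4 * Real.exp (-Real.pi * s ^ 2) := by
  linarith [(abs_le.1 (abs_tsum_gaussDensity_sub_one_le hs x)).2]

theorem tsum_le_of_geometric {f : ℕ → ℝ} {X : ℝ} (h0 : ∀ n, 0 ≤ f n)
    (hf : ∀ n, f n ≤ X * (1 / 2) ^ n) : Summable f ∧ ∑' n, f n ≤ 2 * X := by
  have hg := hasSum_geometric_two.mul_left X
  have hs : Summable f := hg.summable.of_nonneg_of_le h0 hf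
  refine ⟨hs, ?_⟩
  have := hs.tsum_le_tsum hf hg.summable
  rw [hg.tsum_eq] at this
  linarith

/-- A window of `2 Z + 1` integers carries almost all the mass of the discrete Gaussian. -/
theorem sum_gaussDensity_ge {t c : ℝ} {Z : ℕ} (ht : 1 ≤ t) (hZ : t ^ 2 ≤ Z) (hc0 : 0 ≤ c)
    (hc1 : c ≤ 1) : 1 - 8 * Real.exp (-Real.pi * t ^ 2) ≤
      ∑ j ∈ Finset.range (2 * Z + 1), gaussDensity t ((j : ℝ) - Z - c) := by
  have ht0 : 0 < t := by linarith
  set X := Real.exp (-Real.pi * t ^ 2) with hX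
  set f : ℤ → ℝ := fun n => gaussDensity t ((-Z - c) + n) with hf
  have hexp : ∀ (i : ℕ) (y : ℝ), ((Z : ℝ) + i) ^ 2 ≤ y ^ 2 →
      gaussDensity t y ≤ X * (1 / 2) ^ i := by
    intro i y hy
    have h1 : gaussDensity t y ≤ Real.exp (-Real.pi * y ^ 2 / t ^ 2) := by
      unfold gaussDensity
      exact div_le_self (Real.exp_pos _).le ht
    refine h1.trans ?_
    have h2 : Real.exp (-Real.pi) ≤ 1 / 2 := by simpa using exp_neg_pi_mul_sq_le_half le_rfl
    have h3 : X * Real.exp (-Real.pi) ^ i ≤ X * (1 / 2) ^ i := by gcongr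
    refine le_trans ?_ h3
    rw [hX, ← Real.exp_nat_mul, ← Real.exp_add]
    apply Real.exp_le_exp.2
    have h4 : (t ^ 2 + i) * t ^ 2 ≤ y ^ 2 := by
      refine le_trans ?_ hy
      have : (1:ℝ) ≤ t ^ 2 := one_le_pow₀ ht
      have hi : (0:ℝ) ≤ i := i.cast_nonneg
      nlinarith [mul_nonneg hi (show (0:ℝ) ≤ Z - t^2 by linarith), mul_nonneg hi hi,
        mul_nonneg (show (0:ℝ) ≤ Z by linarith) (show (0:ℝ) ≤ Z - t^2 by linarith),
        mul_nonneg (sq_nonneg t) (show (0:ℝ) ≤ Z - t^2 by linarith),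
        mul_nonneg (show (0:ℝ) ≤ Z by linarith) hi]
    have h5 : t ^ 2 + i ≤ y ^ 2 / t ^ 2 := by rwa [le_div_iff₀ (by positivity)]
    have := mul_le_mul_of_nonneg_left h5 Real.pi_pos.le
    rw [show -Real.pi * y ^ 2 / t ^ 2 = -(Real.pi * (y ^ 2 / t ^ 2)) by ring]
    linarith
  have hf0 : ∀ z, 0 ≤ f z := fun z => gaussDensity_nonneg ht0.le _
  have hp : ∀ i : ℕ, f ((i + (2 * Z + 1) : ℕ) : ℤ) ≤ X * (1 / 2) ^ i := fun i => by
    apply hexp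
    have : (0:ℝ) ≤ Z + i := by positivity
    have h2 : (-Z - c) + ((((i + (2 * Z + 1) : ℕ) : ℤ)) : ℝ) = Z + i + (1 - c) := by push_cast; ring
    rw [h2]
    nlinarith
  have hn : ∀ i : ℕ, f (-((i : ℤ) + 1)) ≤ X * (1 / 2) ^ i := fun i => by
    apply hexp
    have : (0:ℝ) ≤ Z + i := by positivity
    have h2 : (-Z - c) + (((-((i : ℤ) + 1) : ℤ)) : ℝ) = -(Z + i + (1 + c)) := by push_cast; ring
    rw [h2]
    nlinarith
  obtain ⟨sp, bp⟩ := tsum_le_of_geometric (fun i => hf0 _) hp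
  obtain ⟨sn, bn⟩ := tsum_le_of_geometric (fun i => hf0 _) hn
  have sp' : Summable fun n : ℕ => f (n : ℤ) :=
    (summable_nat_add_iff (f := fun n : ℕ => f (n : ℤ)) (2 * Z + 1)).1 sp
  have htot := (abs_le.1 (abs_tsum_gaussDensity_sub_one_le ht (-Z - c))).1
  have hsplit : ∑' n : ℤ, f n = ∑ j ∈ Finset.range (2 * Z + 1), f (j : ℤ) +
      ∑' i : ℕ, f ((i + (2 * Z + 1) : ℕ) : ℤ) + ∑' i : ℕ, f (-((i : ℤ) + 1)) := by
    rw [tsum_of_nat_of_neg_add_one sp' sn, ← sp'.sum_add_tsum_nat_add (2 * Z + 1)]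
  have hfin : ∑ j ∈ Finset.range (2 * Z + 1), f (j : ℤ) =
      ∑ j ∈ Finset.range (2 * Z + 1), gaussDensity t ((j : ℝ) - Z - c) := by
    refine Finset.sum_congr rfl fun j _ => ?_
    simp only [hf, Int.cast_natCast]
    congr 1
    ring
  change -(4 * X) ≤ ∑' n : ℤ, f n - 1 at htot
  rw [hsplit, hfin] at htot
  linarith

/-! ### Residues -/

theorem realMod_eq_of {x r q : ℝ} (k : ℤ) (h : x = r + q * k) (h0 : 0 ≤ r) (h1 : r < q) :
    realMod x q = r := by
  have hq : 0 < q := by linarith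
  have : ⌊x / q⌋ = k := by
    rw [Int.floor_eq_iff, h, le_div_iff₀ hq, div_lt_iff₀ hq]
    constructor <;> nlinarith
  rw [realMod, this, h]
  ring

theorem realMod_add_mul_int {q : ℝ} (hq : 0 < q) (x : ℝ) (k : ℤ) :
    realMod (x + q * k) q = realMod x q := by
  have : (x + q * k) / q = x / q + k := by field_simp
  rw [realMod, realMod, this, Int.floor_add_intCast]
  push_cast
  ring

theorem mul_realMod {q : ℝ} (hq : 0 < q) (x : ℝ) : q * realMod x 1 = realMod (q * x) q := by
  rw [realMod, realMod, mul_div_cancel_left₀ x hq.ne']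
  simp only [div_one, one_mul]
  ring

theorem exists_realMod_eq (q x : ℝ) : ∃ k : ℤ, realMod x q = x + q * k :=
  ⟨-⌊x / q⌋, by rw [realMod]; push_cast; ring⟩

theorem realMod_one (x : ℝ) : realMod x 1 = Int.fract x := by
  rw [realMod, div_one, one_mul, Int.self_sub_floor]

@[fun_prop]
theorem measurable_realMod (q : ℝ) : Measurable fun x => realMod x q := by
  unfold realMod
  have h : Measurable fun x : ℝ => ((⌊x / q⌋ : ℤ) : ℝ) :=
    (measurable_from_top (f := fun z : ℤ => (z : ℝ))).comp
      (Int.measurable_floor.comp (measurable_id.div_const q))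
  fun_prop

/-! ### The values of the loops -/

namespace RoundingParams
variable (p : RoundingParams)

theorem bitReduce_intBits_eq_realMod {c y : ℝ} (h0 : 0 ≤ y) (h1 : y < c * 2 ^ (p.K + 1)) :
    bitReduce (p.intBits c) y = realMod y c := by
  have key : ∀ i ≤ p.K + 1, ∃ k : ℤ,
      y = bitReduce ((List.range i).map fun i => c * 2 ^ (p.K - i)) y + c * k ∧
      0 ≤ bitReduce ((List.range i).map fun i => c * 2 ^ (p.K - i)) y ∧
      bitReduce ((List.range i).map fun i => c * 2 ^ (p.K - i)) y < c * 2 ^ (p.K + 1 - i) := by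
    intro i hi
    induction i with
    | zero => exact ⟨0, by simp [bitReduce], by simpa [bitReduce], by simpa [bitReduce]⟩
    | succ i ih =>
      obtain ⟨k, e, l0, l1⟩ := ih (by omega)
      rw [List.range_succ, List.map_append]
      simp only [bitReduce, List.foldl_append, List.map_cons, List.map_nil, List.foldl_cons,
        List.foldl_nil] at e l0 l1 ⊢
      set Y := List.foldl (fun (y w : ℝ) => y - (if w ≤ y then 1 else 0) * w) y
        ((List.range i).map fun i => c * 2 ^ (p.K - i))
      have hp : (2:ℝ) ^ (p.K + 1 - i) = 2 * 2 ^ (p.K - i) := by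
        rw [show p.K + 1 - i = (p.K - i) + 1 by omega, pow_succ]; ring
      have hp' : p.K + 1 - (i + 1) = p.K - i := by omega
      rw [hp] at l1
      rw [hp']
      split_ifs with h
      · refine ⟨k + 2 ^ (p.K - i), ?_, by linarith, by linarith⟩
        push_cast
        linarith
      · exact ⟨k, by linarith, by linarith, by linarith⟩
  obtain ⟨k, e, l0, l1⟩ := key (p.K + 1) le_rfl
  rw [Nat.sub_self, pow_zero, mul_one] at l1
  exact (realMod_eq_of k e l0 l1).symm

theorem frac_eq_fract {v : ℝ} (h : |v| < 2 ^ p.K) : p.frac v = Int.fract v := by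
  rw [abs_lt] at h
  unfold frac
  rw [p.bitReduce_intBits_eq_realMod (by linarith) (by rw [pow_succ]; linarith), realMod_one]
  have : (2:ℝ) ^ p.K = ((2 ^ p.K : ℕ) : ℝ) := by push_cast; rfl
  rw [this, Int.fract_add_natCast]

theorem base_bounds {c : ℝ} (h0 : 0 ≤ c) (h1 : c < 1) (ht : 0 < p.t) :
    Real.exp (p.kappa * (c - (2 ^ p.K₂)⁻¹)) ≤ p.base c ∧ p.base c ≤ Real.exp (p.kappa * c) := by
  have key : ∀ i, (bitExp p.kappa ((List.range i).map fun i => (2 ^ (i + 1))⁻¹) (c, 1)).2 =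
        Real.exp (p.kappa *
          (c - (bitExp p.kappa ((List.range i).map fun i => (2 ^ (i + 1))⁻¹) (c, 1)).1)) ∧
      0 ≤ (bitExp p.kappa ((List.range i).map fun i => (2 ^ (i + 1))⁻¹) (c, 1)).1 ∧
      (bitExp p.kappa ((List.range i).map fun i => (2 ^ (i + 1))⁻¹) (c, 1)).1 < (2 ^ i)⁻¹ := by
    intro i
    induction i with
    | zero => simpa [bitExp] using ⟨h0, h1⟩
    | succ i ih =>
      obtain ⟨e, l0, l1⟩ := ih
      rw [List.range_succ, List.map_append]
      simp only [bitExp, List.foldl_append, List.map_cons, List.map_nil, List.foldl_cons,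
        List.foldl_nil] at e l0 l1 ⊢
      set Y := List.foldl (fun (p_1 : ℝ × ℝ) w => (p_1.1 - (if w ≤ p_1.1 then 1 else 0) * w,
        p_1.2 * ((if w ≤ p_1.1 then 1 else 0) * (Real.exp (p.kappa * w) - 1) + 1))) (c, 1)
        ((List.range i).map fun i => ((2:ℝ) ^ (i + 1))⁻¹)
      have hp : ((2:ℝ) ^ i)⁻¹ = 2 * (2 ^ (i + 1))⁻¹ := by rw [pow_succ]; field_simp
      rw [hp] at l1
      split_ifs with h
      · refine ⟨?_, by linarith, by linarith⟩
        rw [e, one_mul, one_mul, sub_add_cancel, ← Real.exp_add]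
        congr 1
        ring
      · refine ⟨?_, by linarith, by linarith⟩
        rw [e]
        simp
  obtain ⟨e, l0, l1⟩ := key p.K₂
  have hk : 0 ≤ p.kappa := by unfold kappa; positivity
  change p.base c = _ at e
  rw [e]
  constructor <;> apply Real.exp_le_exp.2 <;> apply mul_le_mul_of_nonneg_left _ hk <;> linarith

/-- Partial sums of the weights. -/
def partialSum (y : ℝ) (j : ℕ) : ℝ := ∑ l ∈ Finset.range j, p.weight l * y ^ l

theorem polySum_eq (y : ℝ) (N : ℕ) :
    polySum ((List.range N).map p.weight) y (0, 1) = (p.partialSum y N, y ^ N) := by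
  induction N with
  | zero => simp [polySum, partialSum]
  | succ N ih =>
    simp only [polySum, List.range_succ, List.map_append, List.foldl_append, List.map_cons,
      List.map_nil, List.foldl_cons, List.foldl_nil] at ih ⊢
    rw [ih, partialSum, partialSum, Finset.sum_range_succ, pow_succ]

theorem total_eq (y : ℝ) : p.total y = p.partialSum y (2 * p.Z + 1) := by
  rw [total, polySum_eq]

/-- The number of partial sums, up to the last but one, that are at most `X`. -/
def select (y X : ℝ) : ℕ :=
  ((Finset.range (2 * p.Z)).filter fun j => p.partialSum y (j + 1) ≤ X).card

theorem polyCount_eq (y X a : ℝ) (N : ℕ) :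
    polyCount ((List.range N).map p.weight) y X (0, 1, a) = (p.partialSum y N, y ^ N,
      a + (((Finset.range N).filter fun j => p.partialSum y (j + 1) ≤ X).card : ℝ)) := by
  induction N with
  | zero => simp [polyCount, show p.partialSum y 0 = 0 by simp [partialSum]]
  | succ N ih =>
    simp only [polyCount, List.range_succ, List.map_append, List.foldl_append, List.map_cons,
      List.map_nil, List.foldl_cons, List.foldl_nil] at ih ⊢
    have h : p.partialSum y (N + 1) = p.partialSum y N + p.weight N * y ^ N := by
      rw [partialSum, partialSum, Finset.sum_range_succ]
    rw [ih, pow_succ, Finset.range_add_one, Finset.filter_insert, h]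
    split_ifs
    · rw [Finset.card_insert_of_notMem (by simp)]
      push_cast
      simp only [Prod.mk.injEq, true_and]
      ring
    · simp

theorem count_eq (y X a : ℝ) : p.count y X a = a + p.select y X := by
  rw [count, polyCount_eq, select]

theorem select_le (y X : ℝ) : p.select y X ≤ 2 * p.Z := by
  refine (Finset.card_filter_le _ _).trans ?_
  rw [Finset.card_range]

theorem weight_pos (j : ℕ) : 0 < p.weight j := Real.exp_pos _

theorem partialSum_mono {y : ℝ} (hy : 0 < y) : Monotone (p.partialSum y) := by
  refine monotone_nat_of_le_succ fun j => ?_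
  rw [partialSum, partialSum, Finset.sum_range_succ]
  have := mul_pos (p.weight_pos j) (pow_pos hy j)
  linarith

theorem total_pos {y : ℝ} (hy : 0 < y) : 0 < p.total y := by
  rw [total_eq]
  exact Finset.sum_pos (fun j _ => mul_pos (p.weight_pos j) (pow_pos hy j)) (by simp)

theorem select_bounds {y X : ℝ} (hy : 0 < y) (h0 : 0 ≤ X) (hX : X ≤ p.total y) :
    p.partialSum y (p.select y X) ≤ X ∧ X ≤ p.partialSum y (p.select y X + 1) := by
  have hmono := p.partialSum_mono hy
  constructor
  · by_contra! h
    have hpos : 0 < p.select y X := by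
      rcases Nat.eq_zero_or_pos (p.select y X) with h2 | h2
      · rw [h2] at h; simp [partialSum] at h; linarith
      · exact h2
    have hsub : ((Finset.range (2 * p.Z)).filter fun j => p.partialSum y (j + 1) ≤ X) ⊆
        Finset.range (p.select y X - 1) := by
      intro j hj
      rw [Finset.mem_filter] at hj
      rw [Finset.mem_range]
      by_contra! h3
      have := hmono (show p.select y X ≤ j + 1 by omega)
      linarith [hj.2]
    have := Finset.card_le_card hsub
    rw [Finset.card_range] at this
    change p.select y X ≤ _ at this
    omega
  · by_contra! h
    have hlt : p.select y X < 2 * p.Z := by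
      rcases (p.select_le y X).lt_or_eq with h2 | h2
      · exact h2
      · rw [h2, ← total_eq] at h; linarith
    have hsub : Finset.range (p.select y X + 1) ⊆
        ((Finset.range (2 * p.Z)).filter fun j => p.partialSum y (j + 1) ≤ X) := by
      intro j hj
      rw [Finset.mem_range] at hj
      rw [Finset.mem_filter, Finset.mem_range]
      exact ⟨by omega, (hmono (show j + 1 ≤ p.select y X + 1 by omega)).trans h.le⟩
    have := Finset.card_le_card hsub
    rw [Finset.card_range] at this
    change _ ≤ p.select y X at this
    omega

theorem volume_select_le {y : ℝ} (hy : 0 < y) (j : ℕ) :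
    volume {u : unitInterval | p.select y (u * p.total y) = j} ≤
      ENNReal.ofReal (p.weight j * y ^ j / p.total y) := by
  have hW := p.total_pos hy
  have hsub : (Subtype.val '' {u : unitInterval | p.select y (u * p.total y) = j}) ⊆
      Set.Icc (p.partialSum y j / p.total y) (p.partialSum y (j + 1) / p.total y) := by
    rintro _ ⟨u, hu, rfl⟩
    have h := p.select_bounds hy (X := u * p.total y) (mul_nonneg u.2.1 hW.le)
      (by nlinarith [u.2.2])
    change p.select y (u * p.total y) = j at hu
    rw [hu] at h
    exact ⟨by rw [div_le_iff₀ hW]; exact h.1, by rw [le_div_iff₀ hW]; exact h.2⟩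
  rw [unitInterval.volume_apply]
  refine (measure_mono hsub).trans ?_
  rw [Real.volume_Icc, partialSum, partialSum, Finset.sum_range_succ]
  apply le_of_eq
  congr 1
  ring

/-- The probabilities of the sampler are dominated by the Gaussian density. -/
theorem weight_mul_pow_div_total_le {c : ℝ} (h0 : 0 ≤ c) (h1 : c < 1) (ht : 1 ≤ p.t)
    (hZ : p.t ^ 2 ≤ p.Z) (hx : 8 * Real.exp (-Real.pi * p.t ^ 2) < 1) (j : ℕ) :
    p.weight j * p.base c ^ j / p.total (p.base c) ≤
      Real.exp (2 * p.Z * p.kappa * (2 ^ p.K₂)⁻¹) / (1 - 8 * Real.exp (-Real.pi * p.t ^ 2)) *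
        gaussDensity p.t (j - p.Z - c) := by
  have ht0 : 0 < p.t := by linarith
  obtain ⟨hlo, hhi⟩ := p.base_bounds h0 h1 ht0
  have hy : 0 < p.base c := (Real.exp_pos _).trans_le hlo
  have hk : 0 ≤ p.kappa := by unfold kappa; positivity
  set d : ℝ := (2 ^ p.K₂)⁻¹ with hd
  have hd0 : 0 ≤ d := by positivity
  set E := Real.exp (Real.pi * c ^ 2 / p.t ^ 2 + p.kappa * c * p.Z) * p.t with hE
  have hE0 : 0 < E := by positivity
  set θ := 2 * p.Z * p.kappa * d with hθ
  have hw : ∀ l : ℕ, p.weight l * Real.exp (p.kappa * c * l) =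
      E * gaussDensity p.t (l - p.Z - c) := by
    intro l
    rw [weight, hE, gaussDensity, ← Real.exp_add]
    field_simp
    rw [← Real.exp_add]
    congr 1
    unfold kappa
    field_simp
    ring
  have hnum : p.weight j * p.base c ^ j ≤ E * gaussDensity p.t (j - p.Z - c) := by
    rw [← hw]
    refine mul_le_mul_of_nonneg_left ?_ (p.weight_pos j).le
    refine (pow_le_pow_left₀ hy.le hhi j).trans (le_of_eq ?_)
    rw [← Real.exp_nat_mul]
    congr 1
    ring
  have hden : Real.exp (-θ) * E * (1 - 8 * Real.exp (-Real.pi * p.t ^ 2)) ≤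
      p.total (p.base c) := by
    refine (mul_le_mul_of_nonneg_left (sum_gaussDensity_ge ht hZ h0 h1.le) (by positivity)).trans ?_
    rw [total_eq, partialSum, Finset.mul_sum]
    refine Finset.sum_le_sum fun l hl => ?_
    have hl' : (l : ℝ) ≤ 2 * p.Z := by
      rw [Finset.mem_range] at hl
      exact_mod_cast Nat.lt_succ_iff.1 hl
    rw [mul_assoc, ← hw, mul_left_comm]
    refine mul_le_mul_of_nonneg_left ?_ (p.weight_pos l).le
    refine le_trans ?_ (pow_le_pow_left₀ (Real.exp_pos _).le hlo l)
    rw [← Real.exp_nat_mul, ← Real.exp_add]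
    apply Real.exp_le_exp.2
    have := mul_le_mul_of_nonneg_right hl' (mul_nonneg hk hd0)
    rw [hθ]
    linarith
  have hg : 0 ≤ gaussDensity p.t (j - p.Z - c) := gaussDensity_nonneg ht0.le _
  have hpos : 0 < Real.exp (-θ) * E * (1 - 8 * Real.exp (-Real.pi * p.t ^ 2)) :=
    mul_pos (by positivity) (by linarith)
  calc p.weight j * p.base c ^ j / p.total (p.base c)
      ≤ E * gaussDensity p.t (j - p.Z - c) /
        (Real.exp (-θ) * E * (1 - 8 * Real.exp (-Real.pi * p.t ^ 2))) :=
        div_le_div₀ (by positivity) hnum hpos hden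
    _ = _ := by
        rw [Real.exp_neg]
        have : 1 - 8 * Real.exp (-Real.pi * p.t ^ 2) ≠ 0 := by linarith
        field_simp

/-- The integer to which `v` is rounded with random number `u`. -/
def roundInt (v u : ℝ) : ℤ :=
  ⌊v⌋ + (p.select (p.base (Int.fract v)) (u * p.total (p.base (Int.fract v))) : ℤ) - p.Z

theorem round_eq_realMod (hq : 1 ≤ p.q) {a : ℝ} (u : ℝ)
    (h : |a * p.scale| + (p.Z + 1) ≤ 2 ^ p.K) :
    p.round a u = realMod (p.roundInt (a * p.scale) u) p.q := by
  have hZ : (0:ℝ) ≤ p.Z := Nat.cast_nonneg _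
  have hq' : (1:ℝ) ≤ p.q := by exact_mod_cast hq
  unfold round
  rw [p.frac_eq_fract (by linarith), count_eq]
  set v := a * p.scale
  set D := p.select (p.base (Int.fract v)) (u * p.total (p.base (Int.fract v))) with hD
  have hDle : (D : ℝ) ≤ 2 * p.Z := by exact_mod_cast p.select_le _ _
  have hD0 : (0:ℝ) ≤ D := Nat.cast_nonneg _
  have hv := abs_le.1 (show |v| ≤ 2 ^ p.K - (p.Z + 1) by linarith)
  have hfl := Int.sub_one_lt_floor v
  have hfl' := Int.floor_le v
  have hpow : (0:ℝ) < 2 ^ p.K := by positivity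
  have hmul : (2:ℝ) ^ p.K ≤ p.q * 2 ^ p.K := le_mul_of_one_le_left hpow.le hq'
  have e : v - Int.fract v = ⌊v⌋ := by rw [Int.fract]; ring
  rw [e, p.bitReduce_intBits_eq_realMod (by linarith)
    (by rw [pow_succ]; nlinarith)]
  have : (⌊v⌋ : ℝ) + D + (p.q * 2 ^ p.K - p.Z) =
      ((p.roundInt v u : ℤ) : ℝ) + p.q * ((2 ^ p.K : ℤ) : ℝ) := by
    unfold roundInt
    push_cast
    rw [← hD]
    ring
  rw [this, realMod_add_mul_int (by linarith)]

end RoundingParams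

/-! ### Gaussian and discrete uniform measures -/

theorem gaussianWidth_eq_withDensity {s : ℝ} (hs : 0 < s) :
    gaussianWidth s = volume.withDensity fun x => ENNReal.ofReal (gaussDensity s x) := by
  have hv : (s ^ 2 / (2 * Real.pi)).toNNReal ≠ 0 := by
    rw [Ne, Real.toNNReal_eq_zero, not_le]
    positivity
  rw [gaussianWidth, gaussianReal_of_var_ne_zero _ hv]
  congr 1
  funext x
  rw [gaussianPDF, gaussianPDFReal, gaussDensity, Real.coe_toNNReal _ (by positivity)]
  have h1 : 2 * Real.pi * (s ^ 2 / (2 * Real.pi)) = s ^ 2 := by field_simp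
  rw [h1, Real.sqrt_sq hs.le, inv_mul_eq_div]
  congr 3
  field_simp
  ring

theorem measurable_gaussDensity (s : ℝ) : Measurable (gaussDensity s) := by
  unfold gaussDensity; fun_prop

theorem lintegral_gaussianWidth {s : ℝ} (hs : 0 < s) {F : ℝ → ENNReal} (hF : Measurable F) :
    ∫⁻ x, F x ∂gaussianWidth s = ∫⁻ x, ENNReal.ofReal (gaussDensity s x) * F x := by
  rw [gaussianWidth_eq_withDensity hs,
    lintegral_withDensity_eq_lintegral_mul _ (measurable_gaussDensity s).ennreal_ofReal hF]
  rfl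

instance (s : ℝ) : IsProbabilityMeasure (gaussianWidth s) := by
  unfold gaussianWidth; infer_instance

theorem map_mul_gaussianWidth (s c : ℝ) :
    (gaussianWidth s).map (fun x => c * x) = gaussianWidth (c * s) := by
  rw [gaussianWidth, gaussianReal_map_const_mul, mul_zero, gaussianWidth]
  congr 1
  ext
  rw [NNReal.coe_mul, Real.coe_toNNReal _ (by positivity), Real.coe_toNNReal _ (by positivity)]
  change c ^ 2 * _ = _
  ring

theorem uniformZMod_eq_sum_dirac (q : ℕ) :
    uniformZMod q = (q : ENNReal)⁻¹ • ∑ k ∈ Finset.range q, Measure.dirac (k : ℝ) := by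
  have hfin : ((fun k : ℕ => (k : ℝ)) '' Set.Iio q).Finite := (Set.finite_Iio q).image _
  have hcount : Measure.count ((fun k : ℕ => (k : ℝ)) '' Set.Iio q) = q := by
    rw [Measure.count_apply hfin.measurableSet, Set.InjOn.encard_image Nat.cast_injective.injOn,
      ← Finset.coe_range, Set.encard_coe_eq_coe_finsetCard, Finset.card_range]
    simp
  classical
  ext A hA
  rw [uniformZMod, uniformOn, cond_apply hfin.measurableSet, hcount]
  simp only [Measure.smul_apply, Measure.finsetSum_apply, smul_eq_mul]
  congr 1
  have hA' : MeasurableSet (((fun k : ℕ => (k : ℝ)) '' Set.Iio q) ∩ A) := hfin.measurableSet.inter hA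
  have himg : ((fun k : ℕ => (k : ℝ)) '' Set.Iio q) ∩ A =
      (fun k : ℕ => (k : ℝ)) '' ((Finset.range q).filter fun k : ℕ => (k : ℝ) ∈ A : Finset ℕ) := by
    ext x
    simp only [Set.mem_inter_iff, Set.mem_image, Set.mem_Iio, Finset.mem_range,
      Finset.coe_filter, Set.mem_ofPred_eq]
    constructor
    · rintro ⟨⟨k, hk, rfl⟩, hx⟩; exact ⟨k, ⟨hk, hx⟩, rfl⟩
    · rintro ⟨k, ⟨hk, hx⟩, rfl⟩; exact ⟨⟨k, hk, rfl⟩, hx⟩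
  rw [Measure.count_apply hA', himg, Set.InjOn.encard_image Nat.cast_injective.injOn,
    Set.encard_coe_eq_coe_finsetCard]
  simp only [Measure.dirac_apply' _ hA, Set.indicator_apply, Pi.one_apply]
  rw [Finset.sum_boole]
  simp

theorem isProbabilityMeasure_uniformZMod {q : ℕ} (hq : 1 ≤ q) :
    IsProbabilityMeasure (uniformZMod q) := by
  constructor
  rw [uniformZMod_eq_sum_dirac]
  simp only [Measure.smul_apply, Measure.finsetSum_apply, measure_univ, Finset.sum_const,
    Finset.card_range, nsmul_eq_mul, mul_one, smul_eq_mul]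
  exact ENNReal.inv_mul_cancel (by simp; omega) (by simp)

/-! ### Measurability of the rounding algorithm -/

section Measurability
variable {α : Type*} [MeasurableSpace α]

theorem measurable_bitReduce (ws : List ℝ) {f : α → ℝ} (hf : Measurable f) :
    Measurable fun a => bitReduce ws (f a) := by
  induction ws generalizing f with
  | nil => simpa [bitReduce]
  | cons w ws ih =>
    exact ih (hf.sub ((Measurable.ite (measurableSet_le measurable_const hf) measurable_const
      measurable_const).mul_const w))

theorem measurable_bitExp (κ : ℝ) (ws : List ℝ) {f : α → ℝ × ℝ} (hf : Measurable f) :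
    Measurable fun a => bitExp κ ws (f a) := by
  induction ws generalizing f with
  | nil => simpa [bitExp]
  | cons w ws ih =>
    have hite : Measurable fun a => if w ≤ (f a).1 then (1:ℝ) else 0 :=
      Measurable.ite (measurableSet_le measurable_const hf.fst) measurable_const measurable_const
    exact ih ((hf.fst.sub (hite.mul_const w)).prodMk
      (hf.snd.mul ((hite.mul_const _).add_const _)))

namespace RoundingParams
variable (p : RoundingParams)

theorem measurable_base : Measurable p.base :=
  (measurable_bitExp p.kappa p.fracBits (measurable_id.prodMk measurable_const)).snd

theorem measurable_partialSum (j : ℕ) : Measurable fun y => p.partialSum y j := by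
  unfold partialSum
  fun_prop

theorem measurable_total : Measurable p.total := by
  have : p.total = fun y => p.partialSum y (2 * p.Z + 1) := funext p.total_eq
  rw [this]
  exact p.measurable_partialSum _

theorem measurable_select {y X : α → ℝ} (hy : Measurable y) (hX : Measurable X) :
    Measurable fun a => p.select (y a) (X a) := by
  simp only [select, Finset.card_filter]
  refine Finset.measurable_fun_sum _ fun j _ => Measurable.ite (measurableSet_le ?_ hX)
    measurable_const measurable_const
  exact (p.measurable_partialSum _).comp hy

theorem measurable_roundInt {v u : α → ℝ} (hv : Measurable v) (hu : Measurable u) :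
    Measurable fun a => p.roundInt (v a) (u a) := by
  have hb : Measurable fun a => p.base (Int.fract (v a)) :=
    p.measurable_base.comp (measurable_fract.comp hv)
  have hs := p.measurable_select hb (hu.mul (p.measurable_total.comp hb))
  exact ((Int.measurable_floor.comp hv).add (measurable_from_top.comp hs)).sub measurable_const

theorem measurable_round {a u : α → ℝ} (ha : Measurable a) (hu : Measurable u) :
    Measurable fun w => p.round (a w) (u w) := by
  have hf : Measurable fun w => p.frac (a w * p.scale) :=
    measurable_bitReduce _ ((ha.mul_const _).add_const _)
  have hb := p.measurable_base.comp hf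
  have hs := p.measurable_select hb (hu.mul (p.measurable_total.comp hb))
  unfold round
  simp only [count_eq]
  refine measurable_bitReduce _ ((((ha.mul_const _).sub hf).add ?_).add_const _)
  exact (measurable_from_top (f := fun k : ℕ => (k : ℝ))).comp hs

end RoundingParams
end Measurability

/-! ### Domination of the law of the rounded coordinate -/

namespace RoundingParams
variable (p : RoundingParams)

theorem volume_roundInt_le (ht : 1 ≤ p.t) (hZ : p.t ^ 2 ≤ p.Z)
    (hx : 8 * Real.exp (-Real.pi * p.t ^ 2) < 1) (v : ℝ) (A : Set (ℝ × ℝ)) :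
    volume {u : unitInterval | (realMod (p.roundInt v u) p.q, v - p.roundInt v u) ∈ A} ≤
      ENNReal.ofReal (Real.exp (2 * p.Z * p.kappa * (2 ^ p.K₂)⁻¹) /
        (1 - 8 * Real.exp (-Real.pi * p.t ^ 2))) *
      ∑' z : ℤ, ENNReal.ofReal (gaussDensity p.t (v - z)) *
        A.indicator 1 (realMod z p.q, v - z) := by
  set C := Real.exp (2 * p.Z * p.kappa * (2 ^ p.K₂)⁻¹) / (1 - 8 * Real.exp (-Real.pi * p.t ^ 2))
    with hC
  have hC0 : 0 ≤ C := div_nonneg (Real.exp_pos _).le (by linarith)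
  set y := p.base (Int.fract v) with hy
  have hy0 : 0 < y := (Real.exp_pos _).trans_le
    (p.base_bounds (Int.fract_nonneg v) (Int.fract_lt_one v) (by linarith)).1
  let ι : ℕ → ℤ := fun j => ⌊v⌋ + j - p.Z
  have hι : Function.Injective ι := fun a b h => by simp only [ι] at h; omega
  let G : ℤ → ENNReal := fun z => ENNReal.ofReal (gaussDensity p.t (v - z)) *
        A.indicator 1 (realMod z p.q, v - z)
  have hsub : {u : unitInterval | (realMod (p.roundInt v u) p.q, v - p.roundInt v u) ∈ A} ⊆
      ⋃ j ∈ Finset.range (2 * p.Z + 1), {u : unitInterval | p.select y (u * p.total y) = j ∧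
        (realMod (ι j) p.q, v - ι j) ∈ A} := by
    intro u hu
    simp only [Set.mem_iUnion, Finset.mem_range]
    exact ⟨p.select y (u * p.total y), Nat.lt_succ_of_le (p.select_le _ _), rfl, hu⟩
  have hterm : ∀ j : ℕ, volume {u : unitInterval | p.select y (u * p.total y) = j ∧
        (realMod (ι j) p.q, v - ι j) ∈ A} ≤ ENNReal.ofReal C * G (ι j) := by
    intro j
    by_cases hj : (realMod (ι j) p.q, v - ι j) ∈ A
    · simp only [hj, and_true, G, Set.indicator_of_mem hj, Pi.one_apply, mul_one]
      refine (p.volume_select_le hy0 j).trans ?_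
      rw [← ENNReal.ofReal_mul hC0]
      apply ENNReal.ofReal_le_ofReal
      have h := p.weight_mul_pow_div_total_le (Int.fract_nonneg v) (Int.fract_lt_one v) ht hZ hx j
      refine h.trans (le_of_eq ?_)
      rw [← hC]
      congr 1
      have : v - ((ι j : ℤ) : ℝ) = -((j : ℝ) - p.Z - Int.fract v) := by
        simp only [ι]
        push_cast
        linarith [Int.floor_add_fract v]
      rw [this, gaussDensity, gaussDensity, neg_sq]
    · simp [hj]
  calc _ ≤ _ := measure_mono hsub
    _ ≤ ∑ j ∈ Finset.range (2 * p.Z + 1), _ := measure_biUnion_finset_le _ _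
    _ ≤ ∑ j ∈ Finset.range (2 * p.Z + 1), ENNReal.ofReal C * G (ι j) :=
        Finset.sum_le_sum fun j _ => hterm j
    _ = ENNReal.ofReal C * ∑ z ∈ (Finset.range (2 * p.Z + 1)).map ⟨ι, hι⟩, G z := by
        rw [Finset.sum_map, Finset.mul_sum]; rfl
    _ ≤ _ := mul_le_mul_right (ENNReal.sum_le_tsum _) _

theorem gaussDensity_mul_add {q τ : ℝ} (hq : 0 < q) (x : ℝ) (i : ℤ) :
    gaussDensity (q * τ) (x + q * i) = q⁻¹ * gaussDensity τ (x / q + i) := by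
  unfold gaussDensity
  have : -Real.pi * (x + q * i) ^ 2 / (q * τ) ^ 2 = -Real.pi * (x / q + i) ^ 2 / τ ^ 2 := by
    field_simp
  rw [this]
  field_simp

theorem tsum_gaussDensity_residue_le {q τ : ℝ} (hq : 0 < q) (hτ : 1 ≤ τ) (x : ℝ) :
    ∑' i : ℤ, ENNReal.ofReal (gaussDensity (q * τ) (x + q * i)) ≤
      (ENNReal.ofReal q)⁻¹ * ENNReal.ofReal (1 + 4 * Real.exp (-Real.pi * τ ^ 2)) := by
  simp only [gaussDensity_mul_add hq, ENNReal.ofReal_mul (inv_nonneg.2 hq.le)]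
  rw [ENNReal.tsum_mul_left, ENNReal.ofReal_inv_of_pos hq,
    ← ENNReal.ofReal_tsum_of_nonneg (fun i => gaussDensity_nonneg (by linarith) _)
      (summable_gaussDensity (by linarith) _)]
  gcongr
  exact tsum_gaussDensity_le hτ _

/-- The factor by which the law of a rounded coordinate exceeds the ideal law. -/
def excess (τ : ℝ) : ℝ :=
  Real.exp (2 * p.Z * p.kappa * (2 ^ p.K₂)⁻¹) / (1 - 8 * Real.exp (-Real.pi * p.t ^ 2)) *
    (1 + 4 * Real.exp (-Real.pi * τ ^ 2))

/-- The inputs on which the range of the integer arithmetic suffices. -/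
def inRange : Set ℝ := {a | |a * p.scale| + (p.Z + 1) ≤ 2 ^ p.K}

/-- The rounded coordinate and the rounding error. -/
def roundPair (w : ℝ × unitInterval) : ℝ × ℝ :=
  (p.round w.1 w.2, w.1 * p.scale - p.roundInt (w.1 * p.scale) w.2)

theorem measurable_roundPair : Measurable p.roundPair :=
  (p.measurable_round (by fun_prop) (by fun_prop)).prodMk
    ((by fun_prop : Measurable fun w : ℝ × unitInterval => w.1 * p.scale).sub
      (measurable_from_top.comp (p.measurable_roundInt (by fun_prop) (by fun_prop))))

theorem measurableSet_inRange : MeasurableSet p.inRange :=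
  measurableSet_le (by fun_prop) measurable_const

theorem map_roundPair_le {τ : ℝ} (hq : 1 ≤ p.q) (hτ : 1 ≤ τ) (hscale : p.scale = p.q * τ)
    (ht : 1 ≤ p.t) (hZ : p.t ^ 2 ≤ p.Z) (hx : 8 * Real.exp (-Real.pi * p.t ^ 2) < 1) :
    (((gaussianWidth 1).prod volume).restrict (p.inRange ×ˢ Set.univ)).map p.roundPair ≤
      ENNReal.ofReal (p.excess τ) • (uniformZMod p.q).prod (gaussianWidth p.t) := by
  have hq0 : (0:ℝ) < p.q := by exact_mod_cast hq
  have ht0 : 0 < p.t := by linarith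
  have hs0 : 0 < p.scale := by rw [hscale]; positivity
  have : NeZero p.q := ⟨by omega⟩
  have := isProbabilityMeasure_uniformZMod hq
  set C := Real.exp (2 * p.Z * p.kappa * (2 ^ p.K₂)⁻¹) / (1 - 8 * Real.exp (-Real.pi * p.t ^ 2))
    with hC
  have hC0 : 0 ≤ C := div_nonneg (Real.exp_pos _).le (by linarith)
  rw [Measure.le_iff]
  intro A hA
  have hmeas : MeasurableSet {w : ℝ × unitInterval |
      (realMod (p.roundInt w.1 w.2) p.q, w.1 - p.roundInt w.1 w.2) ∈ A} := by
    have h1 : Measurable fun w : ℝ × unitInterval => ((p.roundInt w.1 w.2 : ℤ) : ℝ) :=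
      measurable_from_top.comp (p.measurable_roundInt (by fun_prop) (by fun_prop))
    exact (((measurable_realMod _).comp h1).prodMk (measurable_fst.sub h1)) hA
  have hAv : ∀ z : ℤ, Measurable fun v : ℝ => ENNReal.ofReal (gaussDensity p.t v) *
      A.indicator (1 : ℝ × ℝ → ENNReal) (realMod z p.q, v) := fun z =>
    ((measurable_gaussDensity _).ennreal_ofReal).mul
      ((measurable_one.indicator hA).comp (by fun_prop))
  have hAd : ∀ z : ℤ, Measurable fun v : ℝ => ENNReal.ofReal (gaussDensity p.t (v - z)) *
      A.indicator (1 : ℝ × ℝ → ENNReal) (realMod z p.q, v - z) := fun z =>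
    (hAv z).comp (measurable_id.sub_const _)
  have step1 : (((gaussianWidth 1).prod volume).restrict (p.inRange ×ˢ Set.univ)).map
      p.roundPair A ≤ ∫⁻ v, volume {u : unitInterval |
        (realMod (p.roundInt v u) p.q, v - p.roundInt v u) ∈ A} ∂gaussianWidth p.scale := by
    rw [Measure.map_apply p.measurable_roundPair hA,
      Measure.restrict_apply (p.measurable_roundPair hA)]
    have hsc : gaussianWidth p.scale = (gaussianWidth 1).map fun x => p.scale * x := by
      rw [map_mul_gaussianWidth, mul_one]
    have hmap : ∫⁻ v, volume {u : unitInterval |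
        (realMod (p.roundInt v u) p.q, v - p.roundInt v u) ∈ A} ∂gaussianWidth p.scale =
        ∫⁻ a, volume {u : unitInterval | (realMod (p.roundInt (p.scale * a) u) p.q,
          p.scale * a - p.roundInt (p.scale * a) u) ∈ A} ∂gaussianWidth 1 := by
      rw [hsc]
      exact lintegral_map (measurable_measure_prodMk_left hmeas) (by fun_prop)
    rw [hmap]
    have hm2 : MeasurableSet {w : ℝ × unitInterval |
        (realMod (p.roundInt (p.scale * w.1) w.2) p.q,
          p.scale * w.1 - p.roundInt (p.scale * w.1) w.2) ∈ A} :=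
      (show Measurable fun w : ℝ × unitInterval => (p.scale * w.1, w.2) by fun_prop) hmeas
    refine (measure_mono (t := {w : ℝ × unitInterval |
        (realMod (p.roundInt (p.scale * w.1) w.2) p.q,
          p.scale * w.1 - p.roundInt (p.scale * w.1) w.2) ∈ A}) ?_).trans
      (Measure.prod_apply hm2).le
    rintro ⟨a, u⟩ ⟨h1, h2, -⟩
    have h3 := p.round_eq_realMod hq u h2
    simp only [Set.mem_preimage, roundPair, h3] at h1
    rw [mul_comm a] at h1
    exact h1
  have step2 : ∫⁻ v, volume {u : unitInterval |
        (realMod (p.roundInt v u) p.q, v - p.roundInt v u) ∈ A} ∂gaussianWidth p.scale ≤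
      ENNReal.ofReal C * ∑' z : ℤ, ∫⁻ δ, ENNReal.ofReal (gaussDensity p.scale (δ + z)) *
        (ENNReal.ofReal (gaussDensity p.t δ) * A.indicator 1 (realMod z p.q, δ)) := by
    refine (lintegral_mono fun v => p.volume_roundInt_le ht hZ hx v A).trans ?_
    rw [lintegral_const_mul _ (Measurable.tsum fun z => hAd z)]
    refine mul_le_mul_right (le_of_eq ?_) _
    rw [lintegral_tsum fun z => (hAd z).aemeasurable]
    congr 1
    funext z
    rw [lintegral_gaussianWidth hs0 (hAd z), ← lintegral_add_right_eq_self _ (z : ℝ)]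
    simp only [add_sub_cancel_right]
  have step3 : ∑' z : ℤ, ∫⁻ δ, ENNReal.ofReal (gaussDensity p.scale (δ + z)) *
        (ENNReal.ofReal (gaussDensity p.t δ) * A.indicator 1 (realMod z p.q, δ)) ≤
      ENNReal.ofReal (1 + 4 * Real.exp (-Real.pi * τ ^ 2)) *
        ((uniformZMod p.q).prod (gaussianWidth p.t)) A := by
    set c := ENNReal.ofReal (1 + 4 * Real.exp (-Real.pi * τ ^ 2)) with hc
    have hB : ∀ k : ℝ, Measurable fun δ : ℝ => A.indicator (1 : ℝ × ℝ → ENNReal) (k, δ) :=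
      fun k => (measurable_one.indicator hA).comp (by fun_prop)
    have hBint : ∀ k : ℝ, ∫⁻ δ, ENNReal.ofReal (gaussDensity p.t δ) * A.indicator 1 (k, δ) =
        gaussianWidth p.t (Prod.mk k ⁻¹' A) := by
      intro k
      rw [← lintegral_gaussianWidth ht0 (hB k), ← lintegral_indicator_one
        (measurable_prodMk_left hA)]
      rfl
    have hres : ∀ (i : ℤ) (k : Fin p.q), realMod ((i * p.q + k : ℤ) : ℝ) p.q = ((k : ℕ) : ℝ) := by
      intro i k
      refine realMod_eq_of i ?_ (Nat.cast_nonneg _) (by exact_mod_cast k.2)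
      push_cast
      ring
    have hk : ∀ k : Fin p.q, ∑' i : ℤ, ∫⁻ δ, ENNReal.ofReal (gaussDensity p.scale
        (δ + (i * p.q + k : ℤ))) * (ENNReal.ofReal (gaussDensity p.t δ) *
          A.indicator 1 (realMod ((i * p.q + k : ℤ) : ℝ) p.q, δ)) ≤
        (p.q : ENNReal)⁻¹ * c * gaussianWidth p.t (Prod.mk ((k : ℕ) : ℝ) ⁻¹' A) := by
      intro k
      have hB' : Measurable fun δ => ENNReal.ofReal (gaussDensity p.t δ) *
          A.indicator 1 (((k : ℕ) : ℝ), δ) :=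
        ((measurable_gaussDensity p.t).ennreal_ofReal).mul (hB ((k : ℕ) : ℝ))
      have hB'' : ∀ i : ℤ, Measurable fun δ => ENNReal.ofReal (gaussDensity p.scale
          (δ + (i * p.q + k : ℤ))) * (ENNReal.ofReal (gaussDensity p.t δ) *
          A.indicator 1 (((k : ℕ) : ℝ), δ)) := fun i =>
        (((measurable_gaussDensity p.scale).comp (measurable_id.add_const _)).ennreal_ofReal).mul hB'
      simp only [hres]
      rw [← lintegral_tsum fun i => (hB'' i).aemeasurable, ← hBint,
        ← lintegral_const_mul _ hB']
      refine lintegral_mono fun δ => ?_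
      rw [ENNReal.tsum_mul_right]
      refine mul_le_mul_left ?_ _
      have h := tsum_gaussDensity_residue_le hq0 hτ (δ + (k : ℕ))
      rw [ENNReal.ofReal_natCast] at h
      refine le_trans (le_of_eq ?_) h
      congr 1
      funext i
      rw [hscale]
      congr 2
      push_cast
      ring
    rw [Measure.prod_apply hA, uniformZMod_eq_sum_dirac, lintegral_smul_measure,
      lintegral_finsetSum_measure, ← (Int.divModEquiv p.q).symm.tsum_eq]
    simp only [Int.divModEquiv_symm_apply]
    rw [ENNReal.tsum_prod', ENNReal.tsum_comm, tsum_fintype]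
    refine (Finset.sum_le_sum fun k _ => hk k).trans (le_of_eq ?_)
    rw [← Finset.mul_sum, smul_eq_mul, ← mul_assoc, mul_comm c, Finset.sum_range]
    congr 1
    refine Finset.sum_congr rfl fun k _ => ?_
    rw [lintegral_dirac' _ (measurable_measure_prodMk_left hA)]
  refine step1.trans (step2.trans ((mul_le_mul_right step3 _).trans (le_of_eq ?_)))
  rw [Measure.smul_apply, smul_eq_mul, ← mul_assoc, ← ENNReal.ofReal_mul hC0]
  rfl

end RoundingParams

/-! ### Product measures -/

theorem Measure.pi_mono_of_le {ι : Type*} [Fintype ι] {α : ι → Type*} [∀ i, MeasurableSpace (α i)]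
    {μ ν : ∀ i, Measure (α i)} (h : ∀ i, μ i ≤ ν i) : Measure.pi μ ≤ Measure.pi ν := by
  rw [Measure.le_iff]
  intro s hs
  rw [Measure.pi_def, Measure.pi_def, toMeasure_apply _ _ hs, toMeasure_apply _ _ hs]
  refine (?_ : OuterMeasure.pi _ ≤ OuterMeasure.pi _) s
  unfold OuterMeasure.pi
  rw [OuterMeasure.le_boundedBy]
  intro t
  refine (OuterMeasure.boundedBy_le t).trans ?_
  unfold piPremeasure
  exact Finset.prod_le_prod' fun i _ => h i _

theorem Measure.pi_smul_const {ι : Type*} [Fintype ι] {α : ι → Type*} [∀ i, MeasurableSpace (α i)]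
    (ν : ∀ i, Measure (α i)) [∀ i, IsFiniteMeasure (ν i)] {c : ENNReal} (hc : c ≠ ⊤) :
    Measure.pi (fun i => c • ν i) = c ^ Fintype.card ι • Measure.pi ν := by
  have : ∀ i, IsFiniteMeasure (c • ν i) := fun i => (ν i).smul_finite hc
  refine Measure.pi_eq fun s _ => ?_
  simp only [Measure.smul_apply, smul_eq_mul, Measure.pi_pi, Finset.prod_mul_distrib,
    Finset.prod_const, Finset.card_univ]

theorem Measure.pi_le_smul {ι : Type*} [Fintype ι] {α : ι → Type*} [∀ i, MeasurableSpace (α i)]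
    {μ ν : ∀ i, Measure (α i)} [∀ i, IsFiniteMeasure (ν i)] {c : ENNReal} (hc : c ≠ ⊤)
    (h : ∀ i, μ i ≤ c • ν i) : Measure.pi μ ≤ c ^ Fintype.card ι • Measure.pi ν :=
  (Measure.pi_mono_of_le h).trans (Measure.pi_smul_const ν hc).le

/-! ### Linear combinations of independent Gaussians -/

theorem map_sum_mul_gaussianReal {n : ℕ} (v : NNReal) (s : Fin n → ℝ) :
    (Measure.pi fun _ : Fin n => gaussianReal 0 v).map (fun x => ∑ j, x j * s j) =
      gaussianReal 0 (v * ∑ j, (s j ^ 2).toNNReal) := by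
  classical
  have hind : iIndepFun (fun j (x : Fin n → ℝ) => x j * s j)
      (Measure.pi fun _ : Fin n => gaussianReal 0 v) :=
    iIndepFun_pi (X := fun j (y : ℝ) => y * s j) fun j => by fun_prop
  have hmeas : ∀ j, Measurable fun x : Fin n → ℝ => x j * s j := fun j => by fun_prop
  have hone : ∀ j, (Measure.pi fun _ : Fin n => gaussianReal 0 v).map (fun x => x j * s j) =
      gaussianReal 0 (v * (s j ^ 2).toNNReal) := by
    intro j
    have h1 : (Measure.pi fun _ : Fin n => gaussianReal 0 v).map (fun x => x j) =
        gaussianReal 0 v := (measurePreserving_eval _ j).map_eq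
    have h2 : (fun x : Fin n → ℝ => x j * s j) = (fun y => s j * y) ∘ fun x => x j := by
      funext x; simp [mul_comm]
    rw [h2, ← Measure.map_map (by fun_prop) (by fun_prop), h1, gaussianReal_map_const_mul, mul_zero]
    congr 1
    ext
    rw [NNReal.coe_mul, NNReal.coe_mul, Real.coe_toNNReal _ (sq_nonneg _), mul_comm]
    rfl
  have key : ∀ F : Finset (Fin n), (Measure.pi fun _ : Fin n => gaussianReal 0 v).map
      (∑ j ∈ F, fun x : Fin n → ℝ => x j * s j) =
        gaussianReal 0 (v * ∑ j ∈ F, (s j ^ 2).toNNReal) := by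
    intro F
    induction F using Finset.induction_on with
    | empty =>
      have h0 : (∑ j ∈ (∅ : Finset (Fin n)), fun x : Fin n → ℝ => x j * s j) = fun _ => 0 := by
        rw [Finset.sum_empty]; rfl
      rw [h0]
      simp
    | insert j F hj ih =>
      have hi := (hind.indepFun_finsetSum_of_notMem hmeas hj).symm
      rw [Finset.sum_insert hj, Finset.sum_insert hj,
        gaussianReal_add_gaussianReal_of_indepFun hi (hone j) ih, mul_add, add_zero]
  rw [← key Finset.univ]
  congr 1
  funext x
  rw [Finset.sum_apply]

/-- The noise produced by rounding errors of width `t` and scaled noise of width `b`. -/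
theorem map_noise_eq {n : ℕ} {t b σ r q : ℝ} (s : Fin n → ℝ) (hs : ∑ j, s j ^ 2 = r ^ 2)
    (hσ : σ ^ 2 = (q * b) ^ 2 + (r * t) ^ 2) :
    ((Measure.pi fun _ : Fin n => gaussianWidth t).prod (gaussianWidth b)).map
      (fun w => ∑ j, w.1 j * s j + q * w.2) = gaussianWidth σ := by
  have h1 : (Measure.pi fun _ : Fin n => gaussianWidth t).map (fun x => ∑ j, x j * s j) =
      gaussianReal 0 ((t ^ 2 / (2 * Real.pi)).toNNReal * ∑ j, (s j ^ 2).toNNReal) :=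
    map_sum_mul_gaussianReal _ s
  have h2 := map_mul_gaussianWidth b q
  have h3 : (fun w : (Fin n → ℝ) × ℝ => ∑ j, w.1 j * s j + q * w.2) =
      (fun z : ℝ × ℝ => z.1 + z.2) ∘ Prod.map (fun x : Fin n → ℝ => ∑ j, x j * s j)
        (fun y : ℝ => q * y) := rfl
  rw [h3, ← Measure.map_map (by fun_prop) (by fun_prop),
    ← Measure.map_prod_map _ _ (by fun_prop) (by fun_prop), h1, h2]
  change Measure.conv _ _ = _
  rw [gaussianWidth, gaussianReal_conv_gaussianReal, gaussianWidth, add_zero]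
  congr 1
  ext
  push_cast
  rw [Real.coe_toNNReal _ (by positivity), Real.coe_toNNReal _ (by positivity),
    Real.coe_toNNReal _ (by positivity)]
  simp only [Real.coe_toNNReal _ (sq_nonneg _), hs, hσ]
  ring

/-! ### The law of one sample and of an array of samples -/

/-- The law of a sample `(a, realMod (γ ⟨a, s⟩ + e) q)`. -/
def sampleLaw {n : ℕ} (q γ : ℝ) (A : Measure (Fin n → ℝ)) (s : Fin n → ℝ) (E : Measure ℝ) :
    Measure ((Fin n → ℝ) × ℝ) :=
  (A.prod E).map fun w => (w.1, realMod (γ * ∑ j, w.1 j * s j + w.2) q)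

theorem measurable_sample {n : ℕ} (q γ : ℝ) (s : Fin n → ℝ) :
    Measurable fun w : (Fin n → ℝ) × ℝ => (w.1, realMod (γ * ∑ j, w.1 j * s j + w.2) q) :=
  measurable_fst.prodMk ((measurable_realMod q).comp (by fun_prop))

instance (n : ℕ) (s : ℝ) : IsProbabilityMeasure (gaussianVec n s) := by
  unfold gaussianVec; infer_instance

theorem map_noisy_eq_pi {m n : ℕ} (q γ : ℝ) (A : Measure (Fin n → ℝ)) [IsProbabilityMeasure A]
    (s : Fin n → ℝ) (E : Measure ℝ) [IsProbabilityMeasure E] :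
    ((Measure.pi fun _ : Fin m => A).prod (Measure.pi fun _ : Fin m => E)).map
      (fun w i => (w.1 i, realMod (γ * ∑ j, w.1 i j * s j + w.2 i) q)) =
      Measure.pi fun _ : Fin m => sampleLaw q γ A s E := by
  have h := measurePreserving_arrowProdEquivProdArrow (Fin n → ℝ) ℝ (Fin m) (fun _ => A) fun _ => E
  have hf := measurable_sample (n := n) q γ s
  rw [← h.map_eq, Measure.map_map _ h.measurable]
  · exact Measure.pi_map_pi (μ := fun _ : Fin m => A.prod E) fun _ => hf.aemeasurable
  · rw [measurable_pi_iff]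
    exact fun i => hf.comp (by fun_prop : Measurable fun w : (Fin m → Fin n → ℝ) × (Fin m → ℝ) =>
      (w.1 i, w.2 i))

/-! ### Domination for arrays of samples -/

namespace RoundingParams
variable (p : RoundingParams)

/-- The randomness used for one sample: coordinates, random numbers of the machine, noise. -/
def baseLaw (n : ℕ) (E : Measure ℝ) : Measure ((Fin n → ℝ × unitInterval) × ℝ) :=
  (Measure.pi fun _ : Fin n => (gaussianWidth 1).prod volume).prod E

/-- The residues, rounding errors and noise of one sample in the ideal situation. -/
def idealLaw (n : ℕ) (E : Measure ℝ) : Measure ((Fin n → ℝ × ℝ) × ℝ) :=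
  (Measure.pi fun _ : Fin n => (uniformZMod p.q).prod (gaussianWidth p.t)).prod E

/-- All coordinates of the sample are in range. -/
def goodSample (n : ℕ) : Set ((Fin n → ℝ × unitInterval) × ℝ) :=
  (Set.univ.pi fun _ => p.inRange ×ˢ Set.univ) ×ˢ Set.univ

/-- The residues, rounding errors and noise of one sample. -/
def roundSample {n : ℕ} (w : (Fin n → ℝ × unitInterval) × ℝ) : (Fin n → ℝ × ℝ) × ℝ :=
  (fun j => p.roundPair (w.1 j), w.2)

instance (n : ℕ) (E : Measure ℝ) [IsProbabilityMeasure E] : IsProbabilityMeasure (baseLaw n E) := by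
  unfold baseLaw; infer_instance

theorem measurable_roundSample {n : ℕ} : Measurable (p.roundSample (n := n)) :=
  Measurable.prodMk (measurable_pi_iff.2 fun j => p.measurable_roundPair.comp (by fun_prop))
    measurable_snd

theorem measurableSet_goodSample (n : ℕ) : MeasurableSet (p.goodSample n) :=
  (MeasurableSet.univ_pi fun _ => p.measurableSet_inRange.prod MeasurableSet.univ).prod
    MeasurableSet.univ

theorem map_roundSample_le {n : ℕ} (hq : 1 ≤ p.q) {c : ENNReal} (hc : c ≠ ⊤)
    (h : (((gaussianWidth 1).prod volume).restrict (p.inRange ×ˢ Set.univ)).map p.roundPair ≤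
      c • (uniformZMod p.q).prod (gaussianWidth p.t)) (E : Measure ℝ) [IsProbabilityMeasure E] :
    ((baseLaw n E).restrict (p.goodSample n)).map p.roundSample ≤ c ^ n • p.idealLaw n E := by
  have := isProbabilityMeasure_uniformZMod hq
  have h1 : (baseLaw n E).restrict (p.goodSample n) =
      (Measure.pi fun _ : Fin n => ((gaussianWidth 1).prod volume).restrict
        (p.inRange ×ˢ Set.univ)).prod E := by
    rw [baseLaw, goodSample, ← Measure.prod_restrict, Measure.restrict_univ]
    congr 1
    exact Measure.restrict_pi_pi (fun _ : Fin n => (gaussianWidth 1).prod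
      (volume : Measure unitInterval)) fun _ => p.inRange ×ˢ Set.univ
  have h2 : p.roundSample (n := n) = Prod.map (fun (x : Fin n → ℝ × unitInterval) j =>
      p.roundPair (x j)) id := rfl
  have hm : Measurable fun (x : Fin n → ℝ × unitInterval) j => p.roundPair (x j) :=
    measurable_pi_iff.2 fun j => p.measurable_roundPair.comp (by fun_prop)
  rw [h1, h2, ← Measure.map_prod_map _ _ hm measurable_id, Measure.map_id,
    Measure.pi_map_pi fun _ => p.measurable_roundPair.aemeasurable, idealLaw,
    ← Measure.prod_smul_left]
  refine Measure.prod_mono ?_ le_rfl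
  have h3 := Measure.pi_le_smul (ι := Fin n) hc fun _ => h
  rwa [Fintype.card_fin] at h3

theorem map_roundArray_le {m n : ℕ} {α : Type*} [MeasurableSpace α] (hq : 1 ≤ p.q) {c : ENNReal}
    (hc : c ≠ ⊤)
    (h : (((gaussianWidth 1).prod volume).restrict (p.inRange ×ˢ Set.univ)).map p.roundPair ≤
      c • (uniformZMod p.q).prod (gaussianWidth p.t)) (E : Measure ℝ) [IsProbabilityMeasure E]
    {Ψ : (Fin n → ℝ × ℝ) × ℝ → α} (hΨ : Measurable Ψ) :
    ((Measure.pi fun _ : Fin m => baseLaw n E).restrict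
      (Set.univ.pi fun _ => p.goodSample n)).map (fun w i => Ψ (p.roundSample (w i))) ≤
      c ^ (n * m) • Measure.pi fun _ : Fin m => (p.idealLaw n E).map Ψ := by
  have := isProbabilityMeasure_uniformZMod hq
  have hm : Measurable fun w => Ψ (p.roundSample (n := n) w) := hΨ.comp p.measurable_roundSample
  have hfin : IsFiniteMeasure (p.idealLaw n E) := by unfold idealLaw; infer_instance
  rw [Measure.restrict_pi_pi, Measure.pi_map_pi fun _ => hm.aemeasurable, pow_mul]
  have h1 : (((baseLaw n E).restrict (p.goodSample n)).map fun w => Ψ (p.roundSample w)) ≤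
      c ^ n • (p.idealLaw n E).map Ψ := by
    have h2 := Measure.map_mono (p.map_roundSample_le (n := n) hq hc h E) hΨ
    rw [Measure.map_map hΨ p.measurable_roundSample, Measure.map_smul] at h2
    exact h2
  have h3 := Measure.pi_le_smul (ι := Fin m) (ENNReal.pow_ne_top hc (n := n)) fun _ => h1
  rwa [Fintype.card_fin] at h3

theorem measure_compl_goodSample_le {m n : ℕ} (E : Measure ℝ) [IsProbabilityMeasure E] :
    (Measure.pi fun _ : Fin m => baseLaw n E) (Set.univ.pi fun _ => p.goodSample n)ᶜ ≤
      (m * n : ℕ) * gaussianWidth 1 p.inRangeᶜ := by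
  have hone : ∀ (i : Fin m) (j : Fin n), (Measure.pi fun _ : Fin m => baseLaw n E)
      {w | ((w i).1 j).1 ∈ p.inRangeᶜ} = gaussianWidth 1 p.inRangeᶜ := by
    intro i j
    have hp := ((measurePreserving_fst (μ := gaussianWidth 1)
      (ν := (volume : Measure unitInterval))).comp
        (measurePreserving_eval (fun _ : Fin n => (gaussianWidth 1).prod volume) j)).comp
        ((measurePreserving_fst (ν := E)).comp
          (measurePreserving_eval (fun _ : Fin m => baseLaw n E) i))
    exact hp.measure_preimage p.measurableSet_inRange.compl.nullMeasurableSet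
  have hsub : (Set.univ.pi fun _ : Fin m => p.goodSample n)ᶜ ⊆
      ⋃ ij : Fin m × Fin n, {w | ((w ij.1).1 ij.2).1 ∈ p.inRangeᶜ} := by
    intro w hw
    by_contra hcon
    simp only [Set.mem_iUnion, not_exists] at hcon
    refine hw fun i _ => ⟨fun j _ => ⟨?_, trivial⟩, trivial⟩
    exact not_not.1 (hcon (i, j))
  refine (measure_mono hsub).trans ((measure_iUnion_fintype_le _ _).trans ?_)
  simp only [hone]
  simp

/-- Samples and random numbers of the machine, generated from the base law. -/
theorem map_baseLaw_eq {m n : ℕ} (E : Measure ℝ) [IsProbabilityMeasure E]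
    {f : (Fin n → ℝ) × ℝ → (Fin n → ℝ) × ℝ} (hf : Measurable f) :
    (Measure.pi fun _ : Fin m => baseLaw n E).map (fun w =>
      ((fun i => f (fun j => ((w i).1 j).1, (w i).2)), fun i j => ((w i).1 j).2)) =
    (Measure.pi fun _ : Fin m => ((gaussianVec n 1).prod E).map f).prod
      (Measure.pi fun _ : Fin m => Measure.pi fun _ : Fin n => (volume : Measure unitInterval)) := by
  set ρ := Measure.pi fun _ : Fin n => (volume : Measure unitInterval) with hρ
  have hprob : IsProbabilityMeasure (((gaussianVec n 1).prod E).map f) :=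
    Measure.isProbabilityMeasure_map hf.aemeasurable
  have p1 : MeasurePreserving (Prod.map (MeasurableEquiv.arrowProdEquivProdArrow ℝ unitInterval
      (Fin n)) id) (baseLaw n E) (((gaussianVec n 1).prod ρ).prod E) :=
    (measurePreserving_arrowProdEquivProdArrow ℝ unitInterval (Fin n) (fun _ => gaussianWidth 1)
      fun _ => volume).prod (MeasurePreserving.id E)
  have p2 := (measurePreserving_prodAssoc (gaussianVec n 1) ρ E)
  have p3 := (MeasurePreserving.id (gaussianVec n 1)).prod
    (Measure.measurePreserving_swap (μ := ρ) (ν := E))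
  have p4 := (measurePreserving_prodAssoc (gaussianVec n 1) E ρ).symm
  have p5 : MeasurePreserving (Prod.map f id) (((gaussianVec n 1).prod E).prod ρ)
      ((((gaussianVec n 1).prod E).map f).prod ρ) :=
    MeasurePreserving.prod ⟨hf, rfl⟩ (MeasurePreserving.id ρ)
  have p6 := p5.comp (p4.comp (p3.comp (p2.comp p1)))
  have p7 := measurePreserving_pi (ι := Fin m) (fun _ => baseLaw n E)
    (fun _ => (((gaussianVec n 1).prod E).map f).prod ρ) fun _ => p6
  have p8 := measurePreserving_arrowProdEquivProdArrow _ _ (Fin m)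
    (fun _ => ((gaussianVec n 1).prod E).map f) fun _ => ρ
  exact (p8.comp p7).map_eq

theorem measurable_transform {m n : ℕ} :
    Measurable fun w : Samples m n × (Fin m → Fin n → unitInterval) =>
      p.transform w.1 fun i j => w.2 i j := by
  rw [measurable_pi_iff]
  intro i
  refine Measurable.prodMk (measurable_pi_iff.2 fun j => ?_) (by fun_prop)
  exact p.measurable_round (by fun_prop) (by fun_prop)

/-- The law of the transformed array is dominated by the ideal law, up to a measure of small mass. -/
theorem map_transform_le {m n : ℕ} (hq : 1 ≤ p.q) {c : ENNReal} (hc : c ≠ ⊤)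
    (h : (((gaussianWidth 1).prod volume).restrict (p.inRange ×ˢ Set.univ)).map p.roundPair ≤
      c • (uniformZMod p.q).prod (gaussianWidth p.t)) (E : Measure ℝ) [IsProbabilityMeasure E]
    {f : (Fin n → ℝ) × ℝ → (Fin n → ℝ) × ℝ} (hf : Measurable f)
    {Ψ : (Fin n → ℝ × ℝ) × ℝ → (Fin n → ℝ) × ℝ} (hΨ : Measurable Ψ)
    (hΨf : ∀ w ∈ p.goodSample n, Ψ (p.roundSample w) =
      (fun j => p.round ((f (fun j => (w.1 j).1, w.2)).1 j) (w.1 j).2,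
        p.q * (f (fun j => (w.1 j).1, w.2)).2)) :
    ∃ ρ : Measure (Samples m n), ρ Set.univ ≤ (m * n : ℕ) * gaussianWidth 1 p.inRangeᶜ ∧
      ((Measure.pi fun _ : Fin m => ((gaussianVec n 1).prod E).map f).prod
        (Measure.pi fun _ : Fin m => Measure.pi fun _ : Fin n =>
          (volume : Measure unitInterval))).map (fun w => p.transform w.1 fun i j => w.2 i j) ≤
      (c ^ (n * m) • Measure.pi fun _ : Fin m => (p.idealLaw n E).map Ψ) + ρ := by
  set B := Measure.pi fun _ : Fin m => baseLaw n E with hB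
  set G : Set (Fin m → (Fin n → ℝ × unitInterval) × ℝ) := Set.univ.pi fun _ => p.goodSample n with hG
  have hGm : MeasurableSet G := MeasurableSet.univ_pi fun _ => p.measurableSet_goodSample n
  set g : (Fin m → (Fin n → ℝ × unitInterval) × ℝ) → Samples m n × (Fin m → Fin n → unitInterval) :=
    fun w => ((fun i => f (fun j => ((w i).1 j).1, (w i).2)), fun i j => ((w i).1 j).2) with hg
  have hgm : Measurable g := Measurable.prodMk
    (measurable_pi_iff.2 fun i => hf.comp (by fun_prop)) (by fun_prop)
  set F := fun w => p.transform (g w).1 fun i j => (g w).2 i j with hF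
  have hFm : Measurable F := p.measurable_transform.comp hgm
  refine ⟨(B.restrict Gᶜ).map F, ?_, ?_⟩
  · rw [Measure.map_apply hFm MeasurableSet.univ, Set.preimage_univ, Measure.restrict_apply_univ]
    exact p.measure_compl_goodSample_le E
  · rw [← map_baseLaw_eq E hf, Measure.map_map p.measurable_transform hgm]
    change B.map F ≤ _
    have hsplit : B.map F = (B.restrict G).map F + (B.restrict Gᶜ).map F := by
      rw [← Measure.map_add _ _ hFm, Measure.restrict_add_restrict_compl hGm]
    rw [hsplit]
    refine add_le_add ?_ le_rfl
    refine le_trans (le_of_eq ?_) (p.map_roundArray_le hq hc h E hΨ)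
    refine Measure.map_congr ?_
    filter_upwards [ae_restrict_mem hGm] with w hw
    funext i
    exact (hΨf (w i) (hw i trivial)).symm

end RoundingParams

/-! ### Splitting the random tape -/

theorem Measure.infinitePi_map_injective {ι κ X : Type*} [MeasurableSpace X] (μ : Measure X)
    [IsProbabilityMeasure μ] {e : κ → ι} (he : Function.Injective e) :
    (Measure.infinitePi fun _ : ι => μ).map (fun ω k => ω (e k)) =
      Measure.infinitePi fun _ : κ => μ := by
  classical
  refine Measure.eq_infinitePi _ fun s t ht => ?_
  have hm : Measurable fun (ω : ι → X) k => ω (e k) := by fun_prop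
  rw [Measure.map_apply hm (MeasurableSet.pi s.countable_toSet fun i _ => ht i)]
  rcases isEmpty_or_nonempty κ with hκ | hκ
  · have hs : s = ∅ := Finset.eq_empty_of_isEmpty s
    subst hs
    simp
  have hpre : (fun (ω : ι → X) k => ω (e k)) ⁻¹' (s : Set κ).pi t =
      ((s.map ⟨e, he⟩ : Finset ι) : Set ι).pi fun i => t (Function.invFun e i) := by
    ext ω
    simp [Set.mem_pi, Function.leftInverse_invFun he _]
  rw [hpre, Measure.infinitePi_pi _ fun i _ => ht _, Finset.prod_map]
  simp [Function.leftInverse_invFun he _]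

theorem Measure.infinitePi_prod_map_sumElim {κ κ' X : Type*} [Countable κ] [Countable κ']
    [MeasurableSpace X] (μ : Measure X) [IsProbabilityMeasure μ] :
    ((Measure.infinitePi fun _ : κ => μ).prod (Measure.infinitePi fun _ : κ' => μ)).map
      (fun w => (Sum.elim w.1 w.2 : κ ⊕ κ' → X)) = Measure.infinitePi fun _ : κ ⊕ κ' => μ := by
  classical
  refine Measure.eq_infinitePi _ fun s t ht => ?_
  have hm : Measurable fun w : (κ → X) × (κ' → X) => (Sum.elim w.1 w.2 : κ ⊕ κ' → X) := by
    rw [measurable_pi_iff]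
    rintro (k | k) <;> simp <;> fun_prop
  rw [Measure.map_apply hm (MeasurableSet.pi s.countable_toSet fun i _ => ht i)]
  have hpre : (fun w : (κ → X) × (κ' → X) => (Sum.elim w.1 w.2 : κ ⊕ κ' → X)) ⁻¹' (s : Set _).pi t =
      ((s.toLeft : Set κ).pi fun k => t (Sum.inl k)) ×ˢ
        ((s.toRight : Set κ').pi fun k => t (Sum.inr k)) := by
    ext w
    simp [Set.mem_pi, Sum.forall]
  rw [hpre, Measure.prod_prod, Measure.infinitePi_pi _ fun i _ => ht _,
    Measure.infinitePi_pi _ fun i _ => ht _]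
  conv_rhs => rw [← Finset.toLeft_disjSum_toRight (u := s), Finset.prod_disjSum]

/-- Independent entries of the tape, together with a later part of the tape. -/
theorem map_split_tape {m n : ℕ} (L : ℕ) (pos : Fin m → Fin n → ℕ)
    (hinj : Function.Injective fun ij : Fin m × Fin n => pos ij.1 ij.2)
    (hlt : ∀ i j, pos i j < L) :
    ramTapeMeasure.map (fun ω => ((fun i j => ω (pos i j)), fun t => ω (L + t))) =
      (Measure.pi fun _ : Fin m => Measure.pi fun _ : Fin n => (volume : Measure unitInterval)).prod
        ramTapeMeasure := by
  set μ := (volume : Measure unitInterval)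
  set e : (Fin m × Fin n) ⊕ ℕ → ℕ := Sum.elim (fun ij => pos ij.1 ij.2) fun t => L + t with he
  have hei : Function.Injective e := by
    refine Function.Injective.sumElim hinj (fun a b h => by simpa using h) fun ij t => ?_
    have := hlt ij.1 ij.2
    omega
  have h1 := Measure.infinitePi_map_injective μ hei
  have h2 := Measure.infinitePi_prod_map_sumElim (κ := Fin m × Fin n) (κ' := ℕ) μ
  have h3 := (Measure.infinitePi_map_curry fun (_ : Fin m) (_ : Fin n) => μ).trans
    (show _ = Measure.pi fun _ : Fin m => Measure.pi fun _ : Fin n => μ by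
      simp only [Measure.infinitePi_eq_pi])
  have hun : Measurable fun y : (Fin m × Fin n) ⊕ ℕ → unitInterval =>
      ((fun k => y (Sum.inl k)), fun t => y (Sum.inr t)) := by fun_prop
  have hm : Measurable fun w : (Fin m × Fin n → unitInterval) × (ℕ → unitInterval) =>
      (Sum.elim w.1 w.2 : (Fin m × Fin n) ⊕ ℕ → unitInterval) := by
    rw [measurable_pi_iff]
    rintro (k | k) <;> simp <;> fun_prop
  have h4 : (Measure.infinitePi fun _ : ℕ => μ).map (fun ω =>
      ((fun ij : Fin m × Fin n => ω (pos ij.1 ij.2)), fun t => ω (L + t))) =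
      (Measure.infinitePi fun _ : Fin m × Fin n => μ).prod (Measure.infinitePi fun _ : ℕ => μ) := by
    have h5 := congrArg (Measure.map fun y : (Fin m × Fin n) ⊕ ℕ → unitInterval =>
      ((fun k => y (Sum.inl k)), fun t => y (Sum.inr t))) (h1.trans h2.symm)
    rw [Measure.map_map hun (by fun_prop), Measure.map_map hun hm] at h5
    refine h5.trans ?_
    exact Measure.map_id
  have h6 := congrArg (Measure.map (Prod.map (MeasurableEquiv.curry (Fin m) (Fin n) unitInterval)
    (id : (ℕ → unitInterval) → (ℕ → unitInterval)))) h4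
  rw [Measure.map_map (by fun_prop) (by fun_prop), ← Measure.map_prod_map _ _ (by fun_prop)
    measurable_id, h3, Measure.map_id] at h6
  exact h6

/-! ### Closeness of probability measures -/

/-- The probabilities of all events differ by at most `δ`. -/
def TVClose {α : Type*} [MeasurableSpace α] (μ ν : Measure α) (δ : ℝ) : Prop :=
  ∀ A, MeasurableSet A → μ A ≤ ν A + ENNReal.ofReal δ ∧ ν A ≤ μ A + ENNReal.ofReal δ

theorem TVClose.of_le {α : Type*} [MeasurableSpace α] {μ ν ρ : Measure α} [IsProbabilityMeasure μ]
    [IsProbabilityMeasure ν] {c : ENNReal} {δ₁ δ₂ : ℝ} (h₁ : 0 ≤ δ₁) (h₂ : 0 ≤ δ₂)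
    (hc : c ≤ ENNReal.ofReal (1 + δ₁)) (hρ : ρ Set.univ ≤ ENNReal.ofReal δ₂) (h : μ ≤ c • ν + ρ) :
    TVClose μ ν (δ₁ + δ₂) := by
  have key : ∀ A, MeasurableSet A → μ A ≤ ν A + ENNReal.ofReal (δ₁ + δ₂) := by
    intro A _
    refine (h A).trans ?_
    rw [Measure.add_apply, Measure.smul_apply, smul_eq_mul, ENNReal.ofReal_add h₁ h₂, ← add_assoc]
    refine add_le_add ?_ ((measure_mono (Set.subset_univ A)).trans hρ)
    refine (mul_le_mul_left hc _).trans ?_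
    rw [ENNReal.ofReal_add zero_le_one h₁, add_mul, ENNReal.ofReal_one, one_mul]
    exact add_le_add le_rfl (mul_le_of_le_one_right' prob_le_one)
  intro A hA
  refine ⟨key A hA, ?_⟩
  have hcompl := key Aᶜ hA.compl
  rw [prob_compl_eq_one_sub hA, prob_compl_eq_one_sub hA, tsub_le_iff_right] at hcompl
  have hν : ν A ≤ 1 := prob_le_one
  calc ν A = ν A + 1 - 1 := by rw [ENNReal.add_sub_cancel_right ENNReal.one_ne_top]
    _ ≤ ν A + (1 - ν A + ENNReal.ofReal (δ₁ + δ₂) + μ A) - 1 := by gcongr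
    _ = (ν A + (1 - ν A)) + (μ A + ENNReal.ofReal (δ₁ + δ₂)) - 1 := by
        congr 1; rw [add_assoc (1 - ν A), ← add_assoc, add_comm (ENNReal.ofReal _)]
    _ = μ A + ENNReal.ofReal (δ₁ + δ₂) := by
        rw [add_tsub_cancel_of_le hν, ENNReal.add_sub_cancel_left ENNReal.one_ne_top]

/-! ### The reduction on arrays of samples and tapes -/

namespace RoundingParams
variable (p : RoundingParams)

/-- The length of the prefix code for arrays of `m` samples in dimension `n`. -/
def prefixLength (m n : ℕ) : ℕ := m * (n + 1) * p.codeLength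

/-- The array of samples and the tape that the prefix code leaves to the program that follows. -/
def reduce {m n : ℕ} (w : Samples m n × RAMTape) : Samples m n × RAMTape :=
  (p.transform w.1 fun i j => w.2 (p.tapePos i j), fun t => w.2 (p.prefixLength m n + t))

theorem measurable_reduce {m n : ℕ} : Measurable (p.reduce (m := m) (n := n)) := by
  have h1 : Measurable fun w : Samples m n × RAMTape =>
      (w.1, fun (i : Fin m) (j : Fin n) => w.2 (p.tapePos i j)) := by fun_prop
  have h2 : Measurable fun w : Samples m n × RAMTape =>
      fun t => w.2 (p.prefixLength m n + t) := by fun_prop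
  exact (p.measurable_transform.comp h1).prodMk h2

instance : IsProbabilityMeasure ramTapeMeasure := by
  unfold ramTapeMeasure; infer_instance

theorem map_reduce_eq {m n : ℕ} (D : Measure (Samples m n)) [IsProbabilityMeasure D] :
    (D.prod ramTapeMeasure).map p.reduce =
      ((D.prod (Measure.pi fun _ : Fin m => Measure.pi fun _ : Fin n =>
        (volume : Measure unitInterval))).map fun w => p.transform w.1 fun i j => w.2 i j).prod
          ramTapeMeasure := by
  have h1 := map_split_tape (m := m) (n := n) (p.prefixLength m n) p.tapePos p.tapePos_injective
    p.tapePos_lt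
  have q1 : MeasurePreserving (Prod.map id fun ω : RAMTape =>
      ((fun (i : Fin m) (j : Fin n) => ω (p.tapePos i j)), fun t => ω (p.prefixLength m n + t)))
      (D.prod ramTapeMeasure) (D.prod ((Measure.pi fun _ : Fin m => Measure.pi fun _ : Fin n =>
        (volume : Measure unitInterval)).prod ramTapeMeasure)) :=
    (MeasurePreserving.id D).prod ⟨by fun_prop, h1⟩
  have q2 := (measurePreserving_prodAssoc D (Measure.pi fun _ : Fin m => Measure.pi fun _ : Fin n =>
        (volume : Measure unitInterval)) ramTapeMeasure).symm
  have hprob : IsProbabilityMeasure ((D.prod (Measure.pi fun _ : Fin m => Measure.pi fun _ : Fin n =>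
        (volume : Measure unitInterval))).map fun w => p.transform w.1 fun i j => w.2 i j) :=
    Measure.isProbabilityMeasure_map p.measurable_transform.aemeasurable
  have q3 := MeasurePreserving.prod (μa := D.prod (Measure.pi fun _ : Fin m =>
    Measure.pi fun _ : Fin n => (volume : Measure unitInterval)))
    ⟨p.measurable_transform, rfl⟩ (MeasurePreserving.id ramTapeMeasure)
  exact (q3.comp (q2.comp q1)).map_eq

/-- What the domination argument needs to know about the parameters. -/
structure IsGood (m n : ℕ) (δ : ℝ) : Prop where
  one_le_q : 1 ≤ p.q
  δ_nonneg : 0 ≤ δ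
  dominated : ∃ c : ENNReal, c ≠ ⊤ ∧ c ^ (n * m) ≤ ENNReal.ofReal (1 + δ) ∧
    (((gaussianWidth 1).prod volume).restrict (p.inRange ×ˢ Set.univ)).map p.roundPair ≤
      c • (uniformZMod p.q).prod (gaussianWidth p.t)
  tail : (m * n : ℕ) * gaussianWidth 1 p.inRangeᶜ ≤ ENNReal.ofReal δ

variable {p}

theorem IsGood.isProbabilityMeasure_idealLaw {m n : ℕ} {δ : ℝ} (h : p.IsGood m n δ) (E : Measure ℝ)
    [IsProbabilityMeasure E] : IsProbabilityMeasure (p.idealLaw n E) := by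
  have := isProbabilityMeasure_uniformZMod h.one_le_q
  unfold idealLaw
  infer_instance

theorem IsGood.tvClose {m n : ℕ} {δ : ℝ} (h : p.IsGood m n δ) (E : Measure ℝ)
    [IsProbabilityMeasure E] {f : (Fin n → ℝ) × ℝ → (Fin n → ℝ) × ℝ} (hf : Measurable f)
    {Ψ : (Fin n → ℝ × ℝ) × ℝ → (Fin n → ℝ) × ℝ} (hΨ : Measurable Ψ)
    (hΨf : ∀ w ∈ p.goodSample n, Ψ (p.roundSample w) =
      (fun j => p.round ((f (fun j => (w.1 j).1, w.2)).1 j) (w.1 j).2,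
        p.q * (f (fun j => (w.1 j).1, w.2)).2)) :
    TVClose (((Measure.pi fun _ : Fin m => ((gaussianVec n 1).prod E).map f).prod
      ramTapeMeasure).map p.reduce)
      ((Measure.pi fun _ : Fin m => (p.idealLaw n E).map Ψ).prod ramTapeMeasure) (δ + δ) := by
  obtain ⟨c, hc, hpow, hdom⟩ := h.dominated
  have := h.isProbabilityMeasure_idealLaw E
  have h1 : IsProbabilityMeasure ((p.idealLaw n E).map Ψ) :=
    Measure.isProbabilityMeasure_map hΨ.aemeasurable
  have h2 : IsProbabilityMeasure (((gaussianVec n 1).prod E).map f) :=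
    Measure.isProbabilityMeasure_map hf.aemeasurable
  obtain ⟨ρ, hρ, hle⟩ := p.map_transform_le (m := m) h.one_le_q hc hdom E hf hΨ hΨf
  have h3 : IsProbabilityMeasure (((Measure.pi fun _ : Fin m => ((gaussianVec n 1).prod E).map f).prod
      ramTapeMeasure).map p.reduce) :=
    Measure.isProbabilityMeasure_map p.measurable_reduce.aemeasurable
  have hρfin : IsFiniteMeasure ρ := ⟨(hρ.trans h.tail).trans_lt ENNReal.ofReal_lt_top⟩
  refine TVClose.of_le (c := c ^ (n * m)) (ρ := ρ.prod ramTapeMeasure) h.δ_nonneg h.δ_nonneg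
    hpow ?_ ?_
  · rw [← Set.univ_prod_univ, Measure.prod_prod, measure_univ (μ := ramTapeMeasure), mul_one]
    exact hρ.trans h.tail
  · rw [p.map_reduce_eq, ← Measure.prod_smul_left, ← Measure.add_prod]
    exact Measure.prod_mono hle le_rfl

end RoundingParams

/-! ### The two reductions -/

theorem map_mul_uniformTorus {q : ℝ} (hq : 0 < q) :
    (uniformTorus 1).map (fun x => q * x) = uniformTorus q := by
  ext A hA
  rw [Measure.map_apply (by fun_prop) hA, uniformTorus, uniformTorus,
    cond_apply measurableSet_Ico, cond_apply measurableSet_Ico]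
  have hpre : Set.Ico 0 1 ∩ (fun x => q * x) ⁻¹' A = (fun x => q * x) ⁻¹' (Set.Ico 0 q ∩ A) := by
    ext x
    simp only [Set.mem_inter_iff, Set.mem_Ico, Set.mem_preimage]
    have h1 : 0 ≤ q * x ↔ 0 ≤ x := mul_nonneg_iff_of_pos_left hq
    have h2 : q * x < q ↔ x < 1 := by
      constructor <;> intro h <;> nlinarith
    rw [h1, h2]
  rw [hpre, Real.volume_preimage_mul_left hq.ne', Real.volume_Ico, Real.volume_Ico,
    abs_of_pos (inv_pos.2 hq), sub_zero, sub_zero, ENNReal.ofReal_one, inv_one, one_mul,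
    ENNReal.ofReal_inv_of_pos hq]

theorem isProbabilityMeasure_uniformTorus {q : ℝ} (hq : 0 < q) :
    IsProbabilityMeasure (uniformTorus q) := by
  refine cond_isProbabilityMeasure_of_finite ?_ ?_ <;> simp [Real.volume_Ico, hq]

namespace RoundingParams
variable {p : RoundingParams}

theorem measurePreserving_residues {n : ℕ} (hq : 1 ≤ p.q) (E : Measure ℝ) [IsProbabilityMeasure E] :
    MeasurePreserving (fun w : (Fin n → ℝ × ℝ) × ℝ =>
      ((fun j => (w.1 j).1), ((fun j => (w.1 j).2), w.2))) (p.idealLaw n E)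
      ((uniformZModVec n p.q).prod ((Measure.pi fun _ : Fin n => gaussianWidth p.t).prod E)) := by
  have := isProbabilityMeasure_uniformZMod hq
  have h1 := (measurePreserving_arrowProdEquivProdArrow ℝ ℝ (Fin n) (fun _ => uniformZMod p.q)
    fun _ => gaussianWidth p.t).prod (MeasurePreserving.id E)
  have h2 := measurePreserving_prodAssoc (Measure.pi fun _ : Fin n => uniformZMod p.q)
    (Measure.pi fun _ : Fin n => gaussianWidth p.t) E
  exact h2.comp h1

theorem isProbabilityMeasure_uniformZModVec {n : ℕ} {q : ℕ} (hq : 1 ≤ q) :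
    IsProbabilityMeasure (uniformZModVec n q) := by
  have := isProbabilityMeasure_uniformZMod hq
  unfold uniformZModVec
  infer_instance

theorem isProbabilityMeasure_nullDist {m n : ℕ} (A : Measure (Fin n → ℝ)) [IsProbabilityMeasure A]
    {q : ℝ} (hq : 0 < q) : IsProbabilityMeasure (nullDist m A q) := by
  have := isProbabilityMeasure_uniformTorus hq
  unfold nullDist
  infer_instance

theorem IsGood.tvClose_nullDist {m n : ℕ} {δ : ℝ} (h : p.IsGood m n δ) :
    TVClose (((nullDist m (gaussianVec n 1) 1).prod ramTapeMeasure).map p.reduce)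
      ((nullDist m (uniformZModVec n p.q) p.q).prod ramTapeMeasure) (δ + δ) := by
  have hq0 : (0:ℝ) < p.q := by exact_mod_cast h.one_le_q
  have := isProbabilityMeasure_uniformTorus one_pos
  have := isProbabilityMeasure_uniformZModVec (n := n) h.one_le_q
  have h1 := h.tvClose (uniformTorus 1) (f := id) (measurable_id)
    (Ψ := fun w => ((fun j => (w.1 j).1), p.q * w.2)) (by fun_prop) fun w _ => rfl
  rw [Measure.map_id] at h1
  have h2 : (p.idealLaw n (uniformTorus 1)).map
      (fun w => ((fun j => (w.1 j).1), (p.q : ℝ) * w.2)) =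
      (uniformZModVec n p.q).prod (uniformTorus p.q) := by
    have h3 := (MeasurePreserving.id (uniformZModVec n p.q)).prod ((⟨by fun_prop,
      map_mul_uniformTorus hq0⟩ : MeasurePreserving (fun x => (p.q : ℝ) * x) (uniformTorus 1)
        (uniformTorus p.q)).comp (measurePreserving_snd (μ := Measure.pi fun _ : Fin n =>
          gaussianWidth p.t)))
    exact (h3.comp (measurePreserving_residues h.one_le_q (uniformTorus 1))).map_eq
  rw [h2] at h1
  exact h1

theorem IsGood.tvClose_sampleLaw {m n : ℕ} {δ r τ γ β σ : ℝ} (h : p.IsGood m n δ)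
    (hscale : p.scale = p.q * τ) (hr : r ≠ 0) (hγ : γ = r * τ)
    (hσ : σ ^ 2 = (p.q * β) ^ 2 + (r * p.t) ^ 2) (s : Fin n → ℤ)
    (hs : ∑ j, (s j : ℝ) ^ 2 = r ^ 2) :
    TVClose (((Measure.pi fun _ : Fin m => sampleLaw 1 γ (gaussianVec n 1)
      (fun j => 1 / r * (s j : ℝ)) (gaussianWidth β)).prod ramTapeMeasure).map p.reduce)
      ((Measure.pi fun _ : Fin m => sampleLaw p.q 1 (uniformZModVec n p.q)
        (fun j => 1 * (s j : ℝ)) (gaussianWidth σ)).prod ramTapeMeasure) (δ + δ) := by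
  have hq0 : (0:ℝ) < p.q := by exact_mod_cast h.one_le_q
  have := isProbabilityMeasure_uniformZModVec (n := n) h.one_le_q
  set Ψ : (Fin n → ℝ × ℝ) × ℝ → (Fin n → ℝ) × ℝ := fun w => ((fun j => (w.1 j).1),
    realMod (1 * ∑ j, (w.1 j).1 * (1 * (s j : ℝ)) +
      (∑ j, (w.1 j).2 * (s j : ℝ) + p.q * w.2)) p.q) with hΨ
  have hΨm : Measurable Ψ :=
    Measurable.prodMk (by fun_prop) ((measurable_realMod _).comp (by fun_prop))
  have h1 := h.tvClose (gaussianWidth β) (measurable_sample 1 γ fun j => 1 / r * (s j : ℝ)) hΨm ?_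
  · have h2 : (p.idealLaw n (gaussianWidth β)).map Ψ = sampleLaw p.q 1 (uniformZModVec n p.q)
        (fun j => 1 * (s j : ℝ)) (gaussianWidth σ) := by
      have h3 := (MeasurePreserving.id (uniformZModVec n p.q)).prod (⟨by fun_prop,
        map_noise_eq (fun j => (s j : ℝ)) hs hσ⟩ : MeasurePreserving
          (fun w : (Fin n → ℝ) × ℝ => ∑ j, w.1 j * (s j : ℝ) + p.q * w.2)
          ((Measure.pi fun _ : Fin n => gaussianWidth p.t).prod (gaussianWidth β))
          (gaussianWidth σ))
      have h4 : MeasurePreserving _ ((uniformZModVec n p.q).prod (gaussianWidth σ))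
          (sampleLaw p.q 1 (uniformZModVec n p.q) (fun j => 1 * (s j : ℝ)) (gaussianWidth σ)) :=
        ⟨measurable_sample _ _ _, rfl⟩
      exact (h4.comp (h3.comp (measurePreserving_residues h.one_le_q (gaussianWidth β)))).map_eq
    rw [h2] at h1
    exact h1
  · rintro ⟨w, e⟩ hw
    have hround : ∀ j, ∃ k : ℤ, p.round (w j).1 (w j).2 =
        p.roundInt ((w j).1 * p.scale) (w j).2 + p.q * k := by
      intro j
      rw [p.round_eq_realMod h.one_le_q _ (hw.1 j trivial).1]
      exact exists_realMod_eq _ _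
    choose k hk using hround
    simp only [hΨ, roundSample, roundPair, Prod.mk.injEq, true_and]
    rw [mul_realMod hq0, hγ]
    have harg : 1 * ∑ j, p.round (w j).1 (w j).2 * (1 * (s j : ℝ)) +
        (∑ j, ((w j).1 * p.scale - p.roundInt ((w j).1 * p.scale) (w j).2) * (s j : ℝ) + p.q * e) =
        p.q * (r * τ * ∑ j, (w j).1 * (1 / r * (s j : ℝ)) + e) + p.q * ((∑ j, k j * s j : ℤ) : ℝ) := by
      have h5 : ∀ j, p.round (w j).1 (w j).2 * (1 * (s j : ℝ)) +
          ((w j).1 * p.scale - p.roundInt ((w j).1 * p.scale) (w j).2) * (s j : ℝ) =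
          p.q * (r * τ) * ((w j).1 * (1 / r * (s j : ℝ))) + p.q * ((k j : ℝ) * s j) := by
        intro j
        rw [hk, hscale]
        field_simp
        ring
      rw [one_mul, ← add_assoc, ← Finset.sum_add_distrib, Finset.sum_congr rfl fun j _ => h5 j,
        Finset.sum_add_distrib, ← Finset.mul_sum, ← Finset.mul_sum]
      push_cast
      ring
    rw [harg, realMod_add_mul_int hq0]

end RoundingParams

/-! ### Random secrets -/

theorem measurable_secret {n : ℕ} (c : ℝ) :
    Measurable fun (s : Fin n → ℤ) (j : Fin n) => c * (s j : ℝ) := by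
  rw [measurable_pi_iff]
  intro j
  exact ((measurable_from_top (f := fun z : ℤ => (z : ℝ))).comp (measurable_pi_apply j)).const_mul c

instance {n : ℕ} (c : ℝ) (S : PMF (Fin n → ℤ)) : IsProbabilityMeasure (scaledSecret c S) :=
  Measure.isProbabilityMeasure_map (measurable_secret c).aemeasurable

theorem measurable_noisy {m n : ℕ} (q γ : ℝ) :
    Measurable fun w : (Fin n → ℝ) × (Fin m → Fin n → ℝ) × (Fin m → ℝ) =>
      (w.1, (fun i => (w.2.1 i, realMod (γ * ∑ j, w.2.1 i j * w.1 j + w.2.2 i) q) : Samples m n)) := by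
  refine measurable_fst.prodMk (measurable_pi_iff.2 fun i => Measurable.prodMk (by fun_prop) ?_)
  exact (measurable_realMod q).comp (by fun_prop)

theorem isProbabilityMeasure_noisyJoint {m n : ℕ} (q γ : ℝ) (A S : Measure (Fin n → ℝ))
    [IsProbabilityMeasure A] [IsProbabilityMeasure S] (E : Measure ℝ) [IsProbabilityMeasure E] :
    IsProbabilityMeasure (noisyJoint m q γ A S E) :=
  Measure.isProbabilityMeasure_map (measurable_noisy q γ).aemeasurable

theorem noisyJoint_prod_apply {m n : ℕ} (q γ c : ℝ) (A : Measure (Fin n → ℝ))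
    [IsProbabilityMeasure A] (S : PMF (Fin n → ℤ)) (E : Measure ℝ) [IsProbabilityMeasure E]
    {B : Set (((Fin n → ℝ) × Samples m n) × RAMTape)} (hB : MeasurableSet B) :
    ((noisyJoint m q γ A (scaledSecret c S) E).prod ramTapeMeasure) B =
      ∫⁻ s, ((Measure.pi fun _ : Fin m => sampleLaw q γ A (fun j => c * (s j : ℝ)) E).prod
        ramTapeMeasure) ((fun w => (((fun j => c * (s j : ℝ)), w.1), w.2)) ⁻¹' B) ∂S.toMeasure := by
  have hprob := isProbabilityMeasure_noisyJoint (m := m) q γ A (scaledSecret c S) E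
  set X := (Measure.pi fun _ : Fin m => A).prod (Measure.pi fun _ : Fin m => E) with hX
  have p1 : MeasurePreserving _ ((scaledSecret c S).prod X)
    (noisyJoint m q γ A (scaledSecret c S) E) := ⟨measurable_noisy q γ, rfl⟩
  have p2 := (p1.prod (MeasurePreserving.id ramTapeMeasure)).comp
    (measurePreserving_prodAssoc (scaledSecret c S) X ramTapeMeasure).symm
  have p3 : MeasurePreserving (fun (s : Fin n → ℤ) (j : Fin n) => c * (s j : ℝ)) S.toMeasure
    (scaledSecret c S) := ⟨measurable_secret c, rfl⟩
  have p4 := p2.comp (p3.prod (MeasurePreserving.id (X.prod ramTapeMeasure)))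
  rw [← p4.measure_preimage hB.nullMeasurableSet, Measure.prod_apply (p4.measurable hB)]
  refine lintegral_congr fun s => ?_
  have hn : Measurable fun (w : (Fin m → Fin n → ℝ) × (Fin m → ℝ)) (i : Fin m) =>
      (w.1 i, realMod (γ * ∑ j, w.1 i j * (c * (s j : ℝ)) + w.2 i) q) :=
    measurable_pi_iff.2 fun i => Measurable.prodMk (by fun_prop)
      ((measurable_realMod q).comp (by fun_prop))
  have p5 := MeasurePreserving.prod (⟨hn, map_noisy_eq_pi q γ A (fun j => c * (s j : ℝ)) E⟩ :
    MeasurePreserving _ X _) (MeasurePreserving.id ramTapeMeasure)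
  have hm : Measurable fun w : Samples m n × RAMTape => (((fun j => c * (s j : ℝ)), w.1), w.2) := by
    fun_prop
  rw [← p5.measure_preimage (hm hB).nullMeasurableSet]
  rfl

namespace RoundingParams
variable {p : RoundingParams}

/-- The secret, the samples and the tape after the reduction. -/
def reduceJoint (p : RoundingParams) (r : ℝ) {m n : ℕ}
    (w : ((Fin n → ℝ) × Samples m n) × RAMTape) : ((Fin n → ℝ) × Samples m n) × RAMTape :=
  (((fun j => r * w.1.1 j), (p.reduce (w.1.2, w.2)).1), (p.reduce (w.1.2, w.2)).2)

theorem measurable_reduceJoint (r : ℝ) {m n : ℕ} :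
    Measurable (p.reduceJoint r (m := m) (n := n)) := by
  have h : Measurable fun w : ((Fin n → ℝ) × Samples m n) × RAMTape => p.reduce (w.1.2, w.2) :=
    p.measurable_reduce.comp (by fun_prop)
  exact Measurable.prodMk (Measurable.prodMk (by fun_prop) h.fst) h.snd

theorem IsGood.tvClose_joint {m n : ℕ} {δ r τ γ β σ : ℝ} (h : p.IsGood m n δ)
    (hscale : p.scale = p.q * τ) (hr : r ≠ 0) (hγ : γ = r * τ)
    (hσ : σ ^ 2 = (p.q * β) ^ 2 + (r * p.t) ^ 2) (S : PMF (Fin n → ℤ))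
    (hS : ∀ s ∈ S.support, ∑ j, (s j : ℝ) ^ 2 = r ^ 2) :
    TVClose (((clweJoint m (gaussianVec n 1) (scaledSecret (1 / r) S) γ β).prod
      ramTapeMeasure).map (p.reduceJoint r))
      ((lweJoint m p.q (uniformZModVec n p.q) S (gaussianWidth σ)).prod ramTapeMeasure) (δ + δ) := by
  have := isProbabilityMeasure_uniformZModVec (n := n) h.one_le_q
  intro B hB
  have hBr := (p.measurable_reduceJoint r) hB
  rw [Measure.map_apply (p.measurable_reduceJoint r) hB, clweJoint, lweJoint,
    noisyJoint_prod_apply _ _ _ _ _ _ hBr, noisyJoint_prod_apply _ _ _ _ _ _ hB]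
  have hm : ∀ s : Fin n → ℤ, Measurable fun w : Samples m n × RAMTape =>
      (((fun j => 1 * (s j : ℝ)), w.1), w.2) := fun s => by fun_prop
  have hfix : ∀ s : Fin n → ℤ, (fun w : Samples m n × RAMTape =>
      (((fun j => 1 / r * (s j : ℝ)), w.1), w.2)) ⁻¹' (p.reduceJoint r ⁻¹' B) =
      p.reduce ⁻¹' ((fun w => (((fun j => 1 * (s j : ℝ)), w.1), w.2)) ⁻¹' B) := by
    intro s
    ext w
    simp only [Set.mem_preimage, reduceJoint]
    have : (fun j => r * (1 / r * (s j : ℝ))) = fun j => 1 * (s j : ℝ) := by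
      funext j; field_simp
    rw [this]
  have hclose := fun s (hs : s ∈ S.support) => h.tvClose_sampleLaw (m := m) hscale hr hγ hσ s (hS s hs)
    _ (hm s hB)
  simp only [Measure.map_apply p.measurable_reduce (hm _ hB), ← hfix] at hclose
  have hae : ∀ᵐ s ∂S.toMeasure, s ∈ S.support := by
    rw [ae_iff]
    exact (S.toMeasure_apply_eq_zero_iff (Set.to_countable _).measurableSet).2
      (Set.disjoint_left.2 fun s hs hs' => hs' hs)
  have hconst : ∫⁻ _, ENNReal.ofReal (δ + δ) ∂S.toMeasure = ENNReal.ofReal (δ + δ) := by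
    rw [lintegral_const, measure_univ, mul_one]
  constructor
  · refine (lintegral_mono_ae (hae.mono fun s hs => (hclose s hs).1)).trans ?_
    rw [lintegral_add_right _ measurable_const, hconst]
  · refine (lintegral_mono_ae (hae.mono fun s hs => (hclose s hs).2)).trans ?_
    rw [lintegral_add_right _ measurable_const, hconst]

end RoundingParams

theorem TVClose.abs_real_sub_le {α : Type*} [MeasurableSpace α] {μ ν : Measure α}
    [IsFiniteMeasure μ] [IsFiniteMeasure ν] {δ : ℝ} (hδ : 0 ≤ δ) (h : TVClose μ ν δ) {A : Set α}
    (hA : MeasurableSet A) : |μ.real A - ν.real A| ≤ δ := by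
  have key : ∀ {μ ν : Measure α} [IsFiniteMeasure μ] [IsFiniteMeasure ν],
      μ A ≤ ν A + ENNReal.ofReal δ → μ.real A ≤ ν.real A + δ := by
    intro μ ν _ _ hle
    have := ENNReal.toReal_mono (by finiteness) hle
    rwa [ENNReal.toReal_add (by finiteness) (by finiteness), ENNReal.toReal_ofReal hδ] at this
  obtain ⟨h1, h2⟩ := h A hA
  rw [abs_le]
  constructor <;> linarith [key h1, key h2]

/-! ### The reductions as programs -/

/-- Multiply the registers `0, …, n - 1` by `c`. -/
def rescaleCode (n : ℕ) (c : ℝ) : List RAMInstr :=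
  .const n c :: (List.range n).map fun j => .mul j j n

theorem exec_rescaleCode (n : ℕ) (c : ℝ) (ω : RAMTape) (R : ℕ → ℝ) (j : Fin n) :
    execCode (rescaleCode n c) ω R j = R j * c := by
  have key : ∀ k ≤ n, ∀ (ω : RAMTape) (R : ℕ → ℝ),
      execCode ((List.range k).map fun j => .mul j j n) ω R =
        fun i => if i < k then R i * R n else R i := by
    intro k hk ω R
    induction k with
    | zero => simp [execCode]
    | succ k ih =>
      rw [List.range_succ, List.map_append, execCode_append, ih (by omega)]
      simp only [List.map_cons, List.map_nil, execCode, RAMInstr.exec]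
      funext i
      by_cases hi : i = k
      · subst hi
        simp [show ¬ n < i by omega]
      · rw [Function.update_of_ne hi]
        simp only [show i < k + 1 ↔ i < k by omega]
  rw [rescaleCode, execCode, key n le_rfl]
  simp [RAMInstr.exec, j.2.ne]

theorem isStraight_rescaleCode (n : ℕ) (c : ℝ) : ∀ i ∈ rescaleCode n c, i.IsStraight := by
  intro i hi
  simp only [rescaleCode, List.mem_cons, List.mem_map] at hi
  unfold RAMInstr.IsStraight
  aesop

theorem length_rescaleCode (n : ℕ) (c : ℝ) : (rescaleCode n c).length = n + 1 := by
  simp [rescaleCode]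

theorem RAMProgram.RunsInTime.mono {P : RAMProgram} {m n T T' : ℕ} (h : P.RunsInTime m n T)
    (hT : T ≤ T') : P.RunsInTime m n T' :=
  ⟨h.1.trans hT, fun x ω => RAMProgram.haltsBy_mono (h.2 x ω) hT⟩

namespace RoundingParams
variable (p : RoundingParams)

/-- Reduce the samples, run `P`, then run `post`. -/
def reduction (m n : ℕ) (post : List RAMInstr) (P : RAMProgram) : RAMProgram :=
  RAMProgram.sandwich (p.prefixCode n (m * (n + 1)) (m * (n + 1))) post P

theorem run_reduction {m n T : ℕ} {post : List RAMInstr} (hpost : ∀ i ∈ post, i.IsStraight)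
    {P : RAMProgram} (hP : P.RunsInTime m n T) (x : Samples m n) (ω : RAMTape) :
    (p.reduction m n post P).HaltsBy x.toReg ω (p.prefixLength m n + T + post.length) ∧
    ∃ ω' : RAMTape,
      ((p.reduction m n post P).run x.toReg ω (p.prefixLength m n + T + post.length)).reg =
        execCode post ω' (P.run (p.reduce (x, ω)).1.toReg (p.reduce (x, ω)).2 T).reg := by
  have h := RAMProgram.run_sandwich (p.prefixCode n (m * (n + 1)) (m * (n + 1))) post
    (p.isStraight_prefixCode _ _ _) hpost P x.toReg ω T
  rw [p.exec_prefixCode_toReg, p.length_prefixCode] at h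
  exact h (hP.2 _ _)

theorem runsInTime_reduction {m n T : ℕ} {post : List RAMInstr}
    (hpost : ∀ i ∈ post, i.IsStraight) {P : RAMProgram} (hP : P.RunsInTime m n T) :
    (p.reduction m n post P).RunsInTime m n (p.prefixLength m n + T + post.length) := by
  refine ⟨?_, fun x ω => (p.run_reduction hpost hP x ω).1⟩
  rw [reduction, RAMProgram.length_sandwich, p.length_prefixCode]
  have := hP.1
  unfold prefixLength
  omega

theorem reduction_accepts_iff {m n T : ℕ} {P : RAMProgram} (hP : P.RunsInTime m n T)
    (x : Samples m n) (ω : RAMTape) :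
    (p.reduction m n [] P).Accepts x ω ↔ P.Accepts (p.reduce (x, ω)).1 (p.reduce (x, ω)).2 := by
  obtain ⟨h1, ω', h2⟩ := p.run_reduction (post := []) (by simp) hP x ω
  rw [RAMProgram.accepts_iff h1, RAMProgram.accepts_iff (hP.2 _ _), h2]
  rfl

theorem reduction_outputs {m n T : ℕ} {P : RAMProgram} (hP : P.RunsInTime m n T) {r : ℝ} (hr : r ≠ 0)
    (x : Samples m n) (ω : RAMTape) (v : Fin n → ℝ)
    (h : P.Outputs (p.reduce (x, ω)).1 (p.reduce (x, ω)).2 fun j => r * v j) :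
    (p.reduction m n (rescaleCode n (1 / r)) P).Outputs x ω v := by
  obtain ⟨h1, ω', h2⟩ := p.run_reduction (isStraight_rescaleCode n (1 / r)) hP x ω
  rw [RAMProgram.outputs_iff h1]
  rw [RAMProgram.outputs_iff (hP.2 _ _)] at h
  intro j
  rw [h2, exec_rescaleCode, h j]
  field_simp

end RoundingParams

theorem acceptProb_map_snd {m n : ℕ} (P : RAMProgram) (J : Measure ((Fin n → ℝ) × Samples m n))
    [IsProbabilityMeasure J] : P.acceptProb (J.map Prod.snd) =
      (J.prod ramTapeMeasure).real {w | P.Accepts w.1.2 w.2} := by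
  have h1 : IsProbabilityMeasure (J.map Prod.snd) :=
    Measure.isProbabilityMeasure_map measurable_snd.aemeasurable
  have h : MeasurePreserving (Prod.map Prod.snd id) (J.prod ramTapeMeasure)
      ((J.map Prod.snd).prod ramTapeMeasure) :=
    MeasurePreserving.prod ⟨measurable_snd, rfl⟩ (MeasurePreserving.id ramTapeMeasure)
  rw [RAMProgram.acceptProb, Measure.real, Measure.real,
    ← h.measure_preimage (P.measurableSet_accepts m n).nullMeasurableSet]
  rfl

namespace RoundingParams
variable {p : RoundingParams}

theorem IsGood.hasDistinguisher {m n : ℕ} {δ r τ γ β σ : ℝ} (h : p.IsGood m n δ)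
    (hscale : p.scale = p.q * τ) (hr : r ≠ 0) (hγ : γ = r * τ)
    (hσ : σ ^ 2 = (p.q * β) ^ 2 + (r * p.t) ^ 2) (S : PMF (Fin n → ℤ))
    (hS : ∀ s ∈ S.support, ∑ j, (s j : ℝ) ^ 2 = r ^ 2) {T T' : ℕ} {ε : ℝ}
    (hT : p.prefixLength m n + T ≤ T')
    (hD : HasDistinguisher (lweDist m p.q (uniformZModVec n p.q) S (gaussianWidth σ))
      (nullDist m (uniformZModVec n p.q) p.q) T ε) :
    HasDistinguisher (clweDist m (gaussianVec n 1) (scaledSecret (1 / r) S) γ β)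
      (nullDist m (gaussianVec n 1) 1) T' (ε - 4 * δ) := by
  obtain ⟨P, hP, hε⟩ := hD
  have hq0 : (0:ℝ) < p.q := by exact_mod_cast h.one_le_q
  have := isProbabilityMeasure_uniformZModVec (n := n) h.one_le_q
  have hJ1 : IsProbabilityMeasure (clweJoint m (gaussianVec n 1) (scaledSecret (1 / r) S) γ β) :=
    isProbabilityMeasure_noisyJoint _ _ _ _ _
  have hJ2 : IsProbabilityMeasure (lweJoint m p.q (uniformZModVec n p.q) S (gaussianWidth σ)) :=
    isProbabilityMeasure_noisyJoint _ _ _ _ _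
  have hN1 := isProbabilityMeasure_nullDist (m := m) (gaussianVec n 1) one_pos
  have hN2 := isProbabilityMeasure_nullDist (m := m) (uniformZModVec n p.q) hq0
  have hδ2 : 0 ≤ δ + δ := add_nonneg h.δ_nonneg h.δ_nonneg
  refine ⟨p.reduction m n [] P, (p.runsInTime_reduction (by simp) hP).mono (by simpa using hT), ?_⟩
  have hacc := P.measurableSet_accepts m n
  have hacc' : MeasurableSet {w : ((Fin n → ℝ) × Samples m n) × RAMTape | P.Accepts w.1.2 w.2} :=
    (by fun_prop : Measurable fun w : ((Fin n → ℝ) × Samples m n) × RAMTape => (w.1.2, w.2)) hacc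
  have h1 : |(p.reduction m n [] P).acceptProb
      (clweDist m (gaussianVec n 1) (scaledSecret (1 / r) S) γ β) -
      P.acceptProb (lweDist m p.q (uniformZModVec n p.q) S (gaussianWidth σ))| ≤ δ + δ := by
    have hm := (p.measurable_reduceJoint r (m := m) (n := n))
    have hprob := Measure.isProbabilityMeasure_map (μ := (clweJoint m (gaussianVec n 1)
      (scaledSecret (1 / r) S) γ β).prod ramTapeMeasure) hm.aemeasurable
    have h2 := (h.tvClose_joint (m := m) hscale hr hγ hσ S hS).abs_real_sub_le hδ2 hacc'
    rw [clweDist, lweDist, acceptProb_map_snd, acceptProb_map_snd]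
    rw [map_measureReal_apply hm hacc'] at h2
    refine le_of_eq_of_le ?_ h2
    congr 3
    ext w
    exact p.reduction_accepts_iff hP w.1.2 w.2
  have h2 : |(p.reduction m n [] P).acceptProb (nullDist m (gaussianVec n 1) 1) -
      P.acceptProb (nullDist m (uniformZModVec n p.q) p.q)| ≤ δ + δ := by
    have hm := (p.measurable_reduce (m := m) (n := n))
    have hprob := Measure.isProbabilityMeasure_map (μ := (nullDist m (gaussianVec n 1) 1).prod
      ramTapeMeasure) hm.aemeasurable
    have h3 := (h.tvClose_nullDist (m := m)).abs_real_sub_le hδ2 hacc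
    rw [map_measureReal_apply hm hacc] at h3
    refine le_of_eq_of_le ?_ h3
    unfold RAMProgram.acceptProb
    congr 3
    ext w
    exact p.reduction_accepts_iff hP w.1 w.2
  rw [abs_le] at h1 h2
  rcases abs_cases (P.acceptProb (lweDist m p.q (uniformZModVec n p.q) S (gaussianWidth σ)) -
    P.acceptProb (nullDist m (uniformZModVec n p.q) p.q)) with ⟨h3, -⟩ | ⟨h3, -⟩
  · refine le_trans ?_ (le_abs_self _)
    linarith [h1.1, h2.2]
  · refine le_trans ?_ (neg_le_abs _)
    linarith [h1.2, h2.1]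

theorem IsGood.hasSearchSolver {m n : ℕ} {δ r τ γ β σ : ℝ} (h : p.IsGood m n δ)
    (hscale : p.scale = p.q * τ) (hr : r ≠ 0) (hγ : γ = r * τ)
    (hσ : σ ^ 2 = (p.q * β) ^ 2 + (r * p.t) ^ 2) (S : PMF (Fin n → ℤ))
    (hS : ∀ s ∈ S.support, ∑ j, (s j : ℝ) ^ 2 = r ^ 2) {T T' : ℕ} {ε : ℝ}
    (hT : p.prefixLength m n + T + (n + 1) ≤ T')
    (hD : HasSearchSolver (lweJoint m p.q (uniformZModVec n p.q) S (gaussianWidth σ)) T ε) :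
    HasSearchSolver (clweJoint m (gaussianVec n 1) (scaledSecret (1 / r) S) γ β) T'
      (ε - 4 * δ) := by
  obtain ⟨P, hP, hε⟩ := hD
  have := isProbabilityMeasure_uniformZModVec (n := n) h.one_le_q
  have hJ1 : IsProbabilityMeasure (clweJoint m (gaussianVec n 1) (scaledSecret (1 / r) S) γ β) :=
    isProbabilityMeasure_noisyJoint _ _ _ _ _
  have hJ2 : IsProbabilityMeasure (lweJoint m p.q (uniformZModVec n p.q) S (gaussianWidth σ)) :=
    isProbabilityMeasure_noisyJoint _ _ _ _ _
  have hδ2 : 0 ≤ δ + δ := add_nonneg h.δ_nonneg h.δ_nonneg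
  refine ⟨p.reduction m n (rescaleCode n (1 / r)) P,
    (p.runsInTime_reduction (isStraight_rescaleCode n (1 / r)) hP).mono
      (by rwa [length_rescaleCode]), ?_⟩
  have hout := P.measurableSet_outputs m n
  have hm := (p.measurable_reduceJoint r (m := m) (n := n))
  have hprob := Measure.isProbabilityMeasure_map (μ := (clweJoint m (gaussianVec n 1)
    (scaledSecret (1 / r) S) γ β).prod ramTapeMeasure) hm.aemeasurable
  have h2 := (h.tvClose_joint (m := m) hscale hr hγ hσ S hS).abs_real_sub_le hδ2 hout
  rw [map_measureReal_apply hm hout] at h2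
  have h3 : ((clweJoint m (gaussianVec n 1) (scaledSecret (1 / r) S) γ β).prod ramTapeMeasure).real
      (p.reduceJoint r ⁻¹' {w | P.Outputs w.1.2 w.2 w.1.1}) ≤
      ((clweJoint m (gaussianVec n 1) (scaledSecret (1 / r) S) γ β).prod ramTapeMeasure).real
      {w | (p.reduction m n (rescaleCode n (1 / r)) P).Outputs w.1.2 w.2 w.1.1} :=
    measureReal_mono fun w hw => p.reduction_outputs hP hr w.1.2 w.2 w.1.1 hw
  linarith [(abs_le.1 h2).1, h.δ_nonneg]

end RoundingParams

/-! ### The choice of the parameters -/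

/-- The parameters of the reduction in dimension `n` with `m` samples and modulus `q`, where `l` is the
binary logarithm of the security parameter, `k` bounds the degree of the growth of `f`, `τ` is the
smoothing width of the input and `t` the width of the rounding. -/
def reductionParams (n m q l k : ℕ) (τ t : ℝ) : RoundingParams where
  q := q
  scale := q * τ
  K := (n + m + (l + 1) ^ 2) + (Nat.log 2 q + 1) + (n + m) + 2 * (l + 1) ^ k + 1
  K₂ := 3 * (n + m + (l + 1) ^ 2)
  Z := n + m + (l + 1) ^ 2
  t := t

/-- A bound for the running time of the reduction. -/
def reductionPoly (k : ℕ) : MvPolynomial (Fin 4) ℕ :=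
  let Z := .X 0 + .X 1 + (.X 3 + 1) ^ 2
  let K := Z + (.X 2 + 1) + (.X 0 + .X 1) + 2 * (.X 3 + 1) ^ k + 1
  .X 1 * (.X 0 + 1) * (8 * (K + 1) + 9 * (3 * Z) + 20 * Z + 27) + (.X 0 + 1)

theorem eval_reductionPoly (n m q l k : ℕ) (τ t : ℝ) :
    (reductionPoly k).eval ![n, m, Nat.log 2 q, l] =
      (reductionParams n m q l k τ t).prefixLength m n + (n + 1) := by
  simp [reductionPoly, reductionParams, RoundingParams.prefixLength, RoundingParams.codeLength]

theorem inv_one_sub_le_exp {y : ℝ} (h0 : 0 ≤ y) (h1 : y ≤ 1 / 2) : 1 / (1 - y) ≤ Real.exp (2 * y) := by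
  rw [div_le_iff₀ (by linarith)]
  nlinarith [Real.add_one_le_exp (2 * y)]

theorem exp_le_one_add_two_mul {y : ℝ} (h0 : 0 ≤ y) (h1 : y ≤ 1) : Real.exp y ≤ 1 + 2 * y := by
  have h := (abs_le.1 (Real.abs_exp_sub_one_sub_id_le (x := y) (by rwa [abs_of_nonneg h0]))).2
  nlinarith

theorem gaussianWidth_one_tail_le {c : ℝ} (hc : 0 < c) :
    gaussianWidth 1 {x | c ≤ |x|} ≤ ENNReal.ofReal (1 / c ^ 2) := by
  have h := meas_ge_le_variance_div_sq (μ := gaussianWidth 1) (X := id)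
    (by unfold gaussianWidth; exact memLp_id_gaussianReal 2) hc
  have hmean : ∫ x, id x ∂gaussianWidth 1 = 0 := by
    unfold gaussianWidth; simp
  rw [hmean] at h
  simp only [id, sub_zero] at h
  refine h.trans (ENNReal.ofReal_le_ofReal ?_)
  gcongr
  have hv : Var[id; gaussianWidth 1] = 1 ^ 2 / (2 * Real.pi) := by
    unfold gaussianWidth
    rw [variance_id_gaussianReal, Real.coe_toNNReal _ (by positivity)]
  rw [hv, div_le_one (by positivity)]
  nlinarith [Real.pi_gt_three]

theorem log_le_natLog_add_one (l : ℕ) : Real.log l ≤ (Nat.log 2 l + 1 : ℕ) := by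
  rcases Nat.eq_zero_or_pos l with rfl | hl
  · simp
  · have h1 : (l : ℝ) ≤ 2 ^ (Nat.log 2 l + 1) := by
      exact_mod_cast (Nat.lt_pow_succ_log_self one_lt_two l).le
    have h2 := Real.log_le_log (by exact_mod_cast hl) h1
    rw [Real.log_pow] at h2
    have h3 : Real.log 2 ≤ 1 := by linarith [Real.log_two_lt_d9]
    exact h2.trans (mul_le_of_le_one_right (Nat.cast_nonneg _) h3)

theorem inv_two_pow_le_exp {h : ℝ} {Z : ℕ} (hZ : h ≤ Z) : ((2:ℝ) ^ Z)⁻¹ ≤ Real.exp (-h / 2) := by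
  rw [← Real.exp_log (show (0:ℝ) < (2 ^ Z)⁻¹ by positivity), Real.log_inv, Real.log_pow]
  apply Real.exp_le_exp.2
  have := Real.log_two_gt_d9
  have hZ0 : (0:ℝ) ≤ Z := Nat.cast_nonneg _
  nlinarith

theorem natCast_mul_le_two_pow (n m : ℕ) : (n : ℝ) * m ≤ 2 ^ (n + m) := by
  have h1 : (n : ℝ) ≤ 2 ^ n := by exact_mod_cast Nat.lt_two_pow_self.le
  have h2 : (m : ℝ) ≤ 2 ^ m := by exact_mod_cast Nat.lt_two_pow_self.le
  rw [pow_add]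
  gcongr

theorem exp_le_two_pow {y : ℝ} {a : ℕ} (h : y ≤ a) : Real.exp y ≤ 2 ^ (2 * a) := by
  rw [← Real.exp_log (show (0:ℝ) < 2 ^ (2 * a) by positivity), Real.log_pow]
  apply Real.exp_le_exp.2
  have := Real.log_two_gt_d9
  have ha : (0:ℝ) ≤ a := Nat.cast_nonneg _
  push_cast
  nlinarith

namespace RoundingParams
variable (p : RoundingParams)

theorem kappa_nonneg : 0 ≤ p.kappa := by unfold kappa; positivity

theorem kappa_le (ht : 1 ≤ p.t) : p.kappa ≤ 7 := by
  unfold kappa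
  have h1 : (1:ℝ) ≤ p.t ^ 2 := one_le_pow₀ ht
  have h2 := Real.pi_lt_d2
  rw [div_le_iff₀ (by linarith)]
  linarith

theorem precision_le {N : ℝ} (hN0 : 0 ≤ N) (hN : N ≤ 2 ^ p.Z) (hK₂ : p.K₂ = 3 * p.Z) (ht : 1 ≤ p.t) :
    N * (2 * p.Z * p.kappa * (2 ^ p.K₂)⁻¹) ≤ 14 * ((2:ℝ) ^ p.Z)⁻¹ := by
  have h1 : (p.Z : ℝ) ≤ 2 ^ p.Z := by exact_mod_cast (Nat.lt_two_pow_self (n := p.Z)).le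
  have hκ := p.kappa_le ht
  have hκ0 := p.kappa_nonneg
  have hZ0 : (0:ℝ) ≤ p.Z := Nat.cast_nonneg _
  rw [hK₂, mul_comm 3, pow_mul]
  generalize (2:ℝ) ^ p.Z = X at *
  generalize p.kappa = κ at *
  generalize (p.Z : ℝ) = z at *
  rcases hN0.eq_or_lt with rfl | hN1
  · have : 0 ≤ X⁻¹ := inv_nonneg.2 (hZ0.trans h1)
    linarith
  have hX : 0 < X := hN1.trans_le hN
  have h2 : N * z ≤ X * X := mul_le_mul hN h1 hZ0 hX.le
  have h3 : N * z * κ ≤ X * X * 7 := mul_le_mul h2 hκ hκ0 (by positivity)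
  calc N * (2 * z * κ * (X ^ 3)⁻¹) = 2 * (N * z * κ) * (X ^ 3)⁻¹ := by ring
    _ ≤ 2 * (X * X * 7) * (X ^ 3)⁻¹ := by gcongr
    _ = 14 * X⁻¹ := by field_simp; norm_num

theorem excess_nonneg {τ : ℝ} (hx : 8 * Real.exp (-Real.pi * p.t ^ 2) ≤ 1 / 2) :
    0 ≤ p.excess τ := by
  unfold excess
  have : 0 ≤ 1 - 8 * Real.exp (-Real.pi * p.t ^ 2) := by linarith
  positivity

theorem excess_le_exp {τ : ℝ} (hτ : p.t ^ 2 ≤ τ ^ 2)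
    (hx : 8 * Real.exp (-Real.pi * p.t ^ 2) ≤ 1 / 2) :
    p.excess τ ≤ Real.exp (2 * p.Z * p.kappa * (2 ^ p.K₂)⁻¹ +
      20 * Real.exp (-Real.pi * p.t ^ 2)) := by
  unfold excess
  have hxτ : Real.exp (-Real.pi * τ ^ 2) ≤ Real.exp (-Real.pi * p.t ^ 2) :=
    Real.exp_le_exp.2 (by nlinarith [Real.pi_pos])
  have hx0 := Real.exp_pos (-Real.pi * p.t ^ 2)
  generalize Real.exp (-Real.pi * p.t ^ 2) = x at *
  generalize 2 * (p.Z : ℝ) * p.kappa * (2 ^ p.K₂)⁻¹ = θ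
  have h1 := inv_one_sub_le_exp (y := 8 * x) (by linarith) hx
  have h2 : 1 + 4 * Real.exp (-Real.pi * τ ^ 2) ≤ Real.exp (4 * x) := by
    linarith [Real.add_one_le_exp (4 * x)]
  have h3 : 0 ≤ 1 / (1 - 8 * x) := div_nonneg zero_le_one (by linarith)
  rw [show θ + 20 * x = θ + 2 * (8 * x) + 4 * x by ring, Real.exp_add, Real.exp_add,
    div_eq_mul_one_div]
  exact mul_le_mul (mul_le_mul_of_nonneg_left h1 (Real.exp_pos _).le) h2 (by positivity)
    (by positivity)

theorem natCast_mul_tail_le {m n a : ℕ} (hnm : (n : ℝ) * m ≤ 2 ^ p.Z) (hK : p.K = p.Z + a + 1)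
    (hscale0 : 0 ≤ p.scale) (hscale : p.scale ≤ 2 ^ a) :
    (m * n : ℕ) * gaussianWidth 1 p.inRangeᶜ ≤ ENNReal.ofReal ((2:ℝ) ^ p.Z)⁻¹ := by
  have hsub : p.inRangeᶜ ⊆ {y | (2:ℝ) ^ p.Z ≤ |y|} := by
    intro y hy
    by_contra hlt
    refine hy (?_ : |y * p.scale| + (p.Z + 1) ≤ 2 ^ p.K)
    have hlt' : |y| ≤ 2 ^ p.Z := (not_le.1 hlt).le
    have h1 : (p.Z : ℝ) + 1 ≤ 2 ^ p.Z := by exact_mod_cast (Nat.lt_two_pow_self (n := p.Z))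
    have h2 : (2:ℝ) ^ p.Z ≤ 2 ^ (p.Z + a) := pow_le_pow_right₀ one_le_two (by omega)
    have h3 : |y * p.scale| ≤ 2 ^ (p.Z + a) := by
      rw [abs_mul, abs_of_nonneg hscale0, pow_add]
      exact mul_le_mul hlt' hscale hscale0 (by positivity)
    rw [hK, pow_succ]
    linarith
  have h2Z0 : (0:ℝ) < 2 ^ p.Z := by positivity
  refine (mul_le_mul_right ((measure_mono hsub).trans (gaussianWidth_one_tail_le h2Z0)) _).trans ?_
  rw [← ENNReal.ofReal_natCast, ← ENNReal.ofReal_mul (Nat.cast_nonneg _)]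
  apply ENNReal.ofReal_le_ofReal
  push_cast
  rw [mul_comm (m : ℝ)]
  generalize (2:ℝ) ^ p.Z = X at *
  calc (n : ℝ) * m * (1 / X ^ 2) ≤ X * (1 / X ^ 2) := by gcongr
    _ = X⁻¹ := by field_simp

theorem isGood_of {m n a : ℕ} {h τ : ℝ} (hn : 1 ≤ n) (hm : 1 ≤ m) (hq : 1 ≤ p.q) (hh : 100 ≤ h)
    (hK₂ : p.K₂ = 3 * p.Z) (hK : p.K = p.Z + a + 1) (hscale : p.scale = p.q * τ)
    (hscale_le : p.scale ≤ 2 ^ a) (hnmZ : n + m ≤ p.Z) (htZ : p.t ^ 2 ≤ p.Z) (ht0 : 0 ≤ p.t)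
    (ht : p.t ^ 2 = Real.log m + Real.log n + h) (hτ0 : 0 ≤ τ) (hτ : p.t ^ 2 ≤ τ ^ 2) :
    p.IsGood m n (68 * Real.exp (-h / 2)) := by
  have hlm0 := Real.log_natCast_nonneg m
  have hln0 := Real.log_natCast_nonneg n
  have ht1 : 1 ≤ p.t := by nlinarith
  have hτ1 : 1 ≤ τ := ht1.trans (abs_le_of_sq_le_sq' hτ hτ0).2
  have hnm : (n : ℝ) * m ≤ 2 ^ p.Z := (natCast_mul_le_two_pow n m).trans
    (pow_le_pow_right₀ one_le_two hnmZ)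
  have hnm0 : (0:ℝ) ≤ (n : ℝ) * m := by positivity
  have h2Z : ((2:ℝ) ^ p.Z)⁻¹ ≤ Real.exp (-h / 2) := inv_two_pow_le_exp (by linarith)
  have hEE : Real.exp (-h) = Real.exp (-h / 2) * Real.exp (-h / 2) := by
    rw [← Real.exp_add]; congr 1; ring
  have hE1 : Real.exp (-h / 2) ≤ 1 / 51 := by
    have h1 : 51 ≤ Real.exp (h / 2) := by linarith [Real.add_one_le_exp (h / 2)]
    rw [neg_div, Real.exp_neg, one_div]
    exact inv_anti₀ (by norm_num) h1
  have hE0 := Real.exp_pos (-h / 2)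
  have hxle : (n : ℝ) * m * Real.exp (-Real.pi * p.t ^ 2) ≤ Real.exp (-h) := by
    have hn0 : (0:ℝ) < n := by exact_mod_cast hn
    have hm0 : (0:ℝ) < m := by exact_mod_cast hm
    rw [← Real.exp_log (mul_pos hn0 hm0), ← Real.exp_add, Real.log_mul hn0.ne' hm0.ne', ht]
    apply Real.exp_le_exp.2
    nlinarith [Real.pi_gt_three]
  have hnm1 : (1:ℝ) ≤ (n : ℝ) * m := one_le_mul_of_one_le_of_one_le (by exact_mod_cast hn)
    (by exact_mod_cast hm)
  have hx0 := Real.exp_pos (-Real.pi * p.t ^ 2)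
  have hx1 : Real.exp (-Real.pi * p.t ^ 2) ≤ Real.exp (-h) :=
    (le_mul_of_one_le_left hx0.le hnm1).trans hxle
  have hEE' : Real.exp (-h / 2) * Real.exp (-h / 2) ≤ Real.exp (-h / 2) * (1 / 51) :=
    mul_le_mul_of_nonneg_left hE1 hE0.le
  have hxs : 8 * Real.exp (-Real.pi * p.t ^ 2) ≤ 1 / 2 := by linarith
  have hθ := p.precision_le hnm0 hnm hK₂ ht1
  have hθ0 : 0 ≤ 2 * p.Z * p.kappa * ((2:ℝ) ^ p.K₂)⁻¹ := by
    have := p.kappa_nonneg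
    positivity
  have hexcess := p.excess_le_exp hτ hxs
  have hexcess0 : 0 ≤ p.excess τ := p.excess_nonneg hxs
  have htail := p.natCast_mul_tail_le hnm hK (by rw [hscale]; positivity) hscale_le
  refine ⟨hq, by positivity, ⟨ENNReal.ofReal (p.excess τ), ENNReal.ofReal_ne_top, ?_,
    p.map_roundPair_le hq hτ1 hscale ht1 htZ (by linarith)⟩,
    htail.trans (ENNReal.ofReal_le_ofReal (by linarith))⟩
  rw [← ENNReal.ofReal_pow hexcess0]
  apply ENNReal.ofReal_le_ofReal
  generalize 2 * (p.Z : ℝ) * p.kappa * (2 ^ p.K₂)⁻¹ = θ at *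
  generalize Real.exp (-Real.pi * p.t ^ 2) = x at *
  have hsum : (n : ℝ) * m * (θ + 20 * x) ≤ 34 * Real.exp (-h / 2) := by linarith
  refine (pow_le_pow_left₀ hexcess0 hexcess _).trans ?_
  rw [← Real.exp_nat_mul]
  push_cast
  refine (exp_le_one_add_two_mul (mul_nonneg hnm0 (by linarith)) (by linarith)).trans ?_
  linarith

end RoundingParams

section Good
variable {n m q lam k : ℕ} {f h τ t : ℝ}

theorem reductionParams_scale_le (hτ1 : 1 ≤ τ)
    (hτ : τ ^ 2 = Real.log m + Real.log n + f) (hf : f ≤ Real.exp (Real.log lam ^ k)) :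
    (q : ℝ) * τ ≤ 2 ^ ((Nat.log 2 q + 1) + (n + m) + 2 * (Nat.log 2 lam + 1) ^ k) := by
  have hq : (q : ℝ) ≤ 2 ^ (Nat.log 2 q + 1) := by
    exact_mod_cast (Nat.lt_pow_succ_log_self one_lt_two q).le
  have hlm := Real.log_le_self (Nat.cast_nonneg (α := ℝ) m)
  have hln := Real.log_le_self (Nat.cast_nonneg (α := ℝ) n)
  have hlog0 : 0 ≤ Real.log lam := Real.log_natCast_nonneg lam
  have hf2 : f ≤ 2 ^ (2 * (Nat.log 2 lam + 1) ^ k) := by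
    refine hf.trans (exp_le_two_pow ?_)
    have := pow_le_pow_left₀ hlog0 (log_le_natLog_add_one lam) k
    exact_mod_cast this
  have h1 : τ ≤ (n + m : ℕ) + 2 ^ (2 * (Nat.log 2 lam + 1) ^ k) := by
    push_cast
    nlinarith
  have h2 : ((n + m : ℕ) : ℝ) + 1 ≤ 2 ^ (n + m) := by
    exact_mod_cast (Nat.lt_two_pow_self (n := n + m))
  have h3 : (1:ℝ) ≤ 2 ^ (2 * (Nat.log 2 lam + 1) ^ k) := one_le_pow₀ one_le_two
  have h4 : τ ≤ 2 ^ (n + m) * 2 ^ (2 * (Nat.log 2 lam + 1) ^ k) := by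
    refine h1.trans ((?_ : _ ≤ (((n + m : ℕ) : ℝ) + 1) * 2 ^ (2 * (Nat.log 2 lam + 1) ^ k)).trans
      (mul_le_mul_of_nonneg_right h2 (by positivity)))
    have : (0:ℝ) ≤ (n + m : ℕ) := Nat.cast_nonneg _
    nlinarith
  rw [pow_add, pow_add, mul_assoc]
  exact mul_le_mul hq h4 (by linarith) (by positivity)

theorem isGood_reductionParams (hn : 1 ≤ n) (hm : 1 ≤ m) (hq : 1 ≤ q) (hh : 100 ≤ h)
    (hlog : h ≤ Real.log lam ^ 2) (hhf : h ≤ f) (hτ0 : 0 ≤ τ) (ht0 : 0 ≤ t)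
    (hτ : τ ^ 2 = Real.log m + Real.log n + f) (ht : t ^ 2 = Real.log m + Real.log n + h)
    (hf : f ≤ Real.exp (Real.log lam ^ k)) :
    (reductionParams n m q (Nat.log 2 lam) k τ t).IsGood m n (68 * Real.exp (-h / 2)) := by
  have hlm := Real.log_le_self (Nat.cast_nonneg (α := ℝ) m)
  have hln := Real.log_le_self (Nat.cast_nonneg (α := ℝ) n)
  have hlm0 := Real.log_natCast_nonneg m
  have hln0 := Real.log_natCast_nonneg n
  have hlogZ : Real.log lam ^ 2 ≤ ((Nat.log 2 lam + 1 : ℕ) : ℝ) ^ 2 :=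
    pow_le_pow_left₀ (Real.log_natCast_nonneg lam) (log_le_natLog_add_one lam) 2
  have hZR : ((n + m + (Nat.log 2 lam + 1) ^ 2 : ℕ) : ℝ) =
      n + m + ((Nat.log 2 lam + 1 : ℕ) : ℝ) ^ 2 := by push_cast; ring
  have hτ1 : 1 ≤ τ := by nlinarith
  refine RoundingParams.isGood_of _ hn hm hq hh rfl
    (a := (Nat.log 2 q + 1) + (n + m) + 2 * (Nat.log 2 lam + 1) ^ k) ?_ (τ := τ) rfl
    (reductionParams_scale_le hτ1 hτ hf) (?_ : n + m ≤ n + m + (Nat.log 2 lam + 1) ^ 2)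
    (?_ : t ^ 2 ≤ ((n + m + (Nat.log 2 lam + 1) ^ 2 : ℕ) : ℝ)) ht0 ht hτ0
    (?_ : t ^ 2 ≤ τ ^ 2)
  · change n + m + (Nat.log 2 lam + 1) ^ 2 + (Nat.log 2 q + 1) + (n + m) +
      2 * (Nat.log 2 lam + 1) ^ k + 1 = (n + m + (Nat.log 2 lam + 1) ^ 2) + _ + 1
    ring
  · omega
  · rw [ht, hZR]; linarith
  · rw [ht, hτ]; linarith

end Good

/-! ### Asymptotics -/

theorem IsSuperLog.eventually_ge {f : ℕ → ℝ} (hf : IsSuperLog f) (A : ℝ) :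
    ∀ᶠ l : ℕ in atTop, A * Real.log l ≤ f l := by
  filter_upwards [hf.eventually_ge_atTop A, eventually_gt_atTop 1] with l hl h1
  rwa [le_div_iff₀ (Real.log_pos (by exact_mod_cast h1))] at hl

theorem tendsto_log_natCast : Tendsto (fun l : ℕ => Real.log l) atTop atTop :=
  Real.tendsto_log_atTop.comp tendsto_natCast_atTop_atTop

theorem eventually_min_ge {f g : ℕ → ℝ} (hf : IsSuperLog f) (hg : IsSuperLog g) (A : ℝ) :
    ∀ᶠ l : ℕ in atTop, A * Real.log l ≤ min (f l) (min (g l) (Real.log l ^ 2)) := by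
  filter_upwards [hf.eventually_ge A, hg.eventually_ge A,
    tendsto_log_natCast.eventually_ge_atTop A, tendsto_log_natCast.eventually_ge_atTop 0]
    with l h1 h2 h3 h4
  refine le_min h1 (le_min h2 ?_)
  rw [sq]
  exact mul_le_mul_of_nonneg_right h3 h4

theorem isNegligible_of_eventually_le {h ν : ℕ → ℝ} {B : ℝ}
    (hh : ∀ A : ℝ, ∀ᶠ l : ℕ in atTop, A * Real.log l ≤ h l)
    (hν : ∀ᶠ l in atTop, ν l = B * Real.exp (-h l / 2)) : IsNegligible ν := by
  have key : Asymptotics.SuperpolynomialDecay atTop (fun l : ℕ => (l : ℝ))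
      fun l => Real.exp (-h l / 2) := by
    intro d
    refine squeeze_zero' (Eventually.of_forall fun l => by positivity) ?_
      (tendsto_inv_atTop_zero.comp (tendsto_natCast_atTop_atTop (R := ℝ)))
    filter_upwards [hh (2 * (d + 1)), eventually_gt_atTop 0] with l hl h0
    have hl0 : (0:ℝ) < l := by exact_mod_cast h0
    have h1 : Real.exp (-h l / 2) ≤ Real.exp (-((d + 1 : ℕ) * Real.log l)) := by
      apply Real.exp_le_exp.2
      push_cast
      linarith
    have h2 : Real.exp (-((d + 1 : ℕ) * Real.log l)) = ((l : ℝ) ^ (d + 1))⁻¹ := by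
      rw [Real.exp_neg, Real.exp_nat_mul, Real.exp_log hl0]
    rw [h2] at h1
    refine (mul_le_mul_of_nonneg_left h1 (by positivity)).trans (le_of_eq ?_)
    simp only [Function.comp]
    field_simp
    rw [pow_succ]
  exact (key.const_mul B).congr' (hν.mono fun l hl => hl.symm)

/-! ### Trivial advantages -/

theorem hasDistinguisher_of_nonpos {m n : ℕ} (D₁ D₂ : Measure (Samples m n)) (T : ℕ) {ε : ℝ}
    (hε : ε ≤ 0) : HasDistinguisher D₁ D₂ T ε :=
  ⟨[], ⟨Nat.zero_le _, fun _ _ => Nat.zero_le _⟩, hε.trans (abs_nonneg _)⟩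

theorem HasDistinguisher.le_one {m n : ℕ} {D₁ D₂ : Measure (Samples m n)} [IsProbabilityMeasure D₁]
    [IsProbabilityMeasure D₂] {T : ℕ} {ε : ℝ} (h : HasDistinguisher D₁ D₂ T ε) : ε ≤ 1 := by
  obtain ⟨P, -, hε⟩ := h
  refine hε.trans ?_
  have h0 : ∀ D : Measure (Samples m n), 0 ≤ P.acceptProb D := fun D => measureReal_nonneg
  have h1 : P.acceptProb D₁ ≤ 1 := measureReal_le_one
  have h2 : P.acceptProb D₂ ≤ 1 := measureReal_le_one
  rw [abs_le]
  constructor <;> linarith [h0 D₁, h0 D₂]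

theorem hasSearchSolver_of_nonpos {m n : ℕ} (J : Measure ((Fin n → ℝ) × Samples m n)) (T : ℕ)
    {ε : ℝ} (hε : ε ≤ 0) : HasSearchSolver J T ε :=
  ⟨[], ⟨Nat.zero_le _, fun _ _ => Nat.zero_le _⟩, hε.trans measureReal_nonneg⟩

theorem HasSearchSolver.le_one {m n : ℕ} {J : Measure ((Fin n → ℝ) × Samples m n)}
    [IsProbabilityMeasure J] {T : ℕ} {ε : ℝ} (h : HasSearchSolver J T ε) : ε ≤ 1 := by
  obtain ⟨P, -, hε⟩ := h
  exact hε.trans measureReal_le_one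

/-! ### The reduction -/

theorem not_hasDistinguisher_lweDist_of_one_lt {n m q : ℕ} (hq : 1 ≤ q) (S : PMF (Fin n → ℤ)) (σ : ℝ)
    (T : ℕ) {ε : ℝ} (hε : 1 < ε) :
    ¬ HasDistinguisher (lweDist m q (uniformZModVec n q) S (gaussianWidth σ))
      (nullDist m (uniformZModVec n q) q) T ε := by
  intro hD
  have := RoundingParams.isProbabilityMeasure_uniformZModVec (n := n) hq
  have hJ : IsProbabilityMeasure (lweJoint m q (uniformZModVec n q) S (gaussianWidth σ)) :=
    isProbabilityMeasure_noisyJoint _ _ _ _ _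
  have hL : IsProbabilityMeasure (lweDist m q (uniformZModVec n q) S (gaussianWidth σ)) :=
    Measure.isProbabilityMeasure_map measurable_snd.aemeasurable
  have hN := RoundingParams.isProbabilityMeasure_nullDist (m := m) (uniformZModVec n q)
    (show (0:ℝ) < q by exact_mod_cast hq)
  linarith [hD.le_one]

theorem not_hasSearchSolver_lweJoint_of_one_lt {n m q : ℕ} (hq : 1 ≤ q) (S : PMF (Fin n → ℤ)) (σ : ℝ)
    (T : ℕ) {ε : ℝ} (hε : 1 < ε) :
    ¬ HasSearchSolver (lweJoint m q (uniformZModVec n q) S (gaussianWidth σ)) T ε := by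
  intro hD
  have := RoundingParams.isProbabilityMeasure_uniformZModVec (n := n) hq
  have hJ : IsProbabilityMeasure (lweJoint m q (uniformZModVec n q) S (gaussianWidth σ)) :=
    isProbabilityMeasure_noisyJoint _ _ _ _ _
  linarith [hD.le_one]

theorem sum_sq_eq_of_norm_eq {n : ℕ} {s : Fin n → ℤ} {r : ℝ}
    (h : ‖WithLp.toLp 2 (fun j => (s j : ℝ))‖ = r) : ∑ j, (s j : ℝ) ^ 2 = r ^ 2 := by
  rw [← h, EuclideanSpace.real_norm_sq_eq]

theorem sqrt_sq_add_sq_le_two_mul {a b : ℝ} (hb : 0 ≤ b) (h : 3 * b ≤ a) :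
    √(a ^ 2 + b ^ 2) ≤ 2 * a := by
  rw [Real.sqrt_le_left (by linarith)]
  nlinarith

end

theorem theoremC1 :
    ∃ C : ℝ, 1 ≤ C ∧
      ∀ f g : ℕ → ℝ, IsSuperLog f → IsQuasiPolyBounded f → IsSuperLog g →
        ∃ (p : MvPolynomial (Fin 4) ℕ) (ν : ℕ → ℝ), IsNegligible ν ∧
          ∀ (lam n m q : ℕ) (r β γ : ℝ), 1 ≤ n → 1 ≤ m → 1 ≤ q → 1 ≤ r → 0 < β →
            γ = r * √(Real.log m + Real.log n + f lam) →
            3 * r * √(Real.log m + Real.log n + g lam) ≤ β * q →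
            ∃ σ : ℝ, β * q ≤ σ ∧ σ ≤ C * (β * q) ∧
              ∀ S : PMF (Fin n → ℤ),
                (∀ s ∈ S.support, ‖WithLp.toLp 2 (fun j => (s j : ℝ))‖ = r) →
                ∀ (T : ℕ) (ε : ℝ),
                  (¬ HasDistinguisher
                        (clweDist m (gaussianVec n 1) (scaledSecret (1 / r) S) γ β)
                        (nullDist m (gaussianVec n 1) 1)
                        (T + p.eval ![n, m, Nat.log 2 q, Nat.log 2 lam]) (ε - ν lam) →
                    ¬ HasDistinguisher
                        (lweDist m q (uniformZModVec n q) S (gaussianWidth σ))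
                        (nullDist m (uniformZModVec n q) q) T ε) ∧
                  (¬ HasSearchSolver
                        (clweJoint m (gaussianVec n 1) (scaledSecret (1 / r) S) γ β)
                        (T + p.eval ![n, m, Nat.log 2 q, Nat.log 2 lam]) (ε - ν lam) →
                    ¬ HasSearchSolver
                        (lweJoint m q (uniformZModVec n q) S (gaussianWidth σ)) T ε) := by
  refine ⟨2, one_le_two, fun f g hf hfk hg => ?_⟩
  obtain ⟨k, hk⟩ := hfk
  let h : ℕ → ℝ := fun l => min (f l) (min (g l) (Real.log l ^ 2))
  classical
  refine ⟨reductionPoly k, fun l => if 100 ≤ h l ∧ f l ≤ Real.exp (Real.log l ^ k) then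
    272 * Real.exp (-h l / 2) else 2,
    isNegligible_of_eventually_le (h := h) (B := 272) (eventually_min_ge hf hg) ?_, ?_⟩
  · filter_upwards [hk, eventually_min_ge hf hg 1, tendsto_log_natCast.eventually_ge_atTop 100]
      with l h1 h2 h3
    exact if_pos ⟨by linarith, h1⟩
  intro lam n m q r β γ hn hm hq hr hβ hγ hβq
  have hq0 : (0:ℝ) < q := by exact_mod_cast hq
  have hβq0 : 0 < β * q := mul_pos hβ hq0
  by_cases hc : 100 ≤ h lam ∧ f lam ≤ Real.exp (Real.log lam ^ k)
  · have hf0 : h lam ≤ f lam := min_le_left _ _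
    have hg0 : h lam ≤ g lam := (min_le_right _ _).trans (min_le_left _ _)
    have hl0 : h lam ≤ Real.log lam ^ 2 := (min_le_right _ _).trans (min_le_right _ _)
    have h100 : 100 ≤ h lam := hc.1
    have hlm0 := Real.log_natCast_nonneg m
    have hln0 := Real.log_natCast_nonneg n
    have hν : (if 100 ≤ h lam ∧ f lam ≤ Real.exp (Real.log lam ^ k) then
        272 * Real.exp (-h lam / 2) else 2) = 4 * (68 * Real.exp (-h lam / 2)) := by
      rw [if_pos hc]; ring
    simp only [hν]
    clear_value h
    set τ := √(Real.log m + Real.log n + f lam)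
    set t := √(Real.log m + Real.log n + h lam)
    have hτ2 : τ ^ 2 = Real.log m + Real.log n + f lam := Real.sq_sqrt (by linarith)
    have ht2 : t ^ 2 = Real.log m + Real.log n + h lam := Real.sq_sqrt (by linarith)
    have ht0 : 0 ≤ t := Real.sqrt_nonneg _
    have hgood := isGood_reductionParams (q := q) (τ := τ) (t := t) hn hm hq h100 hl0 hf0 (Real.sqrt_nonneg _) ht0
      hτ2 ht2 hc.2
    have ht : 3 * (r * t) ≤ β * q := by
      refine le_trans ?_ hβq
      rw [mul_assoc]
      have : t ≤ √(Real.log m + Real.log n + g lam) := Real.sqrt_le_sqrt (by linarith)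
      gcongr
    have hσ : √((β * q) ^ 2 + (r * t) ^ 2) ^ 2 = (q * β) ^ 2 + (r * t) ^ 2 := by
      rw [Real.sq_sqrt (by positivity), mul_comm β]
    refine ⟨√((β * q) ^ 2 + (r * t) ^ 2), Real.le_sqrt_of_sq_le (by nlinarith [sq_nonneg (r * t)]),
      sqrt_sq_add_sq_le_two_mul (by positivity) ht, fun S hS T ε => ?_⟩
    have hS' : ∀ s ∈ S.support, ∑ j, (s j : ℝ) ^ 2 = r ^ 2 := fun s hs => sum_sq_eq_of_norm_eq (hS s hs)
    have hr0 : r ≠ 0 := by linarith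
    rw [eval_reductionPoly n m q (Nat.log 2 lam) k τ t]
    exact ⟨mt fun hD => hgood.hasDistinguisher rfl hr0 hγ hσ S hS' (by omega) hD,
      mt fun hD => hgood.hasSearchSolver rfl hr0 hγ hσ S hS' (by omega) hD⟩
  · refine ⟨β * q, le_rfl, by linarith, fun S _ T ε => ?_⟩
    simp only [if_neg hc]
    refine ⟨fun h1 => not_hasDistinguisher_lweDist_of_one_lt hq S _ T ?_,
      fun h1 => not_hasSearchSolver_lweJoint_of_one_lt hq S _ T ?_⟩
    · by_contra hε
      exact h1 (hasDistinguisher_of_nonpos _ _ _ (by linarith))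
    · by_contra hε
      exact h1 (hasSearchSolver_of_nonpos _ _ (by linarith))
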